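/- **Setting.** Let $X$ be a totally ordered set (for instance $X=\mathbb R^d$ with the lexicographic order), let $V$ be the complex vector space with basis the symbols $\varphi(x)$, $x\in X$, and let $U=S(V)$ be the polynomial algebra in the $\varphi(x)$, with counit $\varepsilon$ and coproduct $\Delta$, the algebra morphism with $\Delta a=1\otimes a+a\otimes 1$ for $a\in V$. The *disconnecting coproduct* $\delta:U\to U\otimes U$ is the linear map with $\delta\big(\prod_i\varphi(x_i)^{n_i}\big)=\prod_i\big(1\otimes\varphi(x_i)^{n_i}+\varphi(x_i)^{n_i}\otimes1\big)$ for distinct points $x_i$; write $\delta^{m-1}u=u_{\{1\}}\otimes\dots\otimes u_{\{m\}}$. A *form* is a linear map $U\to\mathbb C$; it is unital if it takes the value $1$ at $1$. Write $*$ and $\hat *$ for the convolution products of forms defined by $\Delta$ and $\delta$. Let $\rho$ be a unital form, and put $$r=\log^{*}\rho=\sum_{n\ge1}\tfrac{(-1)^{n+1}}n(\rho-\varepsilon)^{*n},\qquad \rho_c=\log^{\hat *}\rho=\sum_{n\ge1}\tfrac{(-1)^{n+1}}n(\rho-\varepsilon)^{\hat * n},\qquad D_m(x_1,\dots,x_m)=r(\varphi(x_1)\cdots\varphi(x_m)).$$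 **1PI component.** For a monomial $u=\prod_{i=1}^k\varphi(x_i)^{n_i}$ ($x_i$ distinct, $n_i\ge 1$), $$\rho(u)=\sum_{l\ge 0}\frac1{l!}\sum_{(u_1,\dots,u_l)}\Big(\prod_{i=1}^k\frac{n_i!}{n_i^1!\cdots n_i^l!}\Big)\,r(u_1)\cdots r(u_l),$$ the inner sum being over the $l$-tuples of monomials $u_j=\prod_i\varphi(x_i)^{n_i^j}$ with product $u$. Consider one term, and link two points when some factor $u_j$ contains both. The term is *connected* if the equivalence relation generated by the links has exactly one class on $\{x_1,\dots,x_k\}$. For a subfamily of the factors, the connected component of a point is the set of the factors of the subfamily that contain a point joined to it by a chain of links of the subfamily (the empty set if no factor contains the point). A connected term is *one-particle-reducible* if some factor $u_j$ is a product of distinct symbols $\varphi(x_{i_1})\cdots\varphi(x_{i_p})$ and, in the family of the remaining factors, the components of $x_{i_1},\dots,x_{i_p}$ are pairwise disjoint (empty ones allowed); otherwise it is *1PI*. Then $\rho_I(u)$ is the sum of the 1PI terms, with their coefficients, and $\rho_I$ is extended linearly to $U$. One has $\rho_c(1)=\rho_I(1)=0$. **Characters.** Let $\vee$ be the product of $S(U)$.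 A form $l$ with $l(1)=0$ is extended to a character of $S(U)$, also written $l$, by $l(u)$ for $u\in U$ with $\varepsilon(u)=0$, and by the value $1$ at the unit $1_U$ of $U$ (scalars of $U$ act as scalars); that is, $u\in U$ is sent to $l(u)+\varepsilon(u)$. **Derivations.** For a monomial $u$, let $\frac{\overline\partial u}{\partial\varphi(x)}=\frac{\partial u}{\partial\varphi(x)}$, except that it is $0$ when $u$ is linear in $\varphi(x)$ and $\frac{\partial u}{\partial\varphi(x)}$ is not a scalar; extend linearly. For $m\ge1$, $A_{m-1}$ is the derivation of $S(U)$ with $$A_{m-1}(u)=\sum_{x_1<\dots<x_m}D_m(x_1,\dots,x_m)\,\frac{\overline\partial u_{\{1\}}}{\partial\varphi(x_1)}\vee\dots\vee\frac{\overline\partial u_{\{m\}}}{\partial\varphi(x_m)}\qquad(u\in U).$$ Let $L_n^k=\sum_\alpha\frac{A_0^{\alpha_0}}{\alpha_0!}\cdots\frac{A_n^{\alpha_n}}{\alpha_n!}$, over $\alpha\in\mathbb N^{n+1}$ with $\sum_i\alpha_i=k$ and $\sum_i i\,\alpha_i=n$, and $\mathbf L_\bullet=\sum_{n,k\ge0}L_n^k$.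 **Theorem.** The derivations $A_n$ commute. For every $w\in S(U)$ only finitely many of the $A_n(w)$, of the $\big(\sum_nA_n\big)^k(w)$ and of the $L_n^k(w)$ are nonzero, and, as characters of $S(U)$, $$\rho_c=\rho_I\circ e^{\sum_nA_n}=\rho_I\circ\mathbf L_\bullet,\qquad \rho_I=\rho_c\circ e^{-\sum_nA_n}.$$ -/

import Mathlib

open scoped TensorProduct

noncomputable section

namespace ConnForm

/-- `S(V)`, for the complex vector space `V` with basis the symbols `φ(x)`, `x ∈ X`: the polynomial
algebra over these symbols (`IsSymmetricAlgebra.mvPolynomial`). The symbol `φ(x)` is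
`MvPolynomial.X x` and `∏ φ(x)^(s x)` is `MvPolynomial.monomial s 1`. -/
abbrev U (X : Type*) : Type _ := MvPolynomial X ℂ

/-- `S(U) = S(S(V))`. Its product is the product `∨`, and `SymmetricAlgebra.ι ℂ (U X)` is the
inclusion of `U`. -/
abbrev SU (X : Type*) : Type _ := SymmetricAlgebra ℂ (U X)

/-- Forms: linear maps from `S(V)` to `ℂ`. -/
abbrev Form (X : Type*) : Type _ := U X →ₗ[ℂ] ℂ

/-- The counit `ε` of `S(V)`. -/
def counit (X : Type*) : Form X := (MvPolynomial.aeval (fun _ : X => (0 : ℂ))).toLinearMap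

/-- The linear map on `S(V)` with prescribed values on the monomials. -/
def onMonomials {X : Type*} {M : Type*} [AddCommGroup M] [Module ℂ M] (f : (X →₀ ℕ) → M) :
    U X →ₗ[ℂ] M :=
  (MvPolynomial.basisMonomials X ℂ).constr ℂ f

/-- The coproduct `Δ` of `S(V)`: the algebra morphism with `Δ a = 1 ⊗ a + a ⊗ 1` for `a ∈ V`. -/
def coprod (X : Type*) : U X →ₗ[ℂ] U X ⊗[ℂ] U X :=
  (MvPolynomial.aeval fun x : X =>
    ((1 : U X) ⊗ₜ[ℂ] (MvPolynomial.X x : U X) +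
      (MvPolynomial.X x : U X) ⊗ₜ[ℂ] (1 : U X))).toLinearMap

/-- The disconnecting coproduct `δ`: for distinct points `x₁, …, x_k`,
`δ (φ(x₁)^n₁ ⋯ φ(x_k)^n_k) = ∏ᵢ (1 ⊗ φ(xᵢ)^nᵢ + φ(xᵢ)^nᵢ ⊗ 1)`. -/
def disc (X : Type*) : U X →ₗ[ℂ] U X ⊗[ℂ] U X :=
  onMonomials fun s => s.prod fun x n =>
    ((1 : U X) ⊗ₜ[ℂ] ((MvPolynomial.X x : U X) ^ n) +
      ((MvPolynomial.X x : U X) ^ n) ⊗ₜ[ℂ] (1 : U X))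

/-- The convolution product `f * g = π ∘ (f ⊗ g) ∘ Γ` attached to a coproduct `Γ` on `S(V)`, for
linear maps with values in a commutative algebra `B` with product `π`. -/
def conv {X B : Type*} [CommRing B] [Algebra ℂ B] (Γ : U X →ₗ[ℂ] U X ⊗[ℂ] U X)
    (f g : U X →ₗ[ℂ] B) : U X →ₗ[ℂ] B :=
  LinearMap.mul' ℂ B ∘ₗ TensorProduct.map f g ∘ₗ Γ

/-- Convolution powers of a form. -/
def convPow {X : Type*} (Γ : U X →ₗ[ℂ] U X ⊗[ℂ] U X) (σ : Form X) : ℕ → Form X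
  | 0 => counit X
  | n + 1 => conv Γ (convPow Γ σ n) σ

/-- The convolution logarithm `∑_{n ≥ 1} (-1)^(n+1)/n (ρ - ε)^{*n}` of a unital form `ρ`. For `Γ`
equal to `Δ` or `δ` the power `(ρ - ε)^{*n}` vanishes on the monomials of degree less than `n`, so
that the sum ends at the degree of the monomial. -/
def convLog {X : Type*} (Γ : U X →ₗ[ℂ] U X ⊗[ℂ] U X) (ρ : Form X) : Form X :=
  onMonomials fun s => ∑ n ∈ Finset.Icc 1 s.degree,
    ((-1 : ℂ) ^ (n + 1) / (n : ℂ)) * convPow Γ (ρ - counit X) n (MvPolynomial.monomial s 1)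

/-- The cumulant form `r = log^* ρ`. -/
def cumulant {X : Type*} (ρ : Form X) : Form X := convLog (coprod X) ρ

/-- The connected form `ρ_c`, the logarithm of `ρ` for the disconnecting convolution. -/
def connected {X : Type*} (ρ : Form X) : Form X := convLog (disc X) ρ

/-! ### The 1PI component

A term `r(u₁) ⋯ r(u_l)` of the expansion of `ρ(u) = e^{*r}(u)` at the monomial `u` with exponents
`s` is given by the exponents `e i` of the monomials `u_i`, with `∑ i, e i = s`. -/

/-- Two points are linked by the factors with index in `J` when one of these factors contains both
points. -/
def Linked {X : Type*} {l : ℕ} (e : Fin l → X →₀ ℕ) (J : Set (Fin l)) (x y : X) : Prop :=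
  ∃ m ∈ J, e m x ≠ 0 ∧ e m y ≠ 0

/-- The connected component of the point `x` in the part of the term formed by the factors with
index in `J`: the factors which contain a point joined to `x` by a chain of links. It is empty when
no factor contains `x`. -/
def component {X : Type*} {l : ℕ} (e : Fin l → X →₀ ℕ) (J : Set (Fin l)) (x : X) :
    Set (Fin l) :=
  {m | m ∈ J ∧ ∃ y, Relation.ReflTransGen (Linked e J) x y ∧ e m y ≠ 0}

/-- The term is connected: the equivalence relation generated by the links has exactly one class
on the set of points of `u`. -/
def IsConnectedTerm {X : Type*} {l : ℕ} (s : X →₀ ℕ) (e : Fin l → X →₀ ℕ) : Prop :=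
  s.support.Nonempty ∧
    ∀ x ∈ s.support, ∀ y ∈ s.support, Relation.ReflTransGen (Linked e Set.univ) x y

/-- The term is one-particle-reducible: some factor `u_i` is a product `φ(x_{i₁}) ⋯ φ(x_{i_p})` over
distinct points, and the connected components of these points in the rest of the term are pairwise
disjoint (which includes the empty ones). -/
def IsReducibleTerm {X : Type*} {l : ℕ} (e : Fin l → X →₀ ℕ) : Prop :=
  ∃ i : Fin l, (∀ x, e i x ≤ 1) ∧
    ∀ x y, e i x ≠ 0 → e i y ≠ 0 → x ≠ y → Disjoint (component e {i}ᶜ x) (component e {i}ᶜ y)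

/-- The 1PI terms. -/
def Is1PITerm {X : Type*} {l : ℕ} (s : X →₀ ℕ) (e : Fin l → X →₀ ℕ) : Prop :=
  IsConnectedTerm s e ∧ ¬ IsReducibleTerm e

open scoped Classical in
/-- The 1PI component `ρ_I`: the sum of the 1PI terms of the expansion
`ρ(u) = ∑_l 1/l! ∑_{(u₁, …, u_l)} (∏ₓ n_x! / (n_x^1! ⋯ n_x^l!)) r(u₁) ⋯ r(u_l)`, where `n_x`
and `n_x^i` are the exponents of `φ(x)` in `u` and `u_i` and the inner sum is over the `l`-tuples of
monomials with product `u`. As `r(1) = 0`, only `l` at most the degree of `u` contributes. -/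
def onePI {X : Type*} (ρ : Form X) : Form X :=
  onMonomials fun s => ∑ l ∈ Finset.range (s.degree + 1), ((l.factorial : ℂ))⁻¹ *
    ∑ e ∈ (Finset.piAntidiag (Finset.univ : Finset (Fin l)) s).filter (fun e => Is1PITerm s e),
      ((∏ x ∈ s.support, Nat.multinomial Finset.univ (fun i => e i x) : ℕ) : ℂ) *
        ∏ i, cumulant ρ (MvPolynomial.monomial (e i) 1)

/-- The character of `S(U)` attached to an infinitesimal form `l` (`l(1) = 0`): the algebra morphism
with value `l(u)` at `u ∈ U` with `ε(u) = 0`, and with value `1` at the unit of `U`. -/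
def character {X : Type*} (l : Form X) : SU X →ₐ[ℂ] ℂ :=
  SymmetricAlgebra.lift (l + counit X)

/-! ### The derivations `A_n` -/

/-- The modified derivative with respect to `φ(x)`: on a monomial `u`, it is `∂u/∂φ(x)`, except that
it is `0` if `u` is linear in `φ(x)` and `∂u/∂φ(x)` is not a scalar. -/
def barD {X : Type*} [DecidableEq X] (x : X) : U X →ₗ[ℂ] U X :=
  onMonomials fun s =>
    if s x = 1 ∧ s ≠ Finsupp.single x 1 then 0
    else MvPolynomial.pderiv x (MvPolynomial.monomial s 1)

/-- The `m`-fold disconnecting convolution product: for a list of linear maps `f₁, …, f_m` it is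
`u ↦ f₁(u_{1}) ∨ ⋯ ∨ f_m(u_{m})`, where `u_{1} ⊗ ⋯ ⊗ u_{m}` is the iterated coproduct
`δ^{m-1} u`. The empty list gives the unit of the convolution product. -/
def discConvList {X : Type*} (L : List (U X →ₗ[ℂ] SU X)) : U X →ₗ[ℂ] SU X :=
  L.foldr (conv (disc X)) (Algebra.linearMap ℂ (SU X) ∘ₗ counit X)

/-- The restriction of `A_{m-1}` to `U`:
`u ↦ ∑_{x₁ < ⋯ < x_m} D_m(x₁, …, x_m) ∂̄u_{1}/∂φ(x₁) ∨ ⋯ ∨ ∂̄u_{m}/∂φ(x_m)`, where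
`D_m(x₁, …, x_m) = r(φ(x₁) ⋯ φ(x_m))`. At a monomial `u` only the points of `u` contribute, and the
sum is over the `m`-subsets of the set of these points. -/
def AU {X : Type*} [LinearOrder X] (ρ : Form X) (m : ℕ) : U X →ₗ[ℂ] SU X :=
  onMonomials fun s => ∑ P ∈ s.support.powersetCard m,
    cumulant ρ (∏ x ∈ P, MvPolynomial.X x) •
      discConvList ((P.sort (· ≤ ·)).map fun x => SymmetricAlgebra.ι ℂ (U X) ∘ₗ barD x)
        (MvPolynomial.monomial s 1)

/-- The algebra morphism `w ↦ w + η D(w)` from `S(U)` to `S(U)[η]/(η²)`, for the derivation `D`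
which extends `f`. -/
def dualLift {X : Type*} (f : U X →ₗ[ℂ] SU X) : SU X →ₐ[ℂ] TrivSqZeroExt (SU X) (SU X) :=
  SymmetricAlgebra.lift
    ((TrivSqZeroExt.inlAlgHom ℂ (SU X) (SU X)).toLinearMap ∘ₗ SymmetricAlgebra.ι ℂ (U X) +
      (TrivSqZeroExt.inrHom (SU X) (SU X)).restrictScalars ℂ ∘ₗ f)

theorem fst_dualLift {X : Type*} (f : U X →ₗ[ℂ] SU X) (w : SU X) : (dualLift f w).fst = w := by
  have h : (TrivSqZeroExt.fstHom ℂ (SU X) (SU X)).comp (dualLift f) = AlgHom.id ℂ (SU X) := by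
    apply SymmetricAlgebra.algHom_ext
    refine LinearMap.ext fun u => ?_
    simp [dualLift]
  exact DFunLike.congr_fun h w

/-- The unique derivation of `S(U)` which extends a linear map `f : U → S(U)`. -/
def extendDerivation {X : Type*} (f : U X →ₗ[ℂ] SU X) : Derivation ℂ (SU X) (SU X) where
  toFun w := (dualLift f w).snd
  map_add' a b := by simp
  map_smul' c a := by simp
  map_one_eq_zero' := by simp
  leibniz' a b := by simp [fst_dualLift, mul_comm]

theorem extendDerivation_ι {X : Type*} (f : U X →ₗ[ℂ] SU X) (u : U X) :
    extendDerivation f (SymmetricAlgebra.ι ℂ (U X) u) = f u := by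
  change (dualLift f _).snd = _
  simp [dualLift]

/-- The derivation `A_n` of `S(U)` built from `D_{n+1}`. -/
def A {X : Type*} [LinearOrder X] (ρ : Form X) (n : ℕ) : Derivation ℂ (SU X) (SU X) :=
  extendDerivation (AU ρ (n + 1))

/-- The sum `w ↦ ∑_n A_n(w)`; locally it has finitely many nonzero terms. -/
def sumA {X : Type*} [LinearOrder X] (ρ : Form X) (w : SU X) : SU X :=
  ∑ᶠ n : ℕ, A ρ n w

/-- The exponential `∑_k F^k(w) / k!` of a locally nilpotent operator `F`. -/
def locExp {X : Type*} (F : SU X → SU X) (w : SU X) : SU X :=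
  ∑ᶠ k : ℕ, ((k.factorial : ℂ))⁻¹ • F^[k] w

/-- `L_n^k = ∑_α A_0^{α_0}/α_0! ⋯ A_n^{α_n}/α_n!`, over the sequences `α` with
`α_0 + ⋯ + α_n = k` and `α_1 + 2 α_2 + ⋯ + n α_n = n`. -/
def L {X : Type*} [LinearOrder X] (ρ : Form X) (n k : ℕ) : Module.End ℂ (SU X) :=
  ∑ α ∈ (Finset.piAntidiag (Finset.range (n + 1)) k).filter
      (fun α => ∑ i ∈ Finset.range (n + 1), i * α i = n),
    ((List.range (n + 1)).map fun i =>
      (((α i).factorial : ℂ))⁻¹ • ((A ρ i : Module.End ℂ (SU X)) ^ α i)).prod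

/-- `L_• = ∑_{n,k} L_n^k`. -/
def Ltot {X : Type*} [LinearOrder X] (ρ : Form X) (w : SU X) : SU X :=
  ∑ᶠ p : ℕ × ℕ, L ρ p.1 p.2 w

end ConnForm

end

open scoped TensorProduct

noncomputable section

namespace ConnForm

set_option linter.unusedSectionVars false

/-! ### Monomials and factorials -/

variable {X : Type*}

/-! The forms $\rho_I$ and $\rho_c$ are the values at $t=0$ and $t=1$ of one polynomial family, and
$\sum_n A_n$ is the generator of the flow in $t$.

In the basis of divided powers $\prod\varphi(x)^{n_x}/n_x!$ the expansion of $\rho$ is a sum over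
multisets of nontrivial monomials (`terms`), each with weight $\prod_a R(a)^{k_a}/k_a!$ (`coef`),
where $R$ is the cumulant of the divided power. Both logarithms are handled through the logarithmic
derivative $F\cdot z\,\partial\log F=z\,\partial F$ of a generating series. It gives recursions
which determine $\rho$ from $r$ and $\rho_c$ from $\rho$, and the sums over all terms (`form_dpow`)
and over connected terms (`connected_dpow_res`) satisfy them. The form $\rho_I$ is the sum over the
connected terms with no reducing factor, here called a bridge (`onePI_dpow`).

Give each connected term the weight $t^{b}$, with $b$ its number of bridges: this is `cpoly`. Its
derivative in $t$ marks one bridge. A bridge is a product of distinct symbols over a set $P$; when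
it is removed, the rest falls into one connected piece for each point of $P$, so that it is
described by a retraction of the set of points on $P$ together with a connected term on each fiber.
The other bridges remain bridges of their pieces, and no new ones appear (`bridge_split_iff`). This
gives `derivative_cpoly`. The same sum over retractions describes $A_n$ on monomials (`A_piece`),
because $\delta$ distributes whole points. The convention in $\overline\partial$ says that a point
left without factors must be a piece by itself.

Thus the multiplicative extension $\Phi_t$ of the family satisfies
$\frac{d}{dt}\Phi_t=\Phi_t\circ\sum_nA_n$ (`derivative_polyChar`), and Taylor's formula from $0$ to
$1$ and back gives the two exponential identities.

The $A_n$ commute since two successive removals are described by data symmetric in the two bridges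
(`sum_retr_retr`, `doubleSum_comm`). All sums are locally finite since $A_n$ lowers the degree by
$n+1$. The identity for $\mathbf L_\bullet$ is then the multinomial theorem. -/

@[simp]
theorem onMonomials_monomial {M : Type*} [AddCommGroup M] [Module ℂ M] (f : (X →₀ ℕ) → M)
    (s : X →₀ ℕ) : onMonomials f (MvPolynomial.monomial s 1) = f s := by
  have := (MvPolynomial.basisMonomials X ℂ).constr_basis ℂ f s
  rwa [MvPolynomial.coe_basisMonomials] at this

theorem linearMap_ext_monomial {M : Type*} [AddCommGroup M] [Module ℂ M] {f g : U X →ₗ[ℂ] M}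
    (h : ∀ s, f (MvPolynomial.monomial s 1) = g (MvPolynomial.monomial s 1)) : f = g := by
  refine (MvPolynomial.basisMonomials X ℂ).ext fun s => ?_
  rw [MvPolynomial.coe_basisMonomials]
  exact h s

theorem counit_monomial (s : X →₀ ℕ) [Decidable (s = 0)] :
    counit X (MvPolynomial.monomial s 1) = if s = 0 then 1 else 0 := by
  unfold counit
  simp only [AlgHom.toLinearMap_apply, MvPolynomial.aeval_monomial, map_one, one_mul]
  split_ifs with h
  · simp [h]
  · obtain ⟨x, hx⟩ := Finsupp.support_nonempty_iff.mpr h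
    exact Finset.prod_eq_zero hx (zero_pow (Finsupp.mem_support_iff.mp hx))

/-- The product of the factorials of the exponents. -/
def ffact (s : X →₀ ℕ) : ℂ := ∏ x ∈ s.support, ((s x).factorial : ℂ)

theorem ffact_ne_zero (s : X →₀ ℕ) : ffact s ≠ 0 :=
  Finset.prod_ne_zero_iff.mpr fun _ _ => Nat.cast_ne_zero.mpr (Nat.factorial_ne_zero _)

theorem ffact_eq_prod {s : X →₀ ℕ} {B : Finset X} (h : s.support ⊆ B) :
    ffact s = ∏ x ∈ B, ((s x).factorial : ℂ) := by
  refine Finset.prod_subset h fun x _ hx => ?_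
  simp [Finsupp.notMem_support_iff.mp hx]

@[simp] theorem ffact_zero : ffact (0 : X →₀ ℕ) = 1 := by simp [ffact]

theorem ffact_add_single (s : X →₀ ℕ) (x : X) :
    ffact (s + Finsupp.single x 1) = (s x + 1) * ffact s := by
  classical
  have h1 : (s + Finsupp.single x 1).support ⊆ insert x s.support := by
    intro y hy
    by_cases hyx : y = x
    · simp [hyx]
    · simp_all
  have h2 : s.support ⊆ insert x s.support := Finset.subset_insert _ _
  rw [ffact_eq_prod h1, ffact_eq_prod h2, ← Finset.mul_prod_erase _ _ (Finset.mem_insert_self x _),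
    ← Finset.mul_prod_erase _ _ (Finset.mem_insert_self x _), ← mul_assoc]
  congr 1
  · simp [Nat.factorial_succ]
  · refine Finset.prod_congr rfl fun y hy => ?_
    simp [(Finset.ne_of_mem_erase hy).symm]

/-! ### Restriction of exponents to sets of points -/

section DecEq

variable [DecidableEq X]

/-- The restriction of exponents to the points of `B`. -/
def res (B : Finset X) (s : X →₀ ℕ) : X →₀ ℕ := s.filter (· ∈ B)

@[simp] theorem res_apply (B : Finset X) (s : X →₀ ℕ) (x : X) :
    res B s x = if x ∈ B then s x else 0 := Finsupp.filter_apply ..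

theorem support_res_subset (B : Finset X) (s : X →₀ ℕ) : (res B s).support ⊆ B := by
  intro x hx
  by_contra h
  simp [h] at hx

theorem res_eq_self {B : Finset X} {s : X →₀ ℕ} (h : s.support ⊆ B) : res B s = s := by
  ext x
  rw [res_apply, ite_eq_left_iff]
  exact fun hx => (Finsupp.notMem_support_iff.mp fun h' => hx (h h')).symm

theorem res_res_of_subset {B I : Finset X} (h : I ⊆ B) (s : X →₀ ℕ) :
    res I (res B s) = res I s := by
  ext x
  by_cases hx : x ∈ I <;> simp [hx]
  exact fun h' => absurd (h hx) h'

theorem support_res {B : Finset X} {s : X →₀ ℕ} (h : B ⊆ s.support) : (res B s).support = B := by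
  refine Finset.Subset.antisymm (support_res_subset B s) fun x hx => ?_
  simpa [hx] using h hx

theorem res_congr {B : Finset X} {s t : X →₀ ℕ} (h : ∀ x ∈ B, s x = t x) : res B s = res B t := by
  ext x
  by_cases hx : x ∈ B <;> simp [hx, h]

theorem ffact_res (B : Finset X) (s : X →₀ ℕ) :
    ffact (res B s) = ∏ x ∈ B, ((s x).factorial : ℂ) := by
  rw [ffact_eq_prod (support_res_subset B s)]
  exact Finset.prod_congr rfl fun x hx => by simp [hx]

theorem monomial_res {B : Finset X} {s : X →₀ ℕ} (h : B ⊆ s.support) :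
    (MvPolynomial.monomial (res B s) 1 : U X) = ∏ x ∈ B, MvPolynomial.X x ^ s x := by
  rw [MvPolynomial.monomial_eq, map_one, one_mul, Finsupp.prod, support_res h]
  exact Finset.prod_congr rfl fun x hx => by simp [hx]

/-- The exponents of `∏ x ∈ P, φ(x)`. -/
def ind (P : Finset X) : X →₀ ℕ := ∑ x ∈ P, Finsupp.single x 1

@[simp] theorem ind_apply (P : Finset X) (x : X) : ind P x = if x ∈ P then 1 else 0 := by
  simp [ind, Finsupp.finsetSum_apply, Finsupp.single_apply]

theorem support_ind (P : Finset X) : (ind P).support = P := by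
  ext x
  simp

theorem monomial_ind (P : Finset X) :
    (MvPolynomial.monomial (ind P) 1 : U X) = ∏ x ∈ P, MvPolynomial.X x := by
  rw [MvPolynomial.monomial_eq, map_one, one_mul, Finsupp.prod, support_ind]
  exact Finset.prod_congr rfl fun x hx => by simp [hx]

theorem ffact_ind (P : Finset X) : ffact (ind P) = 1 := by
  rw [ffact, support_ind]
  exact Finset.prod_eq_one fun x hx => by simp [hx]

/-! ### Convolutions on monomials -/

theorem disc_monomial (s : X →₀ ℕ) :
    disc X (MvPolynomial.monomial s 1) = ∑ I ∈ s.support.powerset,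
      (MvPolynomial.monomial (res I s) 1 : U X) ⊗ₜ[ℂ]
        (MvPolynomial.monomial (res (s.support \ I) s) 1 : U X) := by
  rw [disc, onMonomials_monomial, Finsupp.prod]
  simp_rw [add_comm ((1 : U X) ⊗ₜ[ℂ] _)]
  rw [Finset.prod_add]
  refine Finset.sum_congr rfl fun I hI => ?_
  rw [monomial_res (Finset.mem_powerset.mp hI), monomial_res Finset.sdiff_subset]
  have h1 := map_prod (Algebra.TensorProduct.includeLeft : U X →ₐ[ℂ] U X ⊗[ℂ] U X)
    (fun x => (MvPolynomial.X x : U X) ^ s x) I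
  have h2 := map_prod (Algebra.TensorProduct.includeRight : U X →ₐ[ℂ] U X ⊗[ℂ] U X)
    (fun x => (MvPolynomial.X x : U X) ^ s x) (s.support \ I)
  simp only [Algebra.TensorProduct.includeLeft_apply,
    Algebra.TensorProduct.includeRight_apply] at h1 h2
  rw [← h1, ← h2, Algebra.TensorProduct.tmul_mul_tmul, one_mul, mul_one]

theorem conv_disc_monomial {B : Type*} [CommRing B] [Algebra ℂ B] (f g : U X →ₗ[ℂ] B)
    (s : X →₀ ℕ) :
    conv (disc X) f g (MvPolynomial.monomial s 1) = ∑ I ∈ s.support.powerset,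
      f (MvPolynomial.monomial (res I s) 1) *
        g (MvPolynomial.monomial (res (s.support \ I) s) 1) := by
  simp [conv, disc_monomial]

/-- The divided power `∏ φ(x)^(s x) / (s x)!`. -/
def dpow (s : X →₀ ℕ) : U X := (ffact s)⁻¹ • MvPolynomial.monomial s 1

theorem dpow_add_single (s : X →₀ ℕ) (x : X) :
    ((s x : ℂ) + 1) • dpow (s + Finsupp.single x 1) = MvPolynomial.X x * dpow s := by
  have h : ((s x : ℂ) + 1) ≠ 0 := by exact_mod_cast Nat.succ_ne_zero (s x)
  rw [dpow, dpow, ffact_add_single, smul_smul, mul_inv, mul_inv_cancel_left₀ h, mul_smul_comm,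
    MvPolynomial.X, MvPolynomial.monomial_mul, one_mul, add_comm]

/-- Raising the exponent of `x` in the second part misses exactly the decompositions with `b x = 0`,
where `F` vanishes by hypothesis. -/
theorem sum_antidiagonal_add_single {M : Type*} [AddCommMonoid M] (t : X →₀ ℕ) (x : X)
    (F : (X →₀ ℕ) → (X →₀ ℕ) → M) (hF : ∀ a b, b x = 0 → F a b = 0) :
    ∑ p ∈ Finset.HasAntidiagonal.antidiagonal t, F p.1 (p.2 + Finsupp.single x 1) =
      ∑ p ∈ Finset.HasAntidiagonal.antidiagonal (t + Finsupp.single x 1), F p.1 p.2 := by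
  refine Finset.sum_of_injOn (fun p => (p.1, p.2 + Finsupp.single x 1)) ?_ ?_ ?_ ?_
  · intro p _ q _ hpq
    simpa [Prod.ext_iff] using hpq
  · intro p hp
    simp only [Finset.mem_coe, Finset.HasAntidiagonal.mem_antidiagonal] at hp ⊢
    rw [← hp, add_assoc]
  · intro p hp hp'
    refine hF _ _ (by_contra fun h => hp' ?_)
    have h3 : p.2 - Finsupp.single x 1 + Finsupp.single x 1 = p.2 := tsub_add_cancel_of_le (by
      rw [Finsupp.single_le_iff]; exact Nat.one_le_iff_ne_zero.mpr h)
    refine ⟨(p.1, p.2 - Finsupp.single x 1), ?_, by simp [h3]⟩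
    simp only [Finset.mem_coe, Finset.HasAntidiagonal.mem_antidiagonal] at hp ⊢
    refine add_right_cancel (b := Finsupp.single x 1) ?_
    rw [add_assoc, h3, hp]
  · intro p _
    rfl

theorem sum_antidiagonal_swap' {M : Type*} [AddCommMonoid M] (t : X →₀ ℕ)
    (F : (X →₀ ℕ) → (X →₀ ℕ) → M) :
    ∑ p ∈ Finset.HasAntidiagonal.antidiagonal t, F p.1 p.2 =
      ∑ p ∈ Finset.HasAntidiagonal.antidiagonal t, F p.2 p.1 :=
  Finset.sum_nbij' Prod.swap Prod.swap (by simp [add_comm]) (by simp [add_comm])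
    (by simp) (by simp) (by simp)

/-- Divided powers absorb the binomial coefficients of `Δ`. The induction multiplies by one symbol
at a time. -/
theorem coprod_dpow (s : X →₀ ℕ) :
    coprod X (dpow s) =
      ∑ p ∈ Finset.HasAntidiagonal.antidiagonal s, dpow p.1 ⊗ₜ[ℂ] dpow p.2 := by
  induction hd : s.degree generalizing s with
  | zero =>
    obtain rfl : s = 0 := (Finsupp.degree_eq_zero_iff s).mp hd
    simp [coprod, dpow, Algebra.TensorProduct.one_def]
  | succ d ih =>
    have hs : s ≠ 0 := by rintro rfl; simp at hd
    obtain ⟨x, hx⟩ := Finsupp.support_nonempty_iff.mpr hs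
    obtain ⟨t, rfl⟩ : ∃ t, s = t + Finsupp.single x 1 :=
      ⟨s - Finsupp.single x 1, (tsub_add_cancel_of_le (by
        rw [Finsupp.single_le_iff]; exact Nat.one_le_iff_ne_zero.mpr
          (Finsupp.mem_support_iff.mp hx))).symm⟩
    have h : ((t x : ℂ) + 1) ≠ 0 := by exact_mod_cast Nat.succ_ne_zero (t x)
    have ht := ih t (by simpa using hd)
    refine smul_right_injective _ h ?_
    change ((t x : ℂ) + 1) • _ = ((t x : ℂ) + 1) • _
    have hmul : ∀ u, coprod X (MvPolynomial.X x * u) =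
        (((1 : U X) ⊗ₜ[ℂ] (MvPolynomial.X x : U X) +
      (MvPolynomial.X x : U X) ⊗ₜ[ℂ] (1 : U X))) * coprod X u := fun u => by
      simp [coprod]
    rw [← map_smul, dpow_add_single, hmul, ht, add_mul, Finset.mul_sum, Finset.mul_sum,
      Finset.smul_sum]
    simp only [Algebra.TensorProduct.tmul_mul_tmul, one_mul, ← dpow_add_single]
    -- The total exponent `t x + 1` of `x` is shared between the two tensor factors, which matches
    -- the two summands of `Δ φ(x)`.
    have key : ∀ p ∈ Finset.HasAntidiagonal.antidiagonal (t + Finsupp.single x 1),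
        ((t x : ℂ) + 1) • (dpow p.1 ⊗ₜ[ℂ] dpow p.2) =
          (p.2 x : ℂ) • (dpow p.1 ⊗ₜ[ℂ] dpow p.2) + (p.1 x : ℂ) • (dpow p.1 ⊗ₜ[ℂ] dpow p.2) := by
      intro p hp
      rw [← add_smul]
      congr 1
      have := DFunLike.congr_fun (Finset.HasAntidiagonal.mem_antidiagonal.mp hp) x
      simp only [Finsupp.add_apply, Finsupp.single_eq_same] at this
      rw [add_comm (p.2 x : ℂ)]
      exact_mod_cast this.symm
    rw [Finset.sum_congr rfl key, Finset.sum_add_distrib]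
    congr 1
    · rw [← sum_antidiagonal_add_single t x
        (fun a b => (b x : ℂ) • (dpow a ⊗ₜ[ℂ] dpow b)) (fun a b h => by simp [h])]
      simp [TensorProduct.tmul_smul]
    · rw [sum_antidiagonal_swap' _ (fun a b => (a x : ℂ) • (dpow a ⊗ₜ[ℂ] dpow b)),
        ← sum_antidiagonal_add_single t x
        (fun a b => (b x : ℂ) • (dpow b ⊗ₜ[ℂ] dpow a)) (fun a b h => by simp [h]),
        sum_antidiagonal_swap' t (fun a b => (((a x : ℂ) + 1) • dpow (a + Finsupp.single x 1))
          ⊗ₜ[ℂ] dpow b)]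
      simp [TensorProduct.smul_tmul']

theorem conv_coprod_dpow {B : Type*} [CommRing B] [Algebra ℂ B] (f g : U X →ₗ[ℂ] B)
    (s : X →₀ ℕ) :
    conv (coprod X) f g (dpow s) =
      ∑ p ∈ Finset.HasAntidiagonal.antidiagonal s, f (dpow p.1) * g (dpow p.2) := by
  simp [conv, coprod_dpow]

/-! ### The convolution logarithm -/

/-- The derivation `z_x ∂/∂z_x` satisfies `F · z_x ∂(log F) = z_x ∂F`, degree by degree. -/
theorem coeff_mul_pderiv_log (F : MvPowerSeries X ℂ) (hF : MvPowerSeries.constantCoeff F = 1) (x : X)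
    (a : X →₀ ℕ) (M : ℕ) (hM : a.degree ≤ M) :
    MvPowerSeries.coeff a (F * (MvPowerSeries.X x * MvPowerSeries.pderiv ℂ x
      (∑ n ∈ Finset.Icc 1 M, ((-1 : ℂ) ^ (n + 1) / (n : ℂ)) • (F - 1) ^ n))) =
    MvPowerSeries.coeff a (MvPowerSeries.X x * MvPowerSeries.pderiv ℂ x F) := by
  -- The derivative of the truncated logarithm is a truncated geometric series in `1 - F`, times the
  -- derivative of `F`.
  have h1 : MvPowerSeries.pderiv ℂ x (∑ n ∈ Finset.Icc 1 M, ((-1 : ℂ) ^ (n + 1) / (n : ℂ)) • (F - 1) ^ n) =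
      (∑ n ∈ Finset.range M, (1 - F) ^ n) * MvPowerSeries.pderiv ℂ x F := by
    rw [map_sum, Finset.sum_mul, Finset.range_eq_Ico, Finset.sum_Ico_eq_sum_range,
      ← Finset.Ico_add_one_right_eq_Icc, Finset.sum_Ico_eq_sum_range]
    refine Finset.sum_congr (by simp) fun n _ => ?_
    rw [Derivation.map_smul, Derivation.leibniz_pow, map_sub, Derivation.map_one_eq_zero, sub_zero]
    have hn : ((1 + n : ℕ) : ℂ) ≠ 0 := by exact_mod_cast (by omega : 1 + n ≠ 0)
    have h2 : (-1 : ℂ) ^ (1 + n + 1) = (-1) ^ n := by rw [pow_succ, pow_add]; ring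
    rw [h2, ← Nat.cast_smul_eq_nsmul ℂ, smul_smul, div_mul_cancel₀ _ hn]
    simp only [Nat.add_sub_cancel_left, zero_add]
    rw [smul_eq_mul, MvPowerSeries.smul_eq_C_mul, ← neg_sub F 1, neg_pow (F - 1)]
    simp [mul_assoc]
  have h3 : F * (∑ n ∈ Finset.range M, (1 - F) ^ n) = 1 - (1 - F) ^ M := by
    have := mul_neg_geom_sum (1 - F) M
    rwa [sub_sub_cancel] at this
  have h4 : F * (MvPowerSeries.X x * ((∑ n ∈ Finset.range M, (1 - F) ^ n) * MvPowerSeries.pderiv ℂ x F)) =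
      MvPowerSeries.X x * MvPowerSeries.pderiv ℂ x F - (1 - F) ^ M * (MvPowerSeries.X x * MvPowerSeries.pderiv ℂ x F) := by
    linear_combination (MvPowerSeries.X x * MvPowerSeries.pderiv ℂ x F) * h3
  rw [h1, h4, map_sub, sub_eq_self]
  -- The error term has order at least `M + 1`: `M` from `(1 - F) ^ M` and one more from the
  -- variable in front of the derivative.
  refine MvPowerSeries.coeff_of_lt_order ?_
  refine lt_of_lt_of_le ?_ MvPowerSeries.le_order_mul
  have h5 : (M : ℕ∞) ≤ ((1 - F) ^ M).order :=
    MvPowerSeries.le_order_pow_of_constantCoeff_eq_zero M (by simp [hF])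
  have h6 : (1 : ℕ∞) ≤ (MvPowerSeries.X x * MvPowerSeries.pderiv ℂ x F).order := by
    rw [MvPowerSeries.one_le_order_iff_constCoeff_eq_zero]
    simp
  calc (a.degree : ℕ∞) < (M : ℕ∞) + 1 := by exact_mod_cast Nat.lt_succ_of_le hM
    _ ≤ _ := add_le_add h5 h6

theorem coeff_X_mul_pderiv (F : MvPowerSeries X ℂ) (x : X) (a : X →₀ ℕ) :
    MvPowerSeries.coeff a (MvPowerSeries.X x * MvPowerSeries.pderiv ℂ x F) =
      a x * MvPowerSeries.coeff a F := by
  rw [MvPowerSeries.X, MvPowerSeries.coeff_monomial_mul, one_mul]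
  split_ifs with h
  · rw [MvPowerSeries.coeff_pderiv, tsub_add_cancel_of_le h]
    have : 1 ≤ a x := Finsupp.single_le_iff.mp h
    simp [Nat.cast_sub this, mul_comm]
  · have : a x = 0 := by
      by_contra h'
      exact h (Finsupp.single_le_iff.mpr (Nat.one_le_iff_ne_zero.mpr h'))
    simp [this]

/-- Since `(F - 1) ^ n` has order at least `n`, any truncation beyond the degree gives the same
coefficient. One truncation can thus serve all the summands of a recursion, whose degrees differ. -/
theorem coeff_log_eq (F : MvPowerSeries X ℂ) (hF : MvPowerSeries.constantCoeff F = 1)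
    (a : X →₀ ℕ) (M N : ℕ) (hM : a.degree ≤ M) (hMN : M ≤ N) :
    MvPowerSeries.coeff a
      (∑ n ∈ Finset.Icc 1 N, ((-1 : ℂ) ^ (n + 1) / (n : ℂ)) • (F - 1) ^ n) =
    ∑ n ∈ Finset.Icc 1 M, ((-1 : ℂ) ^ (n + 1) / (n : ℂ)) *
      MvPowerSeries.coeff a ((F - 1) ^ n) := by
  rw [map_sum]
  refine (Finset.sum_subset (Finset.Icc_subset_Icc_right hMN) fun n hn hn' => ?_).symm
  simp only [Finset.mem_Icc, not_and, not_le] at hn hn'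
  have : MvPowerSeries.coeff a ((F - 1) ^ n) = 0 := by
    refine MvPowerSeries.coeff_of_lt_order (lt_of_lt_of_le ?_
      (MvPowerSeries.le_order_pow_of_constantCoeff_eq_zero n (by simp [hF])))
    exact_mod_cast hM.trans_lt (hn' hn.1)
  simp [this]

theorem dpow_zero : dpow (0 : X →₀ ℕ) = 1 := by simp [dpow]

theorem monomial_eq_smul_dpow (s : X →₀ ℕ) :
    (MvPolynomial.monomial s 1 : U X) = ffact s • dpow s := by
  rw [dpow, smul_smul, mul_inv_cancel₀ (ffact_ne_zero s), one_smul]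

/-- The exponential generating series of a form. -/
def formSeries (f : Form X) : MvPowerSeries X ℂ := fun a => f (dpow a)

theorem coeff_formSeries (f : Form X) (a : X →₀ ℕ) :
    MvPowerSeries.coeff a (formSeries f) = f (dpow a) := rfl

theorem formSeries_conv (f g : Form X) :
    formSeries (conv (coprod X) f g) = formSeries f * formSeries g := by
  ext a
  rw [coeff_formSeries, conv_coprod_dpow, MvPowerSeries.coeff_mul]
  rfl

theorem formSeries_counit : formSeries (counit X) = 1 := by
  ext a
  rw [coeff_formSeries, dpow, map_smul, counit_monomial, MvPowerSeries.coeff_one]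
  split_ifs with h <;> simp [h]

theorem formSeries_convPow (f : Form X) (n : ℕ) :
    formSeries (convPow (coprod X) f n) = formSeries f ^ n := by
  induction n with
  | zero => rw [convPow, formSeries_counit, pow_zero]
  | succ n ih => rw [convPow, formSeries_conv, ih, pow_succ]

theorem constantCoeff_formSeries (ρ : Form X) (hρ : ρ 1 = 1) :
    MvPowerSeries.constantCoeff (formSeries ρ) = 1 := by
  rw [← MvPowerSeries.coeff_zero_eq_constantCoeff_apply, coeff_formSeries, dpow_zero, hρ]

theorem cumulant_dpow (ρ : Form X) (s : X →₀ ℕ) :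
    cumulant ρ (dpow s) = ∑ n ∈ Finset.Icc 1 s.degree, ((-1 : ℂ) ^ (n + 1) / (n : ℂ)) *
      MvPowerSeries.coeff s ((formSeries ρ - 1) ^ n) := by
  have h : formSeries ρ - 1 = formSeries (ρ - counit X) := by
    rw [← formSeries_counit]; rfl
  rw [dpow, map_smul, cumulant, convLog, onMonomials_monomial, Finset.smul_sum]
  refine Finset.sum_congr rfl fun n _ => ?_
  rw [h, ← formSeries_convPow, coeff_formSeries, dpow, map_smul, smul_eq_mul, smul_eq_mul]
  ring

/-- Coefficient of `s` in $F\cdot z_x\partial_x\log F=z_x\partial_xF$ for the series of `ρ`. It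
determines `ρ` from its cumulants by induction on the degree, without an exponential series. -/
theorem cumulant_recursion (ρ : Form X) (hρ : ρ 1 = 1) (s : X →₀ ℕ) (x : X) :
    s x * ρ (dpow s) = ∑ p ∈ Finset.HasAntidiagonal.antidiagonal s,
      ρ (dpow p.1) * (p.2 x * cumulant ρ (dpow p.2)) := by
  have h0 := constantCoeff_formSeries ρ hρ
  have h := coeff_mul_pderiv_log (formSeries ρ) h0 x s s.degree le_rfl
  rw [coeff_X_mul_pderiv, coeff_formSeries, MvPowerSeries.coeff_mul] at h
  rw [← h]
  refine Finset.sum_congr rfl fun p hp => ?_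
  have hp2 : p.2.degree ≤ s.degree := by
    rw [← Finset.HasAntidiagonal.mem_antidiagonal.mp hp, map_add]
    exact Nat.le_add_left _ _
  rw [coeff_X_mul_pderiv, coeff_formSeries, coeff_log_eq _ h0 _ _ _ le_rfl hp2, cumulant_dpow]

theorem degree_ind (P : Finset X) : (ind P).degree = P.card := by
  rw [Finsupp.degree_apply, support_ind, Finset.card_eq_sum_ones]
  exact Finset.sum_congr rfl fun x hx => by simp [hx]

/-- A squarefree exponent decomposes only into complementary subsets. Hence ordinary products of
power series, read at squarefree exponents, reproduce the convolution of `δ`. -/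
theorem coeff_ind_mul (F G : MvPowerSeries X ℂ) (B : Finset X) :
    MvPowerSeries.coeff (ind B) (F * G) = ∑ I ∈ B.powerset,
      MvPowerSeries.coeff (ind I) F * MvPowerSeries.coeff (ind (B \ I)) G := by
  rw [MvPowerSeries.coeff_mul]
  have key : ∀ p ∈ Finset.HasAntidiagonal.antidiagonal (ind B),
      p.1.support ⊆ B ∧ ind p.1.support = p.1 ∧ ind (B \ p.1.support) = p.2 := by
    intro p hp
    have h : ∀ x, p.1 x + p.2 x = if x ∈ B then 1 else 0 := fun x => by
      rw [← Finsupp.add_apply, Finset.HasAntidiagonal.mem_antidiagonal.mp hp, ind_apply]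
    have hx1 : ∀ x, p.1 x ≠ 0 → x ∈ B ∧ p.1 x = 1 ∧ p.2 x = 0 := fun x hx => by
      have := h x
      split_ifs at this with hB
      · exact ⟨hB, by omega, by omega⟩
      · omega
    refine ⟨fun x hx => (hx1 x (Finsupp.mem_support_iff.mp hx)).1, ?_, ?_⟩
    · ext x
      by_cases hx : p.1 x = 0
      · simp [hx]
      · simp [(hx1 x hx).2.1]
    · ext x
      by_cases hx : p.1 x = 0
      · have := h x
        rw [hx, zero_add] at this
        simp [this, hx]
      · simp [hx, (hx1 x hx).2.2]
  refine Finset.sum_nbij' (fun p => p.1.support) (fun I => (ind I, ind (B \ I))) ?_ ?_ ?_ ?_ ?_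
  · exact fun p hp => Finset.mem_powerset.mpr (key p hp).1
  · intro I hI
    rw [Finset.HasAntidiagonal.mem_antidiagonal]
    ext x
    have hIB : x ∈ I → x ∈ B := fun hx => Finset.mem_powerset.mp hI hx
    by_cases hx : x ∈ I
    · simp [hx, hIB hx]
    · simp [hx]
  · intro p hp
    exact Prod.ext (key p hp).2.1 (key p hp).2.2
  · intro I _
    exact support_ind I
  · intro p hp
    rw [(key p hp).2.1, (key p hp).2.2]

/-- The generating series of the values of a form at the monomials obtained from `∏ φ(x)^(s x)` by
restriction to a set of points. -/
def resSeries (s : X →₀ ℕ) (f : Form X) : MvPowerSeries X ℂ :=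
  fun a => f (MvPolynomial.monomial (res a.support s) 1)

theorem coeff_resSeries (s : X →₀ ℕ) (f : Form X) (B : Finset X) :
    MvPowerSeries.coeff (ind B) (resSeries s f) = f (MvPolynomial.monomial (res B s) 1) := by
  change f (MvPolynomial.monomial (res (ind B).support s) 1) = _
  rw [support_ind]

theorem conv_disc_res {A : Type*} [CommRing A] [Algebra ℂ A] (f g : U X →ₗ[ℂ] A) (s : X →₀ ℕ)
    {B : Finset X} (hB : B ⊆ s.support) :
    conv (disc X) f g (MvPolynomial.monomial (res B s) 1) = ∑ I ∈ B.powerset,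
      f (MvPolynomial.monomial (res I s) 1) * g (MvPolynomial.monomial (res (B \ I) s) 1) := by
  rw [conv_disc_monomial, support_res hB]
  refine Finset.sum_congr rfl fun I hI => ?_
  rw [res_res_of_subset (Finset.mem_powerset.mp hI), res_res_of_subset Finset.sdiff_subset]

theorem res_eq_zero_iff {B : Finset X} {s : X →₀ ℕ} (hB : B ⊆ s.support) :
    res B s = 0 ↔ B = ∅ := by
  rw [← Finsupp.support_eq_empty, support_res hB]

theorem coeff_resSeries_sub_one_pow (s : X →₀ ℕ) (f : Form X) (n : ℕ) {B : Finset X}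
    (hB : B ⊆ s.support) :
    MvPowerSeries.coeff (ind B) ((resSeries s f - 1) ^ n) =
      convPow (disc X) (f - counit X) n (MvPolynomial.monomial (res B s) 1) := by
  have h1 : ∀ I ⊆ s.support, MvPowerSeries.coeff (ind I) (1 : MvPowerSeries X ℂ) =
      counit X (MvPolynomial.monomial (res I s) 1) := by
    intro I hI
    have : ind I = 0 ↔ I = ∅ := by rw [← Finsupp.support_eq_empty, support_ind]
    simp only [MvPowerSeries.coeff_one, counit_monomial, res_eq_zero_iff hI, this]
  induction n generalizing B with
  | zero => rw [pow_zero, convPow, h1 B hB]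
  | succ n ih =>
    rw [pow_succ, coeff_ind_mul, convPow, conv_disc_res _ _ _ hB]
    refine Finset.sum_congr rfl fun I hI => ?_
    have hI := Finset.mem_powerset.mp hI
    rw [ih (hI.trans hB), map_sub, coeff_resSeries, h1 _ (Finset.sdiff_subset.trans hB),
      LinearMap.sub_apply]

/-- The logarithmic derivative again, now at a squarefree exponent: the factor coming from
$z_x\partial_x$ becomes the indicator that `x` lies in the connected part. -/
theorem connected_recursion (ρ : Form X) (hρ : ρ 1 = 1) (s : X →₀ ℕ) {B : Finset X}
    (hB : B ⊆ s.support) {x : X} (hx : x ∈ B) :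
    ρ (MvPolynomial.monomial (res B s) 1) = ∑ I ∈ B.powerset,
      ρ (MvPolynomial.monomial (res I s) 1) *
        (if x ∈ B \ I then connected ρ (MvPolynomial.monomial (res (B \ I) s) 1) else 0) := by
  have h0 : MvPowerSeries.constantCoeff (resSeries s ρ) = 1 := by
    have := coeff_resSeries s ρ ∅
    have h1 : ind (∅ : Finset X) = 0 := by simp [ind]
    have h2 : res (∅ : Finset X) s = 0 := by ext; simp
    rw [h1, h2] at this
    rw [← MvPowerSeries.coeff_zero_eq_constantCoeff_apply, this]
    exact hρ
  -- `convLog` is truncated at the degree of the monomial, whereas the squarefree series needs only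
  -- the number of points, which is not larger.
  have hdeg : ∀ J ⊆ s.support, (ind J).degree ≤ (res J s).degree := by
    intro J hJ
    rw [degree_ind, Finsupp.degree_apply, support_res hJ, Finset.card_eq_sum_ones]
    refine Finset.sum_le_sum fun y hy => ?_
    simpa [hy, Nat.one_le_iff_ne_zero] using hJ hy
  have h := coeff_mul_pderiv_log (resSeries s ρ) h0 x (ind B) _ (hdeg B hB)
  rw [coeff_X_mul_pderiv, coeff_resSeries, coeff_ind_mul, ind_apply, if_pos hx, Nat.cast_one,
    one_mul] at h
  rw [← h]
  refine Finset.sum_congr rfl fun I hI => ?_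
  have hJ : B \ I ⊆ s.support := Finset.sdiff_subset.trans hB
  rw [coeff_X_mul_pderiv, coeff_resSeries, ind_apply]
  congr 1
  split_ifs with hxI
  · rw [Nat.cast_one, one_mul, coeff_log_eq _ h0 _ _ _ (hdeg _ hJ), connected, convLog,
      onMonomials_monomial]
    · refine Finset.sum_congr rfl fun n _ => ?_
      rw [coeff_resSeries_sub_one_pow _ _ _ hJ]
    · rw [Finsupp.degree_apply, Finsupp.degree_apply, support_res hJ, support_res hB]
      refine (Finset.sum_le_sum fun y hy => ?_).trans
        (Finset.sum_le_sum_of_subset Finset.sdiff_subset)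
      simp [hy, (Finset.mem_sdiff.mp hy).1]
  · simp

end DecEq

/-! ### Multisets of factors and their connectivity -/

/-- Multisets of monomials: the terms of the expansion up to the order of the factors. -/
abbrev Fac (X : Type*) : Type _ := (X →₀ ℕ) →₀ ℕ

/-- The exponents of the product of a multiset of monomials. -/
def wt : Fac X →+ (X →₀ ℕ) := Finsupp.weight id

theorem wt_single (a : X →₀ ℕ) (n : ℕ) : wt (Finsupp.single a n) = n • a := by
  simp [wt, Finsupp.weight_single]

theorem le_wt {k : Fac X} {a : X →₀ ℕ} (h : k a ≠ 0) : k a • a ≤ wt k := by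
  classical
  rw [wt, Finsupp.weight_apply, Finsupp.sum]
  exact Finset.single_le_sum (f := fun a => k a • id a) (fun _ _ => zero_le)
    (Finsupp.mem_support_iff.mpr h)

theorem le_wt' {k : Fac X} {a : X →₀ ℕ} (h : k a ≠ 0) : a ≤ wt k := by
  refine le_trans ?_ (le_wt h)
  intro x
  simpa using Nat.le_mul_of_pos_left (a x) (Nat.pos_of_ne_zero h)

/-- The set `T` of points is a union of classes of linked points. -/
def Sat (k : Fac X) (T : Set X) : Prop :=
  ∀ a, k a ≠ 0 → ∀ x y, a x ≠ 0 → a y ≠ 0 → x ∈ T → y ∈ T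

/-- The points `x` and `y` are joined by a chain of links. -/
def Conn (k : Fac X) (x y : X) : Prop := ∀ T, Sat k T → x ∈ T → y ∈ T

/-- This is what makes `Conn` symmetric, although it is defined by one-sided implications. -/
theorem Sat.compl {k : Fac X} {T : Set X} (h : Sat k T) : Sat k Tᶜ :=
  fun a ha x y hx hy hxT hyT => hxT (h a ha y x hy hx hyT)

theorem Conn.refl (k : Fac X) (x : X) : Conn k x x := fun _ _ h => h

theorem Conn.symm {k : Fac X} {x y : X} (h : Conn k x y) : Conn k y x :=
  fun T hT hy => by_contra fun hx => h Tᶜ hT.compl hx hy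

theorem Conn.trans {k : Fac X} {x y z : X} (h : Conn k x y) (h' : Conn k y z) : Conn k x z :=
  fun T hT hx => h' T hT (h T hT hx)

theorem Conn.mono {k k' : Fac X} (hk : ∀ a, k a ≠ 0 → k' a ≠ 0) {x y : X} (h : Conn k x y) :
    Conn k' x y :=
  fun T hT => h T fun a ha => hT a (hk a ha)

theorem Conn.of_mem {k : Fac X} {a : X →₀ ℕ} (ha : k a ≠ 0) {x y : X} (hx : a x ≠ 0)
    (hy : a y ≠ 0) : Conn k x y :=
  fun _ hT => hT a ha x y hx hy

/-- The points of `B` form one class. -/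
def ConnOn (B : Finset X) (k : Fac X) : Prop :=
  B.Nonempty ∧ ∀ x ∈ B, ∀ y ∈ B, Conn k x y

/-- Together with the other factors `k`, the factor `a` makes the term one-particle-reducible. -/
def Bridge (a : X →₀ ℕ) (k : Fac X) : Prop :=
  (∀ x, a x ≤ 1) ∧ ∀ x y, a x ≠ 0 → a y ≠ 0 → x ≠ y → ¬ Conn k x y

open scoped Classical in
/-- The number of factors which make the term one-particle-reducible. -/
def red (k : Fac X) : ℕ := k.sum fun a n => if Bridge a (k - Finsupp.single a 1) then n else 0

/-- The coefficient of a multiset of factors. -/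
def coef (R : (X →₀ ℕ) → ℂ) (k : Fac X) : ℂ := k.prod fun a n => R a ^ n / (n.factorial : ℂ)

@[simp] theorem coef_zero (R : (X →₀ ℕ) → ℂ) : coef R 0 = 1 := by simp [coef]

theorem coef_add_single (R : (X →₀ ℕ) → ℂ) (k : Fac X) (a : X →₀ ℕ) :
    ((k a : ℂ) + 1) * coef R (k + Finsupp.single a 1) = R a * coef R k := by
  classical
  have h1 : (k + Finsupp.single a 1).support ⊆ insert a k.support := by
    intro b hb
    by_cases hba : b = a
    · simp [hba]
    · simp_all
  have h2 : k.support ⊆ insert a k.support := Finset.subset_insert _ _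
  have h0 : ∀ b, R b ^ 0 / (Nat.factorial 0 : ℂ) = 1 := by simp
  have h : ((k a : ℂ) + 1) ≠ 0 := by exact_mod_cast Nat.succ_ne_zero (k a)
  have h' : ((k a).factorial : ℂ) ≠ 0 := Nat.cast_ne_zero.mpr (Nat.factorial_ne_zero _)
  rw [coef, coef, Finsupp.prod_of_support_subset _ h1 _ (fun b _ => h0 b),
    Finsupp.prod_of_support_subset _ h2 _ (fun b _ => h0 b),
    ← Finset.mul_prod_erase _ _ (Finset.mem_insert_self a _),
    ← Finset.mul_prod_erase _ _ (Finset.mem_insert_self a _), ← mul_assoc, ← mul_assoc]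
  congr 1
  · simp only [Finsupp.add_apply, Finsupp.single_eq_same, Nat.factorial_succ, pow_succ,
      Nat.cast_mul, Nat.cast_add, Nat.cast_one]
    field_simp
  · refine Finset.prod_congr rfl fun b hb => ?_
    simp [(Finset.ne_of_mem_erase hb).symm]

theorem coef_add_of_disjoint (R : (X →₀ ℕ) → ℂ) {k k' : Fac X}
    (h : Disjoint k.support k'.support) : coef R (k + k') = coef R k * coef R k' := by
  classical
  exact Finsupp.prod_add_index_of_disjoint h _

/-- The factorials of multiplicities factor over the pieces only because no monomial occurs in two
of them. -/
theorem coef_sum_of_disjoint (R : (X →₀ ℕ) → ℂ) {ι : Type*} (S : Finset ι) (κ : ι → Fac X)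
    (h : ∀ i ∈ S, ∀ j ∈ S, ∀ a, κ i a ≠ 0 → κ j a ≠ 0 → i = j) :
    coef R (∑ i ∈ S, κ i) = ∏ i ∈ S, coef R (κ i) := by
  classical
  induction S using Finset.induction_on with
  | empty => simp
  | insert i S hi ih =>
    rw [Finset.sum_insert hi, Finset.prod_insert hi, coef_add_of_disjoint, ih]
    · exact fun j hj l hl => h j (Finset.mem_insert_of_mem hj) l (Finset.mem_insert_of_mem hl)
    · rw [Finset.disjoint_left]
      intro a ha ha'
      rw [Finsupp.mem_support_iff] at ha ha'
      rw [Finsupp.finsetSum_apply] at ha'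
      obtain ⟨j, hj, hja⟩ := Finset.exists_ne_zero_of_sum_ne_zero ha'
      have := h i (Finset.mem_insert_self i S) j (Finset.mem_insert_of_mem hj) a ha hja
      exact hi (this ▸ hj)

section DecEq

variable [DecidableEq X]

open scoped Classical in
/-- The multisets of nontrivial monomials with product of exponents `s`. -/
def terms (s : X →₀ ℕ) : Finset (Fac X) :=
  ((Finset.Iic s).finsupp fun _ => Finset.range (s.degree + 1)).filter
    fun k => k 0 = 0 ∧ wt k = s

/-- The bounds in `terms` are automatic: each factor divides the product, and `k a` copies of a
nontrivial factor contribute at least `k a` to the degree. This needs `k 0 = 0`. -/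
theorem mem_terms {s : X →₀ ℕ} {k : Fac X} : k ∈ terms s ↔ k 0 = 0 ∧ wt k = s := by
  classical
  rw [terms, Finset.mem_filter, and_iff_right_iff_imp, Finset.mem_finsupp_iff]
  rintro ⟨h0, rfl⟩
  refine ⟨fun a ha => Finset.mem_Iic.mpr (le_wt' (Finsupp.mem_support_iff.mp ha)), fun a _ => ?_⟩
  rw [Finset.mem_range, Nat.lt_succ_iff]
  by_cases ha : k a = 0
  · simp [ha]
  · have ha0 : a ≠ 0 := by rintro rfl; exact ha h0
    obtain ⟨x, hx⟩ := Finsupp.support_nonempty_iff.mpr ha0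
    have h1 := le_wt ha x
    simp only [Finsupp.smul_apply, smul_eq_mul] at h1
    have h2 : (wt k) x ≤ (wt k).degree := Finsupp.le_degree x _
    have h3 : k a ≤ k a * a x :=
      Nat.le_mul_of_pos_right _ (Nat.pos_of_ne_zero (Finsupp.mem_support_iff.mp hx))
    omega

/-! ### Retractions of a set of points on a subset -/

/-- The maps from `B` to `P`, extended by the identity. -/
def maps (B P : Finset X) : Finset (X → X) :=
  Set.Finite.toFinset (s := {g | (∀ z, z ∉ B → g z = z) ∧ ∀ z ∈ B, g z ∈ P}) <| by
    refine Set.Finite.of_injOn (f := fun (g : X → X) (z : B) => g z)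
      (t := Set.pi Set.univ fun _ => (P : Set X)) (fun g hg z _ => hg.2 z z.2) ?_
      (Set.Finite.pi fun _ => P.finite_toSet)
    intro g hg g' hg' h
    funext z
    by_cases hz : z ∈ B
    · exact congrFun h ⟨z, hz⟩
    · rw [hg.1 z hz, hg'.1 z hz]

theorem mem_maps {B P : Finset X} {g : X → X} :
    g ∈ maps B P ↔ (∀ z, z ∉ B → g z = z) ∧ ∀ z ∈ B, g z ∈ P := by
  simp [maps]

/-- The retractions of `B` on `P`, extended by the identity. -/
def retr (B P : Finset X) : Finset (X → X) := (maps B P).filter fun g => ∀ p ∈ P, g p = p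

theorem mem_retr {B P : Finset X} {g : X → X} :
    g ∈ retr B P ↔ (∀ z, z ∉ B → g z = z) ∧ (∀ z ∈ B, g z ∈ P) ∧ ∀ p ∈ P, g p = p := by
  rw [retr, Finset.mem_filter, mem_maps, and_assoc]

/-- The part of `B` which `g` maps to `x`. -/
def fib (B : Finset X) (g : X → X) (x : X) : Finset X := B.filter (g · = x)

theorem mem_fib {B : Finset X} {g : X → X} {x z : X} : z ∈ fib B g x ↔ z ∈ B ∧ g z = x := by
  simp [fib]

open scoped Classical in
/-- The connected part of the expansion at the restriction of `s` to `B`, where `B` may have points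
which occur in no factor; the variable marks the factors which make a term reducible. -/
def cpoly (R : (X →₀ ℕ) → ℂ) (B : Finset X) (s : X →₀ ℕ) : Polynomial ℂ :=
  ∑ k ∈ (terms (res B s)).filter (ConnOn B), Polynomial.monomial (red k) (coef R k)

/-! ### Removal of a bridge -/

theorem support_subset_of_mem_terms {B : Finset X} {s : X →₀ ℕ} {k : Fac X}
    (hk : k ∈ terms (res B s)) {a : X →₀ ℕ} (ha : k a ≠ 0) {x : X} (hx : a x ≠ 0) : x ∈ B := by
  have h1 := le_wt' ha x
  rw [(mem_terms.mp hk).2] at h1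
  by_contra hxB
  simp [hxB] at h1
  exact hx h1

theorem exists_ne_zero_of_mem_terms {s : X →₀ ℕ} {k : Fac X}
    (hk : k ∈ terms s) {a : X →₀ ℕ} (ha : k a ≠ 0) : ∃ x, a x ≠ 0 := by
  by_contra! h
  obtain rfl : a = 0 := Finsupp.ext h
  exact ha (mem_terms.mp hk).1

section Split

variable {B P : Finset X} {s : X →₀ ℕ} {g : X → X} {κ : P → Fac X}

theorem sum_apply_ne_zero_iff {a : X →₀ ℕ} : (∑ x, κ x) a ≠ 0 ↔ ∃ x, κ x a ≠ 0 := by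
  rw [Finsupp.finsetSum_apply, Ne, Finset.sum_eq_zero_iff]
  simp

variable (hPB : P ⊆ B) (hg : g ∈ retr B P)
  (hκ : ∀ x : P, κ x ∈ terms (res (fib B g x) s))
  (hκ' : ∀ x : P, ConnOn (fib B g x) (κ x))

include hκ in
theorem split_mem {x : P} {a : X →₀ ℕ} (ha : κ x a ≠ 0) {z : X} (hz : a z ≠ 0) :
    z ∈ B ∧ g z = x :=
  mem_fib.mp (support_subset_of_mem_terms (hκ x) ha hz)

include hκ in
theorem split_unique {x y : P} {a : X →₀ ℕ} (ha : κ x a ≠ 0) (hy : κ y a ≠ 0) : x = y := by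
  obtain ⟨z, hz⟩ := exists_ne_zero_of_mem_terms (hκ x) ha
  exact Subtype.ext ((split_mem hκ ha hz).2.symm.trans (split_mem hκ hy hz).2)

include hPB hg hκ hκ' in
-- The points of a factor lie in a single fiber of `g`, so fibers are saturated; each is connected
-- by its own piece. The fibers are therefore the classes of the term without its bridge.
theorem conn_sum_iff {x : X} (hx : x ∈ P) {z : X} (hz : z ∈ B) :
    Conn (∑ x, κ x) x z ↔ g z = x := by
  constructor
  · intro h
    refine h {z | g z = x} ?_ ((mem_retr.mp hg).2.2 x hx)
    intro a ha y y' hy hy' hyx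
    obtain ⟨p, hp⟩ := sum_apply_ne_zero_iff.mp ha
    rw [Set.mem_ofPred_eq] at hyx ⊢
    rw [← hyx, (split_mem hκ hp hy).2, (split_mem hκ hp hy').2]
  · intro h
    refine ((hκ' ⟨x, hx⟩).2 x (mem_fib.mpr ⟨hPB hx, (mem_retr.mp hg).2.2 x hx⟩) z
      (mem_fib.mpr ⟨hz, h⟩)).mono fun a ha => sum_apply_ne_zero_iff.mpr ⟨_, ha⟩

include hκ in
-- A piece is recovered from the sum as the factors supported in its fiber. This gives injectivity
-- in `sum_bridge_eq`.
theorem split_apply (x : P) (a : X →₀ ℕ) :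
    κ x a = if a.support ⊆ fib B g x then (∑ x, κ x) a else 0 := by
  rw [Finsupp.finsetSum_apply]
  split_ifs with h
  · symm
    refine Finset.sum_eq_single x (fun y _ hyx => ?_) fun h => absurd (Finset.mem_univ _) h
    by_contra hy
    obtain ⟨z, hz⟩ := exists_ne_zero_of_mem_terms (hκ y) hy
    exact hyx (Subtype.ext ((split_mem hκ hy hz).2.symm.trans
      (mem_fib.mp (h (Finsupp.mem_support_iff.mpr hz))).2))
  · by_contra hx
    exact h fun z hz => mem_fib.mpr (split_mem hκ hx (Finsupp.mem_support_iff.mp hz))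

include hPB hg hκ hκ' in
theorem bridge_ind_sum : Bridge (ind P) (∑ x, κ x) := by
  refine ⟨fun x => by rw [ind_apply]; split_ifs <;> omega, fun x y hx hy hxy h => hxy ?_⟩
  have hx : x ∈ P := by simpa using hx
  have hy : y ∈ P := by simpa using hy
  rw [conn_sum_iff hPB hg hκ hκ' hx (hPB hy), (mem_retr.mp hg).2.2 y hy] at h
  exact h.symm

include hPB hg hκ hκ' in
theorem connOn_add_ind (hP : P.Nonempty) :
    ConnOn B (∑ x, κ x + Finsupp.single (ind P) 1 : Fac X) := by
  have h1 : ∀ z ∈ B, Conn (∑ x, κ x + Finsupp.single (ind P) 1 : Fac X) (g z) z := fun z hz =>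
    ((conn_sum_iff hPB hg hκ hκ' ((mem_retr.mp hg).2.1 z hz) hz).mpr rfl).mono
      fun a ha => by rw [Finsupp.add_apply]; omega
  have h2 : (∑ x, κ x + Finsupp.single (ind P) 1 : Fac X) (ind P) ≠ 0 := by simp
  refine ⟨hP.mono hPB, fun x hx y hy => ((h1 x hx).symm.trans ?_).trans (h1 y hy)⟩
  exact Conn.of_mem h2 (by simp [(mem_retr.mp hg).2.1 x hx]) (by simp [(mem_retr.mp hg).2.1 y hy])

include hg hκ in
theorem sum_mem_terms : ∑ x, κ x ∈ terms (res B s) := by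
  rw [mem_terms]
  constructor
  · rw [Finsupp.finsetSum_apply]
    exact Finset.sum_eq_zero fun x _ => (mem_terms.mp (hκ x)).1
  · rw [map_sum]
    ext z
    rw [Finset.sum_congr rfl fun x _ => (mem_terms.mp (hκ x)).2, Finsupp.finsetSum_apply]
    simp only [res_apply, mem_fib]
    split_ifs with hz
    · simp only [hz, true_and]
      rw [Finset.sum_eq_single ⟨g z, (mem_retr.mp hg).2.1 z hz⟩ _ (by simp)]
      · simp
      · intro y _ hy
        rw [if_neg]
        exact fun h => hy (Subtype.ext h.symm)
    · simp [hz]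

include hκ in
theorem coef_split (R : (X →₀ ℕ) → ℂ) : coef R (∑ x, κ x) = ∏ x, coef R (κ x) :=
  coef_sum_of_disjoint R _ κ fun _ _ _ _ _ => split_unique hκ

include hPB hg hκ in
-- The added factor and the other pieces meet the fiber of `x` at most at the point `x`. They
-- provide no chain between two points of this fiber that the piece of `x` does not already provide.
theorem bridge_split_iff {x : P} {a : X →₀ ℕ} (ha : κ x a ≠ 0) :
    Bridge a (∑ x, κ x + Finsupp.single (ind P) 1 -  Finsupp.single a 1) ↔
      Bridge a (κ x - Finsupp.single a 1) := by
  refine and_congr_right fun _ => forall₄_congr fun y z hy hz => ?_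
  refine forall_congr' fun _ => not_congr ⟨fun h T hT hyT => ?_, fun h => ?_⟩
  · have hy' := split_mem hκ ha hy
    have hz' := split_mem hκ ha hz
    -- the factors other than those of the piece of `x`
    have other : ∀ b, (∑ x, κ x + Finsupp.single (ind P) 1 - Finsupp.single a 1 : Fac X) b ≠ 0 →
        (κ x - Finsupp.single a 1 : Fac X) b ≠ 0 ∨ (∃ y, y ≠ x ∧ κ y b ≠ 0) ∨ b = ind P := by
      intro b hb
      by_contra! hcon
      obtain ⟨h1, h2, h3⟩ := hcon
      apply hb
      have h4 : (∑ x, κ x) b = κ x b := by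
        rw [Finsupp.finsetSum_apply]
        exact Finset.sum_eq_single x (fun y _ hy => h2 y hy) (by simp)
      rw [Finsupp.tsub_apply, Finsupp.add_apply, h4, Finsupp.single_eq_of_ne h3, add_zero,
        ← Finsupp.tsub_apply, h1]
    have hxx := (mem_retr.mp hg).2.2 x x.2
    -- A set `T` saturated for the piece is made saturated for the whole term by deciding what
    -- happens outside the fiber: everything there is added if `x ∈ T`, and everything is discarded
    -- otherwise.
    by_cases hxT : (x : X) ∈ T
    · have := h (T ∪ {w | g w ≠ x}) ?_ (Or.inl hyT)
      · exact this.resolve_right fun h' => h' hz'.2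
      intro b hb u v hu hv huT
      by_cases hgv : g v = x
      swap
      · exact Or.inr hgv
      left
      rcases other b hb with h1 | ⟨p, hp, hpb⟩ | rfl
      · have hb' : κ x b ≠ 0 := fun h0 => h1 (by simp [h0])
        exact hT b h1 u v hu hv (huT.resolve_right fun h' => h' (split_mem hκ hb' hu).2)
      · exact absurd (Subtype.ext ((split_mem hκ hpb hv).2.symm.trans hgv)) hp
      · have hvP : v ∈ P := by simpa using hv
        rwa [← (mem_retr.mp hg).2.2 v hvP, hgv]
    · have := h (T ∩ {w | g w = x}) ?_ ⟨hyT, hy'.2⟩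
      · exact this.1
      rintro b hb u v hu hv ⟨huT, hgu⟩
      rw [Set.mem_ofPred_eq] at hgu
      rcases other b hb with h1 | ⟨p, hp, hpb⟩ | rfl
      · have hb' : κ x b ≠ 0 := fun h0 => h1 (by simp [h0])
        exact ⟨hT b h1 u v hu hv huT, (split_mem hκ hb' hv).2⟩
      · exact absurd (Subtype.ext ((split_mem hκ hpb hu).2.symm.trans hgu)) hp
      · have huP : u ∈ P := by simpa using hu
        rw [(mem_retr.mp hg).2.2 u huP] at hgu
        exact absurd (hgu ▸ huT) hxT
  · refine h.mono fun b hb => ?_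
    have : κ x b ≤ (∑ x, κ x) b := by
      rw [Finsupp.finsetSum_apply]
      exact Finset.single_le_sum (f := fun y => κ y b) (fun _ _ => zero_le) (Finset.mem_univ x)
    simp only [Finsupp.tsub_apply, Finsupp.add_apply] at hb ⊢
    omega

include hPB hg hκ hκ' in
theorem red_split : red (∑ x, κ x + Finsupp.single (ind P) 1) = 1 + ∑ x, red (κ x) := by
  classical
  -- With the bridge condition of the whole term held fixed, the count is additive in the multiset,
  -- even when `ind P` already occurs in a piece (possible if `P` is a single point).
  have hadd : ∀ (h : (X →₀ ℕ) → Prop) (k k' : Fac X),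
      (k + k').sum (fun a n => if h a then n else 0) =
        k.sum (fun a n => if h a then n else 0) + k'.sum (fun a n => if h a then n else 0) := by
    intro h k k'
    exact Finsupp.sum_add_index' (by simp) (by intros; split_ifs <;> simp)
  rw [red, hadd, add_comm]
  congr 1
  · rw [Finsupp.sum_single_index (by simp), add_tsub_cancel_right,
      if_pos (bridge_ind_sum hPB hg hκ hκ')]
  · rw [← Finsupp.sum_finsetSum_index (fun _ => by split_ifs <;> rfl) (by intros; split_ifs <;> simp)]
    refine Finset.sum_congr rfl fun x _ => ?_
    rw [red]
    refine Finsupp.sum_congr fun a ha => ?_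
    rw [bridge_split_iff hPB hg hκ (Finsupp.mem_support_iff.mp ha)]

end Split

/-- The pieces of a term after the removal of a bridge. -/
theorem exists_split {B P : Finset X} {s : X →₀ ℕ} {k : Fac X} (hPB : P ⊆ B) (hP : P.Nonempty)
    (hk : k ∈ terms (res B s)) (hc : ConnOn B (k + Finsupp.single (ind P) 1))
    (hb : Bridge (ind P) k) :
    ∃ g ∈ retr B P, ∃ κ : P → Fac X, (∀ x : P, κ x ∈ terms (res (fib B g x) s)) ∧
      (∀ x : P, ConnOn (fib B g x) (κ x)) ∧ ∑ x, κ x = k := by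
  classical
  have hex : ∀ z ∈ B, ∃ x ∈ P, Conn k x z := by
    intro z hz
    obtain ⟨p, hp⟩ := hP
    -- The points joined to `P` without the bridge form a saturated set of the whole term, so
    -- connectedness makes it contain all of `B`.
    refine hc.2 p (hPB hp) z hz {z | ∃ x ∈ P, Conn k x z} ?_ ⟨p, hp, Conn.refl k p⟩
    rintro a ha u v hu hv ⟨x, hx, hxu⟩
    by_cases hka : k a = 0
    · have haP : a = ind P := by
        by_contra hne
        exact ha (by simp [hka, Finsupp.single_eq_of_ne hne])
      subst haP
      exact ⟨v, by simpa using hv, Conn.refl k v⟩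
    · exact ⟨x, hx, hxu.trans (Conn.of_mem hka hu hv)⟩
  have huniq : ∀ x ∈ P, ∀ y ∈ P, Conn k x y → x = y := fun x hx y hy h =>
    by_contra fun hxy => hb.2 x y (by simpa using hx) (by simpa using hy) hxy h
  choose! f hfP hf using hex
  -- Each point goes to the point of `P` in its class, which is unique by the bridge condition.
  let g : X → X := fun z => if z ∈ B then f z else z
  have hgB : ∀ z ∈ B, g z = f z := fun z hz => if_pos hz
  have hg : g ∈ retr B P := by
    refine mem_retr.mpr ⟨fun z hz => if_neg hz, fun z hz => ?_, fun p hp => ?_⟩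
    · rw [hgB z hz]
      exact hfP z hz
    · rw [hgB p (hPB hp)]
      exact huniq _ (hfP p (hPB hp)) _ hp (hf p (hPB hp))
  have hconn : ∀ y ∈ B, ∀ z ∈ B, Conn k y z → g y = g z := by
    intro y hy z hz h
    rw [hgB y hy, hgB z hz]
    exact huniq _ (hfP y hy) _ (hfP z hz) (((hf y hy).trans h).trans (hf z hz).symm)
  let κ : P → Fac X := fun x => k.filter fun a => a.support ⊆ fib B g x
  have hκ_apply : ∀ x a, κ x a = if a.support ⊆ fib B g x then k a else 0 :=
    fun x a => Finsupp.filter_apply ..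
  -- All the points of a factor are in one fiber, so a single point tells to which piece the factor
  -- belongs.
  have hclass : ∀ a, k a ≠ 0 → ∀ z, a z ≠ 0 → ∀ x : P, a.support ⊆ fib B g x ↔ g z = x := by
    intro a ha z hz x
    have hzB := support_subset_of_mem_terms hk ha hz
    refine ⟨fun h => (mem_fib.mp (h (Finsupp.mem_support_iff.mpr hz))).2, fun h y hy => ?_⟩
    have hy := Finsupp.mem_support_iff.mp hy
    have hyB := support_subset_of_mem_terms hk ha hy
    exact mem_fib.mpr ⟨hyB, (hconn y hyB z hzB (Conn.of_mem ha hy hz)).trans h⟩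
  have hsum : ∑ x, κ x = k := by
    ext a
    rw [Finsupp.finsetSum_apply]
    by_cases ha : k a = 0
    · simp [hκ_apply, ha]
    obtain ⟨z, hz⟩ := exists_ne_zero_of_mem_terms hk ha
    have hzB := support_subset_of_mem_terms hk ha hz
    rw [Finset.sum_eq_single ⟨g z, (mem_retr.mp hg).2.1 z hzB⟩]
    · rw [hκ_apply, if_pos ((hclass a ha z hz _).mpr rfl)]
    · intro y _ hy
      rw [hκ_apply, if_neg]
      exact fun h => hy (Subtype.ext ((hclass a ha z hz y).mp h).symm)
    · exact fun h => absurd (Finset.mem_univ _) h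
  have hκ0 : ∀ x a, κ x a ≠ 0 → k a ≠ 0 ∧ a.support ⊆ fib B g x := by
    intro x a h
    rw [hκ_apply] at h
    split_ifs at h with h'
    · exact ⟨h, h'⟩
    · exact absurd rfl h
  have hwt0 : ∀ (x : P) z, wt (κ x) z ≠ 0 → z ∈ fib B g x := by
    intro x z hz
    rw [wt, Finsupp.weight_apply, Finsupp.sum, Finsupp.finsetSum_apply] at hz
    obtain ⟨a, ha, haz⟩ := Finset.exists_ne_zero_of_sum_ne_zero hz
    refine (hκ0 x a (Finsupp.mem_support_iff.mp ha)).2 (Finsupp.mem_support_iff.mpr fun h => haz ?_)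
    simp [h]
  refine ⟨g, hg, κ, fun x => mem_terms.mpr ⟨?_, ?_⟩, fun x => ?_, hsum⟩
  · rw [hκ_apply, (mem_terms.mp hk).1, ite_self]
  · ext z
    rw [res_apply]
    split_ifs with hz
    · have h1 : wt k z = s z := by
        rw [(mem_terms.mp hk).2, res_apply, if_pos (mem_fib.mp hz).1]
      rw [← h1, ← hsum, map_sum, Finsupp.finsetSum_apply]
      symm
      refine Finset.sum_eq_single x (fun y _ hy => ?_) fun h => absurd (Finset.mem_univ _) h
      by_contra hne
      exact hy (Subtype.ext ((mem_fib.mp (hwt0 y z hne)).2.symm.trans (mem_fib.mp hz).2))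
    · by_contra hne
      exact hz (hwt0 x z hne)
  · have hxx := (mem_retr.mp hg).2.2 x x.2
    have hx : ∀ z ∈ fib B g x, Conn (κ x) x z := by
      intro z hz T hT hxT
      have hz' := mem_fib.mp hz
      have hkz : Conn k x z := by
        have := hf z hz'.1
        rwa [← hgB z hz'.1, hz'.2] at this
      -- Chains of `k` which start at `x` stay in its fiber and use only factors of its piece.
      refine (hkz (T ∩ fib B g x) ?_ ⟨hxT, mem_fib.mpr ⟨hPB x.2, hxx⟩⟩).1
      rintro a ha u v hu hv ⟨huT, huF⟩
      have h1 := (hclass a ha u hu x).mpr (mem_fib.mp huF).2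
      refine ⟨hT a ?_ u v hu hv huT, h1 (Finsupp.mem_support_iff.mpr hv)⟩
      rwa [hκ_apply, if_pos h1]
    exact ⟨⟨x, mem_fib.mpr ⟨hPB x.2, hxx⟩⟩, fun y hy z hz => (hx y hy).symm.trans (hx z hz)⟩

theorem monomial_prod {ι : Type*} (S : Finset ι) (n : ι → ℕ) (c : ι → ℂ) :
    ∏ i ∈ S, Polynomial.monomial (n i) (c i) =
      Polynomial.monomial (∑ i ∈ S, n i) (∏ i ∈ S, c i) := by
  classical
  induction S using Finset.induction_on with
  | empty => simp
  | insert i S hi ih =>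
    rw [Finset.prod_insert hi, ih, Polynomial.monomial_mul_monomial, Finset.sum_insert hi,
      Finset.prod_insert hi]

open scoped Classical in
-- Removing the bridge and gluing the pieces back are inverse bijections. Here `k` is the term
-- without the bridge; weights multiply over pieces, and the exponents of the variable add up once
-- the bridge itself is discounted.
theorem sum_bridge_eq (R : (X →₀ ℕ) → ℂ) {B P : Finset X} (s : X →₀ ℕ) (hPB : P ⊆ B)
    (hP : P.Nonempty) :
    ∑ k ∈ (terms (res B s)).filter
        (fun k => ConnOn B (k + Finsupp.single (ind P) 1) ∧ Bridge (ind P) k),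
      Polynomial.monomial (red (k + Finsupp.single (ind P) 1) - 1) (coef R k) =
    ∑ g ∈ retr B P, ∏ x ∈ P, cpoly R (fib B g x) s := by
  have h1 : ∀ g ∈ retr B P, ∏ x ∈ P, cpoly R (fib B g x) s =
      ∑ κ ∈ Fintype.piFinset fun x : P => (terms (res (fib B g x) s)).filter (ConnOn (fib B g x)),
        Polynomial.monomial (∑ x, red (κ x)) (∏ x, coef R (κ x)) := by
    intro g _
    rw [← Finset.prod_coe_sort]
    simp only [cpoly]
    rw [Finset.prod_univ_sum]
    exact Finset.sum_congr rfl fun κ _ => monomial_prod _ _ _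
  rw [Finset.sum_congr rfl h1, Finset.sum_sigma']
  symm
  refine Finset.sum_bij (fun q _ => (∑ x : P, q.2 x : Fac X)) ?_ ?_ ?_ ?_
  · rintro ⟨g, κ⟩ hq
    simp only [Finset.mem_sigma, Fintype.mem_piFinset, Finset.mem_filter] at hq ⊢
    obtain ⟨hg, hκ⟩ := hq
    exact ⟨sum_mem_terms hg fun x => (hκ x).1,
      connOn_add_ind hPB hg (fun x => (hκ x).1) (fun x => (hκ x).2) hP,
      bridge_ind_sum hPB hg (fun x => (hκ x).1) (fun x => (hκ x).2)⟩
  · rintro ⟨g, κ⟩ hq ⟨g', κ'⟩ hq' heq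
    simp only [Finset.mem_sigma, Fintype.mem_piFinset, Finset.mem_filter] at hq hq' heq
    obtain ⟨hg, hκ⟩ := hq
    obtain ⟨hg', hκ'⟩ := hq'
    obtain rfl : g = g' := by
      funext z
      by_cases hz : z ∈ B
      · have h2 := (conn_sum_iff hPB hg (fun x => (hκ x).1) (fun x => (hκ x).2)
          ((mem_retr.mp hg).2.1 z hz) hz).mpr rfl
        rw [heq, conn_sum_iff hPB hg' (fun x => (hκ' x).1) (fun x => (hκ' x).2)
          ((mem_retr.mp hg).2.1 z hz) hz] at h2
        exact h2.symm
      · rw [(mem_retr.mp hg).1 z hz, (mem_retr.mp hg').1 z hz]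
    congr 1
    funext x
    ext a
    rw [split_apply (fun x => (hκ x).1) x a, split_apply (fun x => (hκ' x).1) x a, heq]
  · intro k hk
    simp only [Finset.mem_filter] at hk
    obtain ⟨g, hg, κ, h2, h3, h4⟩ := exists_split hPB hP hk.1 hk.2.1 hk.2.2
    refine ⟨⟨g, κ⟩, ?_, h4⟩
    simp only [Finset.mem_sigma, Fintype.mem_piFinset, Finset.mem_filter]
    exact ⟨hg, fun x => ⟨h2 x, h3 x⟩⟩
  · rintro ⟨g, κ⟩ hq
    simp only [Finset.mem_sigma, Fintype.mem_piFinset, Finset.mem_filter] at hq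
    obtain ⟨hg, hκ⟩ := hq
    simp only
    rw [red_split hPB hg (fun x => (hκ x).1) (fun x => (hκ x).2), add_tsub_cancel_left,
      coef_split fun x => (hκ x).1]

/-! ### The derivative of the connected polynomial -/

theorem single_le_of_ne_zero {k : Fac X} {a : X →₀ ℕ} (h : k a ≠ 0) : Finsupp.single a 1 ≤ k :=
  Finsupp.single_le_iff.mpr (Nat.one_le_iff_ne_zero.mpr h)

/-- Marking one of the `k a` equal copies of `a` and removing it: $n\,R^n/n!=R\cdot R^{n-1}/(n-1)!$.
-/
theorem coef_mul_apply (R : (X →₀ ℕ) → ℂ) (k : Fac X) {a : X →₀ ℕ} (h : k a ≠ 0) :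
    coef R k * k a = R a * coef R (k - Finsupp.single a 1) := by
  obtain ⟨k', rfl⟩ : ∃ k', k = k' + Finsupp.single a 1 :=
    ⟨k - Finsupp.single a 1, (tsub_add_cancel_of_le (single_le_of_ne_zero h)).symm⟩
  rw [add_tsub_cancel_right, ← coef_add_single, mul_comm]
  simp

theorem Bridge.eq_ind {a : X →₀ ℕ} {k : Fac X} (h : Bridge a k) : a = ind a.support := by
  ext x
  have := h.1 x
  rw [ind_apply]
  split_ifs with hx <;> rw [Finsupp.mem_support_iff] at hx <;> omega

open scoped Classical in
-- Differentiation brings down the number of bridges, that is, it marks one of them. Bridges are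
-- squarefree, hence of the form `ind P`, and `sum_bridge_eq` describes what is left.
theorem derivative_cpoly (R : (X →₀ ℕ) → ℂ) (B : Finset X) (s : X →₀ ℕ) :
    Polynomial.derivative (cpoly R B s) =
      ∑ P ∈ B.powerset.filter (fun P => P.Nonempty ∧ ind P ≤ s), Polynomial.C (R (ind P)) *
        ∑ g ∈ retr B P, ∏ x ∈ P, cpoly R (fib B g x) (s - ind P) := by
  have h1 : ∀ k ∈ (terms (res B s)).filter (ConnOn B),
      Polynomial.derivative (Polynomial.monomial (red k) (coef R k)) =
      ∑ a ∈ k.support.filter (fun a => Bridge a (k - Finsupp.single a 1)),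
        Polynomial.monomial (red k - 1) (R a * coef R (k - Finsupp.single a 1)) := by
    intro k _
    rw [Polynomial.derivative_monomial, ← map_sum]
    congr 1
    rw [red, Finsupp.sum, ← Finset.sum_filter, Nat.cast_sum, Finset.mul_sum]
    refine Finset.sum_congr rfl fun a ha => ?_
    exact coef_mul_apply R k (Finsupp.mem_support_iff.mp (Finset.mem_filter.mp ha).1)
  have h2 : ∀ P ∈ B.powerset.filter (fun P => P.Nonempty ∧ ind P ≤ s), Polynomial.C (R (ind P)) *
        ∑ g ∈ retr B P, ∏ x ∈ P, cpoly R (fib B g x) (s - ind P) =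
      ∑ k ∈ (terms (res B (s - ind P))).filter
        (fun k => ConnOn B (k + Finsupp.single (ind P) 1) ∧ Bridge (ind P) k),
      Polynomial.monomial (red (k + Finsupp.single (ind P) 1) - 1) (R (ind P) * coef R k) := by
    intro P hP
    obtain ⟨hPB, hP, -⟩ := Finset.mem_filter.mp hP
    rw [← sum_bridge_eq R _ (Finset.mem_powerset.mp hPB) hP, Finset.mul_sum]
    exact Finset.sum_congr rfl fun k _ => Polynomial.C_mul_monomial ..
  rw [cpoly, map_sum, Finset.sum_congr rfl h1, Finset.sum_congr rfl h2, Finset.sum_sigma',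
    Finset.sum_sigma']
  have hres : ∀ P : Finset X, P ⊆ B → ind P ≤ s → res B (s - ind P) + ind P = res B s := by
    intro P hPB hPs
    ext x
    have := hPs x
    rw [ind_apply] at this
    by_cases hx : x ∈ P
    · rw [if_pos hx] at this
      simp only [Finsupp.add_apply, res_apply, Finsupp.tsub_apply, ind_apply, if_pos hx,
        if_pos (hPB hx)]
      omega
    · simp [hx]
  -- Pairs (term, marked bridge) correspond to pairs (points of the bridge, term without it).
  refine Finset.sum_bij' (fun q _ => ⟨q.2.support, q.1 - Finsupp.single q.2 1⟩)
    (fun q _ => ⟨q.2 + Finsupp.single (ind q.1) 1, ind q.1⟩) ?_ ?_ ?_ ?_ ?_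
  · rintro ⟨k, a⟩ hq
    simp only [Finset.mem_sigma, Finset.mem_filter, Finset.mem_powerset,
      Finsupp.mem_support_iff] at hq ⊢
    obtain ⟨⟨hk, hc⟩, ha, hb⟩ := hq
    have hka := tsub_add_cancel_of_le (single_le_of_ne_zero ha)
    have haB : a.support ⊆ B := fun x hx =>
      support_subset_of_mem_terms hk ha (Finsupp.mem_support_iff.mp hx)
    have hwt := le_wt' ha
    rw [(mem_terms.mp hk).2] at hwt
    have has : ind a.support ≤ s := by
      rw [← hb.eq_ind]
      refine hwt.trans fun x => ?_
      rw [res_apply]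
      split_ifs <;> simp
    rw [← hb.eq_ind, hka]
    rw [← hb.eq_ind] at has
    refine ⟨⟨haB, ?_, has⟩, mem_terms.mpr ⟨?_, ?_⟩, hc, hb⟩
    · obtain ⟨x, hx⟩ := exists_ne_zero_of_mem_terms hk ha
      exact ⟨x, Finsupp.mem_support_iff.mpr hx⟩
    · rw [Finsupp.tsub_apply, (mem_terms.mp hk).1, zero_tsub]
    · have h3 := hres a.support haB (by rwa [← hb.eq_ind])
      rw [← hb.eq_ind] at h3
      refine add_right_cancel (b := a) ?_
      rw [h3, ← (mem_terms.mp hk).2, ← hka, map_add, wt_single, one_smul]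
      simp
  · rintro ⟨P, k⟩ hq
    simp only [Finset.mem_sigma, Finset.mem_filter, Finset.mem_powerset,
      Finsupp.mem_support_iff] at hq ⊢
    obtain ⟨⟨hPB, hP, hPs⟩, hk, hc, hb⟩ := hq
    have hP0 : ind P ≠ 0 := by
      rw [← Finsupp.support_nonempty_iff, support_ind]
      exact hP
    refine ⟨⟨mem_terms.mpr ⟨?_, ?_⟩, hc⟩, ?_, ?_⟩
    · rw [Finsupp.add_apply, (mem_terms.mp hk).1, Finsupp.single_eq_of_ne hP0.symm, add_zero]
    · rw [map_add, (mem_terms.mp hk).2, wt_single, one_smul, hres P hPB hPs]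
    · simp
    · rwa [add_tsub_cancel_right]
  · rintro ⟨k, a⟩ hq
    simp only [Finset.mem_sigma, Finset.mem_filter, Finsupp.mem_support_iff] at hq
    obtain ⟨-, ha, hb⟩ := hq
    simp only
    rw [← hb.eq_ind, tsub_add_cancel_of_le (single_le_of_ne_zero ha)]
  · rintro ⟨P, k⟩ hq
    simp only
    rw [add_tsub_cancel_right, support_ind]
  · rintro ⟨k, a⟩ hq
    simp only [Finset.mem_sigma, Finset.mem_filter, Finsupp.mem_support_iff] at hq
    obtain ⟨-, ha, hb⟩ := hq
    simp only
    rw [← hb.eq_ind, tsub_add_cancel_of_le (single_le_of_ne_zero ha)]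

end DecEq

/-! ### The derivations on connected pieces -/

theorem derivation_prod {ι : Type*} [DecidableEq ι] (D : Derivation ℂ (SU X) (SU X))
    (S : Finset ι) (f : ι → SU X) :
    D (∏ i ∈ S, f i) = ∑ i ∈ S, (∏ j ∈ S.erase i, f j) * D (f i) := by
  induction S using Finset.induction_on with
  | empty => simp
  | insert i S hi ih =>
    rw [Finset.prod_insert hi, Derivation.leibniz, ih, Finset.sum_insert hi,
      Finset.erase_insert hi, smul_eq_mul, smul_eq_mul, add_comm, Finset.mul_sum]
    congr 1
    refine Finset.sum_congr rfl fun j hj => ?_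
    have hij : i ≠ j := by rintro rfl; exact hi hj
    rw [Finset.erase_insert_of_ne hij, Finset.prod_insert (by simp [hi]), mul_assoc]

theorem SU_induction {p : SU X → Prop} (h1 : p 1)
    (hmul : ∀ s w, p w → p (SymmetricAlgebra.ι ℂ (U X) (MvPolynomial.monomial s 1) * w))
    (hadd : ∀ v w, p v → p w → p (v + w)) (hsmul : ∀ (c : ℂ) w, p w → p (c • w)) (w : SU X) :
    p w := by
  have h0 : p 0 := by simpa using hsmul 0 1 h1
  have hι : ∀ u w, p w → p (SymmetricAlgebra.ι ℂ (U X) u * w) := by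
    intro u w hw
    induction u using MvPolynomial.induction_on' with
    | monomial s c =>
      have : (MvPolynomial.monomial s c : U X) = c • MvPolynomial.monomial s 1 := by
        rw [MvPolynomial.smul_monomial, smul_eq_mul, mul_one]
      rw [this, map_smul, smul_mul_assoc]
      exact hsmul _ _ (hmul s w hw)
    | add u v hu hv =>
      rw [map_add, add_mul]
      exact hadd _ _ hu hv
  suffices h : ∀ v w, p w → p (v * w) by simpa using h w 1 h1
  intro v
  induction v using SymmetricAlgebra.induction with
  | algebraMap c =>
    intro w hw
    rw [← Algebra.smul_def]
    exact hsmul c w hw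
  | ι u => exact hι u
  | mul a b ha hb =>
    intro w hw
    rw [mul_assoc]
    exact ha _ (hb _ hw)
  | add a b ha hb =>
    intro w hw
    rw [add_mul]
    exact hadd _ _ (ha _ hw) (hb _ hw)

theorem derivation_eq_zero {D : Derivation ℂ (SU X) (SU X)}
    (h : ∀ s, D (SymmetricAlgebra.ι ℂ (U X) (MvPolynomial.monomial s 1)) = 0) (w : SU X) :
    D w = 0 := by
  induction w using SU_induction with
  | h1 => simp
  | hmul s w hw => rw [Derivation.leibniz, h, hw, smul_zero, smul_zero, add_zero]
  | hadd v w hv hw => rw [map_add, hv, hw, add_zero]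
  | hsmul c w hw => rw [Derivation.map_smul, hw, smul_zero]

section DecEq

variable [DecidableEq X]

theorem barD_dpow (x : X) (t : X →₀ ℕ) : barD x (dpow t) =
    if t x = 0 ∨ (t x = 1 ∧ t ≠ Finsupp.single x 1) then 0
    else dpow (t - Finsupp.single x 1) := by
  rw [dpow, map_smul, barD, onMonomials_monomial]
  by_cases h0 : t x = 0
  · simp [h0, MvPolynomial.pderiv_monomial]
  by_cases h1 : t x = 1 ∧ t ≠ Finsupp.single x 1
  · simp [h1]
  rw [if_neg h1, if_neg (by tauto), MvPolynomial.pderiv_monomial, one_mul]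
  obtain ⟨t', rfl⟩ : ∃ t', t = t' + Finsupp.single x 1 :=
    ⟨t - Finsupp.single x 1, (tsub_add_cancel_of_le
      (Finsupp.single_le_iff.mpr (Nat.one_le_iff_ne_zero.mpr h0))).symm⟩
  have h : ((t' x : ℂ) + 1) ≠ 0 := by exact_mod_cast Nat.succ_ne_zero (t' x)
  rw [add_tsub_cancel_right, dpow, ffact_add_single, MvPolynomial.smul_monomial,
    MvPolynomial.smul_monomial, smul_eq_mul, smul_eq_mul]
  congr 1
  simp only [Finsupp.add_apply, Finsupp.single_eq_same, Nat.cast_add, Nat.cast_one, mul_inv]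
  field_simp

/-- The element of `U` attached to the restriction of `s` to `B`: it vanishes if some point of `B`
does not occur in `s`, unless this is the only point of `B`. -/
def piece (B : Finset X) (s : X →₀ ℕ) : SU X :=
  if (res B s).support = B ∨ (B.card = 1 ∧ res B s = 0) then
    SymmetricAlgebra.ι ℂ (U X) (dpow (res B s)) else 0

theorem piece_eq_zero {B : Finset X} {s : X →₀ ℕ} {z : X} (hz : z ∈ B) (hs : s z = 0)
    (hB : B.card ≠ 1) : piece B s = 0 := by
  rw [piece, if_neg]
  rintro (h | h)
  · rw [← h] at hz
    simp [hs] at hz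
  · exact hB h.1

theorem piece_of_subset {B : Finset X} {s : X →₀ ℕ} (h : B ⊆ s.support) :
    piece B s = SymmetricAlgebra.ι ℂ (U X) (dpow (res B s)) :=
  if_pos (Or.inl (support_res h))

theorem piece_congr {B : Finset X} {s t : X →₀ ℕ} (h : ∀ x ∈ B, s x = t x) :
    piece B s = piece B t := by
  rw [piece, piece, res_congr h]

/-- The convention in $\overline\partial$ and that of `piece` agree. If the only occurrence of `x`
is removed, `x` remains as a point without factors, which is allowed only when it is the whole
piece. -/
theorem ι_barD_dpow_res {I : Finset X} {s : X →₀ ℕ} (hI : I ⊆ s.support) {x : X} (hx : x ∈ I) :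
    SymmetricAlgebra.ι ℂ (U X) (barD x (dpow (res I s))) =
      piece I (s - Finsupp.single x 1) := by
  have hres : res I (s - Finsupp.single x 1) = res I s - Finsupp.single x 1 := by
    ext y
    by_cases hy : y ∈ I
    · simp [hy]
    · simp [hy]
  have hsx : s x ≠ 0 := Finsupp.mem_support_iff.mp (hI hx)
  have htx : res I s x = s x := by simp [hx]
  rw [barD_dpow, htx]
  by_cases h1 : s x = 1 ∧ res I s ≠ Finsupp.single x 1
  · rw [if_pos (Or.inr h1), map_zero, piece_eq_zero hx (by simp [h1.1])]
    intro hc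
    obtain ⟨y, rfl⟩ := Finset.card_eq_one.mp hc
    obtain rfl := Finset.mem_singleton.mp hx
    refine h1.2 ?_
    ext z
    by_cases hz : z = x
    · subst hz; simp [h1.1]
    · simp [hz]
  · rw [if_neg (by tauto), piece, hres, if_pos]
    by_cases h2 : s x = 1
    · have h3 : res I s = Finsupp.single x 1 := by tauto
      right
      rw [h3, tsub_self]
      refine ⟨?_, rfl⟩
      rw [← support_res hI, h3]
      simp
    · left
      refine Finset.Subset.antisymm ?_ fun y hy => ?_
      · rw [← hres]
        exact support_res_subset _ _
      · have hsy := Finsupp.mem_support_iff.mp (hI hy)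
        by_cases hyx : y = x
        · subst hyx
          simp [hy]
          omega
        · simp [hy, hsy, Finsupp.single_eq_of_ne hyx]

theorem fib_subset (B : Finset X) (g : X → X) (x : X) : fib B g x ⊆ B := Finset.filter_subset _ _

/-- A map to `insert x P` amounts to its fiber `I` over `x` and a map of the remaining points. The
hypothesis `hF` is needed because the two maps have the same fibers over `P` only. -/
theorem sum_maps_insert {M : Type*} [AddCommMonoid M] {B P : Finset X} {x : X} (hx : x ∉ P)
    (F : Finset X → (X → Finset X) → M)
    (hF : ∀ I f f', (∀ y ∈ P, f y = f' y) → F I f = F I f') :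
    ∑ g ∈ maps B (insert x P), F (fib B g x) (fib B g) =
      ∑ I ∈ B.powerset, ∑ g ∈ maps (B \ I) P, F I (fib (B \ I) g) := by
  rw [Finset.sum_sigma']
  refine Finset.sum_bij' (fun g _ => ⟨fib B g x, fun z => if z ∈ fib B g x then z else g z⟩)
    (fun q _ => fun z => if z ∈ q.1 then x else q.2 z) ?_ ?_ ?_ ?_ ?_
  · intro g hg
    obtain ⟨h1, h2⟩ := mem_maps.mp hg
    simp only [Finset.mem_sigma, Finset.mem_powerset, mem_maps, Finset.mem_sdiff]
    refine ⟨fib_subset _ _ _, fun z hz => ?_, fun z hz => ?_⟩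
    · split_ifs with h
      · rfl
      · exact h1 z (by tauto)
    · rw [if_neg hz.2]
      have h3 : g z ≠ x := fun h => hz.2 (mem_fib.mpr ⟨hz.1, h⟩)
      exact (Finset.mem_insert.mp (h2 z hz.1)).resolve_left h3
  · rintro ⟨I, g⟩ hq
    simp only [Finset.mem_sigma, Finset.mem_powerset, mem_maps, Finset.mem_sdiff] at hq ⊢
    obtain ⟨hI, h1, h2⟩ := hq
    refine ⟨fun z hz => ?_, fun z hz => ?_⟩
    · rw [if_neg fun h => hz (hI h)]
      exact h1 z (by tauto)
    · split_ifs with h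
      · exact Finset.mem_insert_self _ _
      · exact Finset.mem_insert_of_mem (h2 z ⟨hz, h⟩)
  · intro g hg
    funext z
    simp only
    split_ifs with h
    · exact (mem_fib.mp h).2.symm
    · rfl
  · rintro ⟨I, g⟩ hq
    simp only [Finset.mem_sigma, Finset.mem_powerset, mem_maps, Finset.mem_sdiff] at hq
    obtain ⟨hI, h1, h2⟩ := hq
    have hfib : fib B (fun z => if z ∈ I then x else g z) x = I := by
      ext z
      rw [mem_fib]
      constructor
      · rintro ⟨hz, h⟩
        by_contra hzI
        rw [if_neg hzI] at h
        exact hx (h ▸ h2 z ⟨hz, hzI⟩)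
      · exact fun hz => ⟨hI hz, if_pos hz⟩
    simp only
    rw [hfib]
    congr 1
    funext z
    split_ifs with h
    · exact (h1 z (by tauto)).symm
    · rfl
  · intro g hg
    refine hF _ _ _ fun y hy => ?_
    ext z
    have hyx : y ≠ x := by rintro rfl; exact hx hy
    simp only [mem_fib, Finset.mem_sdiff]
    by_cases hz : z ∈ B
    · by_cases hgz : g z = x
      · simp [hz, hgz, hyx.symm]
      · simp [hz, hgz]
    · simp [hz]

/-- Each application of `δ` chooses the points that go to the next slot, all copies of a point
together. The iterated coproduct is thus a sum over the maps from points to slots. -/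
theorem discConvList_res (F : X → U X →ₗ[ℂ] SU X) (s : X →₀ ℕ) (L : List X) (hL : L.Nodup)
    {B : Finset X} (hB : B ⊆ s.support) :
    discConvList (L.map F) (MvPolynomial.monomial (res B s) 1) =
      ∑ g ∈ maps B L.toFinset, ∏ x ∈ L.toFinset,
        F x (MvPolynomial.monomial (res (fib B g x) s) 1) := by
  induction L generalizing B with
  | nil =>
    have h1 : discConvList (([] : List X).map F) (MvPolynomial.monomial (res B s) 1) =
        algebraMap ℂ (SU X) (counit X (MvPolynomial.monomial (res B s) 1)) := rfl
    rw [h1, counit_monomial]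
    simp only [res_eq_zero_iff hB]
    split_ifs with h
    · subst h
      have : maps (∅ : Finset X) (∅ : Finset X) = {id} := by
        ext g
        simp [mem_maps, funext_iff]
      simp [this]
    · obtain ⟨z, hz⟩ := Finset.nonempty_iff_ne_empty.mpr h
      rw [map_zero]
      symm
      refine Finset.sum_eq_zero fun g hg => ?_
      simpa using (mem_maps.mp hg).2 z hz
  | cons x L ih =>
    obtain ⟨hx, hL⟩ := List.nodup_cons.mp hL
    have h1 : discConvList ((x :: L).map F) = conv (disc X) (F x) (discConvList (L.map F)) := rfl
    have hx' : x ∉ L.toFinset := by simpa using hx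
    rw [h1, conv_disc_res _ _ _ hB, List.toFinset_cons]
    simp_rw [Finset.prod_insert hx']
    rw [sum_maps_insert hx' (fun I f => F x (MvPolynomial.monomial (res I s) 1) *
      ∏ y ∈ L.toFinset, F y (MvPolynomial.monomial (res (f y) s) 1))]
    · refine Finset.sum_congr rfl fun I _ => ?_
      rw [ih hL (Finset.sdiff_subset.trans hB), Finset.mul_sum]
    · intro I f f' h
      congr 1
      exact Finset.prod_congr rfl fun y hy => by rw [h y hy]

theorem discConvList_dpow (F : X → U X →ₗ[ℂ] SU X) (s : X →₀ ℕ) (L : List X) (hL : L.Nodup)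
    {B : Finset X} (hB : B ⊆ s.support) :
    discConvList (L.map F) (dpow (res B s)) =
      ∑ g ∈ maps B L.toFinset, ∏ x ∈ L.toFinset, F x (dpow (res (fib B g x) s)) := by
  rw [dpow, map_smul, discConvList_res F s L hL hB, Finset.smul_sum]
  refine Finset.sum_congr rfl fun g hg => ?_
  simp only [dpow, map_smul, ffact_res]
  rw [Finset.prod_smul, Finset.prod_inv_distrib, ← Finset.prod_fiberwise_of_maps_to
    (mem_maps.mp hg).2]
  rfl

/-! ### Two successive removals -/

/-- Two successive removals of bridges with points `P` and `Q` from a piece `B`: the pieces are the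
fibers of `q.1.1` except that of `x = q.2.1`, the fibers of `q.1.2` except that of `y = q.2.2`, and
the intersection of these two. -/
def doubleRetr (B P Q : Finset X) : Finset (((X → X) × (X → X)) × (X × X)) :=
  ((retr B P ×ˢ retr B Q) ×ˢ (P ×ˢ Q)).filter fun q =>
    (∀ z ∈ Q, q.1.1 z = q.2.1) ∧ (∀ z ∈ P, q.1.2 z = q.2.2) ∧
      ∀ z ∈ B, q.1.1 z = q.2.1 ∨ q.1.2 z = q.2.2

/-- The sum over the double removals with points `P` and `Q`. -/
def doubleSum (B P Q : Finset X) (t : X →₀ ℕ) : SU X :=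
  ∑ q ∈ doubleRetr B P Q, (∏ p ∈ P.erase q.2.1, piece (fib B q.1.1 p) t) *
    (∏ p ∈ Q.erase q.2.2, piece (fib B q.1.2 p) t) *
      piece (fib B q.1.1 q.2.1 ∩ fib B q.1.2 q.2.2) t

theorem doubleSum_comm (B P Q : Finset X) (t : X →₀ ℕ) :
    doubleSum B P Q t = doubleSum B Q P t := by
  refine Finset.sum_nbij' (fun q => (q.1.swap, q.2.swap)) (fun q => (q.1.swap, q.2.swap))
    ?_ ?_ ?_ ?_ ?_
  · rintro ⟨⟨g, h⟩, x, y⟩ hq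
    simp only [doubleRetr, Finset.mem_filter, Finset.mem_product, Prod.swap] at hq ⊢
    exact ⟨⟨⟨hq.1.1.2, hq.1.1.1⟩, hq.1.2.2, hq.1.2.1⟩, hq.2.2.1, hq.2.1,
      fun z hz => (hq.2.2.2 z hz).symm⟩
  · rintro ⟨⟨g, h⟩, x, y⟩ hq
    simp only [doubleRetr, Finset.mem_filter, Finset.mem_product, Prod.swap] at hq ⊢
    exact ⟨⟨⟨hq.1.1.2, hq.1.1.1⟩, hq.1.2.2, hq.1.2.1⟩, hq.2.2.1, hq.2.1,
      fun z hz => (hq.2.2.2 z hz).symm⟩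
  · intro q _
    rfl
  · intro q _
    rfl
  · rintro ⟨⟨g, h⟩, x, y⟩ _
    simp only [Prod.swap]
    rw [Finset.inter_comm, mul_comm (∏ p ∈ P.erase x, _)]

/-- The second bridge `Q` lies in one fiber, that of `x`. Once `Q` alone is removed, the points
outside this fiber remain attached to `x`, so the second retraction `h` extends to `B` by the value
`h x` there; this extension and its inverse put the two removals on an equal footing. -/
theorem sum_retr_retr {B P : Finset X} (hPB : P ⊆ B) (Q : Finset X) (u : X →₀ ℕ) :
    ∑ r ∈ (retr B P ×ˢ P).filter (fun r => Q ⊆ fib B r.1 r.2),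
      (∏ y ∈ P.erase r.2, piece (fib B r.1 y) u) * ∑ h ∈ retr (fib B r.1 r.2) Q,
        ∏ q ∈ Q, piece (fib (fib B r.1 r.2) h q) (u - ind Q) =
    doubleSum B P Q (u - ind Q) := by
  simp_rw [Finset.mul_sum]
  rw [Finset.sum_sigma', doubleSum]
  have hin : ∀ g ∈ retr B P, ∀ x ∈ P, x ∈ fib B g x := fun g hg x hx =>
    mem_fib.mpr ⟨hPB hx, (mem_retr.mp hg).2.2 x hx⟩
  -- the fibers of the second map
  have hfibs : ∀ (g h H : X → X) (x y : X), (∀ z ∈ fib B g x, H z = h z) →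
      (∀ z ∈ B, z ∉ fib B g x → H z = y) →
      (∀ q, q ≠ y → fib B H q = fib (fib B g x) h q) ∧
        fib B g x ∩ fib B H y = fib (fib B g x) h y := by
    intro g h H x y h1 h2
    refine ⟨fun q hq => ?_, ?_⟩
    · ext z
      rw [mem_fib, mem_fib]
      constructor
      · rintro ⟨hz, hzq⟩
        by_cases hzf : z ∈ fib B g x
        · exact ⟨hzf, by rw [← h1 z hzf, hzq]⟩
        · exact absurd (hzq.symm.trans (h2 z hz hzf)) hq
      · rintro ⟨hzf, hzq⟩
        exact ⟨fib_subset _ _ _ hzf, by rw [h1 z hzf, hzq]⟩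
    · ext z
      rw [Finset.mem_inter, mem_fib (g := H), mem_fib (g := h)]
      constructor
      · rintro ⟨hzf, -, hzq⟩
        exact ⟨hzf, by rw [← h1 z hzf, hzq]⟩
      · rintro ⟨hzf, hzq⟩
        exact ⟨hzf, fib_subset _ _ _ hzf, by rw [h1 z hzf, hzq]⟩
  refine Finset.sum_bij'
    (fun r _ => ((r.1.1, fun z => if z ∈ fib B r.1.1 r.1.2 then r.2 z else
      if z ∈ B then r.2 r.1.2 else z), (r.1.2, r.2 r.1.2)))
    (fun q _ => ⟨(q.1.1, q.2.1), fun z => if z ∈ fib B q.1.1 q.2.1 then q.1.2 z else z⟩)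
    ?_ ?_ ?_ ?_ ?_
  · rintro ⟨⟨g, x⟩, h⟩ hr
    simp only [Finset.mem_sigma, Finset.mem_filter, Finset.mem_product] at hr
    obtain ⟨⟨⟨hg, hx⟩, hQ⟩, hh⟩ := hr
    obtain ⟨h1, h2, h3⟩ := mem_retr.mp hh
    have hxx := hin g hg x hx
    simp only [doubleRetr, Finset.mem_filter, Finset.mem_product]
    refine ⟨⟨⟨hg, mem_retr.mpr ⟨fun z hz => ?_, fun z hz => ?_, fun z hz => ?_⟩⟩, hx, h2 x hxx⟩,
      fun z hz => (mem_fib.mp (hQ hz)).2, fun z hz => ?_, fun z hz => ?_⟩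
    · rw [if_neg fun hf => hz (fib_subset _ _ _ hf), if_neg hz]
    · split_ifs with hf
      · exact h2 z hf
      · exact h2 x hxx
    · rw [if_pos (hQ hz)]
      exact h3 z hz
    · split_ifs with hf hzB
      · rw [(mem_fib.mp hf).2.symm.trans ((mem_retr.mp hg).2.2 z hz)]
      · rfl
      · exact absurd (hPB hz) hzB
    · by_cases hf : z ∈ fib B g x
      · exact Or.inl (mem_fib.mp hf).2
      · right
        rw [if_neg hf, if_pos hz]
  · rintro ⟨⟨g, H⟩, x, y⟩ hq
    simp only [doubleRetr, Finset.mem_filter, Finset.mem_product] at hq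
    obtain ⟨⟨⟨hg, hH⟩, hx, hy⟩, h1, h2, h3⟩ := hq
    obtain ⟨h4, h5, h6⟩ := mem_retr.mp hH
    simp only [Finset.mem_sigma, Finset.mem_filter, Finset.mem_product]
    have hQB : Q ⊆ B := fun z hz => by
      by_contra hzB
      have := (mem_retr.mp hg).1 z hzB
      rw [h1 z hz] at this
      exact hzB (this ▸ hPB hx)
    have hQ : Q ⊆ fib B g x := fun z hz => mem_fib.mpr ⟨hQB hz, h1 z hz⟩
    refine ⟨⟨⟨hg, hx⟩, hQ⟩, mem_retr.mpr ⟨fun z hz => if_neg hz, fun z hz => ?_, fun z hz => ?_⟩⟩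
    · rw [if_pos hz]
      exact h5 z (fib_subset _ _ _ hz)
    · rw [if_pos (hQ hz)]
      exact h6 z hz
  · rintro ⟨⟨g, x⟩, h⟩ hr
    simp only [Finset.mem_sigma, Finset.mem_filter, Finset.mem_product] at hr
    obtain ⟨⟨⟨hg, hx⟩, hQ⟩, hh⟩ := hr
    simp only
    congr 1
    funext z
    split_ifs with hf
    · rfl
    · exact ((mem_retr.mp hh).1 z hf).symm
  · rintro ⟨⟨g, H⟩, x, y⟩ hq
    simp only [doubleRetr, Finset.mem_filter, Finset.mem_product] at hq
    obtain ⟨⟨⟨hg, hH⟩, hx, hy⟩, h1, h2, h3⟩ := hq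
    have hxx := hin g hg x hx
    have hHx : H x = y := h2 x hx
    simp only [Prod.mk.injEq, true_and, if_pos hxx, hHx, and_true]
    funext z
    split_ifs with hf hz
    · rfl
    · exact ((h3 z hz).resolve_left fun h => hf (mem_fib.mpr ⟨hz, h⟩)).symm
    · exact ((mem_retr.mp hH).1 z hz).symm
  · rintro ⟨⟨g, x⟩, h⟩ hr
    simp only [Finset.mem_sigma, Finset.mem_filter, Finset.mem_product] at hr
    obtain ⟨⟨⟨hg, hx⟩, hQ⟩, hh⟩ := hr
    obtain ⟨h1, h2, h3⟩ := mem_retr.mp hh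
    have hxx := hin g hg x hx
    simp only
    obtain ⟨e1, e2⟩ := hfibs g h (fun z => if z ∈ fib B g x then h z else
      if z ∈ B then h x else z) x (h x) (fun z hz => if_pos hz)
      (fun z hz hf => by rw [if_neg hf, if_pos hz])
    rw [e2, ← Finset.mul_prod_erase Q _ (h2 x hxx), mul_assoc]
    -- Pieces over points other than `x` do not meet `Q`, so they do not see the subtraction of `ind
    -- Q`.
    congr 1
    · refine Finset.prod_congr rfl fun p hp => piece_congr fun z hz => ?_
      have : z ∉ Q := fun hzQ => (Finset.ne_of_mem_erase hp)
        ((mem_fib.mp hz).2.symm.trans (mem_fib.mp (hQ hzQ)).2)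
      simp [this]
    · rw [mul_comm]
      congr 1
      refine Finset.prod_congr rfl fun q hq => ?_
      rw [e1 q (Finset.ne_of_mem_erase hq)]

end DecEq

/-! ### Action of the derivations on pieces and their commutation -/

section Order

variable [LinearOrder X]

/-- `D_m(x₁, …, x_m)` as a function of the set `{x₁, …, x_m}`. -/
def prop (ρ : Form X) (P : Finset X) : ℂ := cumulant ρ (MvPolynomial.monomial (ind P) 1)

/-- The counterpart of `derivative_cpoly` in `S(U)`. It has to hold also for sets `B` with points
missing from `s`, since such pieces arise after a removal. -/
theorem A_piece (ρ : Form X) (n : ℕ) (B : Finset X) (s : X →₀ ℕ) :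
    A ρ n (piece B s) = ∑ P ∈ B.powersetCard (n + 1), if ind P ≤ s then
      prop ρ P • ∑ g ∈ retr B P, ∏ x ∈ P, piece (fib B g x) (s - ind P) else 0 := by
  by_cases hB : B ⊆ s.support
  · rw [piece_of_subset hB, A, extendDerivation_ι]
    have h1 : AU ρ (n + 1) (dpow (res B s)) = ∑ P ∈ B.powersetCard (n + 1), prop ρ P •
        discConvList ((P.sort (· ≤ ·)).map fun x => SymmetricAlgebra.ι ℂ (U X) ∘ₗ barD x)
          (dpow (res B s)) := by
      rw [dpow, map_smul, AU, onMonomials_monomial, support_res hB, Finset.smul_sum]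
      refine Finset.sum_congr rfl fun P _ => ?_
      rw [prop, monomial_ind, map_smul, smul_comm]
    rw [h1]
    refine Finset.sum_congr rfl fun P hP => ?_
    have hPB := (Finset.mem_powersetCard.mp hP).1
    rw [if_pos, discConvList_dpow _ _ _ (Finset.sort_nodup ..) hB, Finset.sort_toFinset, retr,
      Finset.sum_filter]
    · congr 1
      refine Finset.sum_congr rfl fun g hg => ?_
      split_ifs with hgP
      · refine Finset.prod_congr rfl fun x hx => ?_
        have hxf : x ∈ fib B g x := mem_fib.mpr ⟨hPB hx, hgP x hx⟩
        rw [LinearMap.comp_apply, ι_barD_dpow_res ((fib_subset _ _ _).trans hB) hxf]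
        refine piece_congr fun y hy => ?_
        by_cases hyx : y = x
        · subst hyx; simp [hx]
        · have : y ∉ P := fun hyP => hyx ((hgP y hyP).symm.trans (mem_fib.mp hy).2)
          simp [this, Finsupp.single_eq_of_ne hyx]
      -- A map which moves some `p ∈ P` leaves the slot of `p` without the symbol `φ(p)`, and its
      -- derivative is zero. Only retractions survive.
      · push Not at hgP
        obtain ⟨p, hp, hne⟩ := hgP
        refine Finset.prod_eq_zero hp ?_
        rw [LinearMap.comp_apply, barD_dpow, if_pos, map_zero]
        left
        rw [res_apply, if_neg]
        exact fun h => hne (mem_fib.mp h).2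
    · intro x
      rw [ind_apply]
      split_ifs with hx
      · exact Nat.one_le_iff_ne_zero.mpr (Finsupp.mem_support_iff.mp (hB (hPB hx)))
      · exact Nat.zero_le _
  -- If `z ∈ B` is missing from `s`, the left side is zero: the piece is either zero or the unit of
  -- `U`. On the right `z ∉ P`, so the fiber containing `z` has a second point `g z`, and its piece
  -- vanishes.
  · obtain ⟨z, hzB, hz⟩ := Finset.not_subset.mp hB
    rw [Finsupp.notMem_support_iff] at hz
    have h1 : A ρ n (piece B s) = 0 := by
      by_cases hc : B.card = 1 ∧ res B s = 0
      · rw [piece, if_pos (Or.inr hc), hc.2, A, extendDerivation_ι, dpow, map_smul, AU,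
          onMonomials_monomial, Finsupp.support_zero, Finset.powersetCard_eq_empty.mpr (by simp)]
        simp
      · rw [piece, if_neg, map_zero]
        rintro (h | h)
        · rw [← h] at hzB
          simp [hz] at hzB
        · exact hc h
    rw [h1]
    symm
    refine Finset.sum_eq_zero fun P hP => ?_
    obtain ⟨hPB, hPc⟩ := Finset.mem_powersetCard.mp hP
    split_ifs with hPs
    swap
    · rfl
    rw [Finset.sum_eq_zero, smul_zero]
    intro g hg
    have hgz := (mem_retr.mp hg).2.1 z hzB
    have hzP : z ∉ P := fun h => by
      have := hPs z
      simp [h, hz] at this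
    refine Finset.prod_eq_zero hgz ?_
    refine piece_eq_zero (z := z) (mem_fib.mpr ⟨hzB, rfl⟩) (by simp [hz]) fun hc => ?_
    refine hzP ?_
    have h2 : g z ∈ fib B g (g z) := mem_fib.mpr ⟨hPB hgz, (mem_retr.mp hg).2.2 _ hgz⟩
    rwa [Finset.card_le_one.mp hc.le _ (mem_fib.mpr ⟨hzB, rfl⟩) _ h2]

/-- By the Leibniz rule the second derivation acts on one fiber of the first retraction, and
`sum_retr_retr` puts the result in a form symmetric in the two bridges. -/
theorem A_A_piece (ρ : Form X) (m n : ℕ) (B : Finset X) (s : X →₀ ℕ) :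
    A ρ m (A ρ n (piece B s)) =
      ∑ P ∈ B.powersetCard (n + 1), ∑ Q ∈ B.powersetCard (m + 1), if ind P + ind Q ≤ s then
        (prop ρ P * prop ρ Q) • doubleSum B P Q (s - (ind P + ind Q)) else 0 := by
  rw [A_piece, map_sum]
  refine Finset.sum_congr rfl fun P hP => ?_
  have hPB := (Finset.mem_powersetCard.mp hP).1
  by_cases hPs : ind P ≤ s
  swap
  · rw [if_neg hPs, map_zero]
    symm
    exact Finset.sum_eq_zero fun Q _ => if_neg fun h => hPs ((le_add_of_nonneg_right
      (zero_le)).trans h)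
  have hle : ∀ Q : Finset X, ind P + ind Q ≤ s ↔ ind Q ≤ s - ind P := fun Q => by
    rw [add_comm]
    exact (le_tsub_iff_right hPs).symm
  have h1 : ∀ (g : X → X) (x : X), A ρ m (piece (fib B g x) (s - ind P)) =
      ∑ Q ∈ B.powersetCard (m + 1), if Q ⊆ fib B g x then (if ind P + ind Q ≤ s then
        prop ρ Q • ∑ h ∈ retr (fib B g x) Q, ∏ q ∈ Q,
          piece (fib (fib B g x) h q) (s - ind P - ind Q) else 0) else 0 := by
    intro g x
    have hfilter : (fib B g x).powersetCard (m + 1) =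
        (B.powersetCard (m + 1)).filter (· ⊆ fib B g x) := by
      ext Q
      simp only [Finset.mem_powersetCard, Finset.mem_filter]
      exact ⟨fun h => ⟨⟨h.1.trans (fib_subset _ _ _), h.2⟩, h.1⟩, fun h => ⟨h.2, h.1.2⟩⟩
    rw [A_piece, hfilter, Finset.sum_filter]
    simp_rw [hle]
  rw [if_pos hPs, Derivation.map_smul, map_sum]
  simp_rw [derivation_prod, h1]
  rw [← Finset.sum_product', Finset.smul_sum]
  simp_rw [Finset.mul_sum, Finset.smul_sum]
  rw [Finset.sum_comm]
  refine Finset.sum_congr rfl fun Q _ => ?_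
  split_ifs with hQs
  · rw [← tsub_tsub, ← sum_retr_retr hPB, Finset.sum_filter, Finset.smul_sum]
    refine Finset.sum_congr rfl fun r _ => ?_
    split_ifs
    · rw [← Finset.smul_sum, mul_smul_comm, smul_smul]
    · simp
  · exact Finset.sum_eq_zero fun r _ => by split_ifs <;> simp

theorem monomial_eq_piece (s : X →₀ ℕ) :
    SymmetricAlgebra.ι ℂ (U X) (MvPolynomial.monomial s 1) = ffact s • piece s.support s := by
  rw [piece_of_subset (Finset.Subset.refl _), res_eq_self (Finset.Subset.refl _),
    monomial_eq_smul_dpow, map_smul]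

/-- The commutator is a derivation, so it suffices to compare the double sums on generators. -/
theorem A_comm (ρ : Form X) (m n : ℕ) (w : SU X) : A ρ m (A ρ n w) = A ρ n (A ρ m w) := by
  rw [← sub_eq_zero, ← Derivation.commutator_apply]
  refine derivation_eq_zero (fun s => ?_) w
  rw [monomial_eq_piece, Derivation.map_smul, Derivation.commutator_apply, A_A_piece, A_A_piece,
    Finset.sum_comm, sub_eq_zero.mpr, smul_zero]
  refine Finset.sum_congr rfl fun P _ => Finset.sum_congr rfl fun Q _ => ?_
  rw [add_comm (ind Q), mul_comm (prop ρ Q), doubleSum_comm]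

end Order

/-! ### The degree filtration and local finiteness -/

/-- The span of the products of monomials with total degree at most `d`. -/
def degFil (X : Type*) (d : ℤ) : Submodule ℂ (SU X) :=
  Submodule.span ℂ {w | ∃ m : Multiset (X →₀ ℕ), (((m.map Finsupp.degree).sum : ℕ) : ℤ) ≤ d ∧
    w = (m.map fun s => SymmetricAlgebra.ι ℂ (U X) (MvPolynomial.monomial s 1)).prod}

theorem degFil_mono {d e : ℤ} (h : d ≤ e) : degFil X d ≤ degFil X e :=
  Submodule.span_mono fun _ ⟨m, hm, hw⟩ => ⟨m, hm.trans h, hw⟩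

/-- The filtration is indexed by integers for this purpose: an operator that lowers the index below
zero gives zero. -/
theorem eq_zero_of_mem_degFil {d : ℤ} (hd : d < 0) {w : SU X} (hw : w ∈ degFil X d) : w = 0 := by
  have : {w : SU X | ∃ m : Multiset (X →₀ ℕ), (((m.map Finsupp.degree).sum : ℕ) : ℤ) ≤ d ∧
      w = (m.map fun s => SymmetricAlgebra.ι ℂ (U X) (MvPolynomial.monomial s 1)).prod} = ∅ := by
    rw [Set.eq_empty_iff_forall_notMem]
    rintro w ⟨m, hm, -⟩
    omega
  rwa [degFil, this, Submodule.span_empty, Submodule.mem_bot] at hw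

theorem one_mem_degFil : (1 : SU X) ∈ degFil X 0 :=
  Submodule.subset_span ⟨0, by simp, by simp⟩

theorem ι_mem_degFil (s : X →₀ ℕ) :
    SymmetricAlgebra.ι ℂ (U X) (MvPolynomial.monomial s 1) ∈ degFil X s.degree :=
  Submodule.subset_span ⟨{s}, by simp, by simp⟩

theorem mul_mem_degFil {d e : ℤ} {v w : SU X} (hv : v ∈ degFil X d) (hw : w ∈ degFil X e) :
    v * w ∈ degFil X (d + e) := by
  have h := Submodule.mul_mem_mul hv hw
  rw [degFil, degFil, Submodule.span_mul_span] at h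
  refine Submodule.span_mono ?_ h
  rintro _ ⟨_, ⟨m, hm, rfl⟩, _, ⟨m', hm', rfl⟩, rfl⟩
  refine ⟨m + m', ?_, ?_⟩
  · rw [Multiset.map_add, Multiset.sum_add, Nat.cast_add]
    omega
  · rw [Multiset.map_add, Multiset.prod_add]

theorem prod_mem_degFil {ι : Type*} (S : Finset ι) (f : ι → SU X) (d : ι → ℤ)
    (h : ∀ i ∈ S, f i ∈ degFil X (d i)) : ∏ i ∈ S, f i ∈ degFil X (∑ i ∈ S, d i) := by
  classical
  induction S using Finset.induction_on with
  | empty => simpa using one_mem_degFil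
  | insert i S hi ih =>
    rw [Finset.prod_insert hi, Finset.sum_insert hi]
    exact mul_mem_degFil (h i (Finset.mem_insert_self i S))
      (ih fun j hj => h j (Finset.mem_insert_of_mem hj))

theorem exists_mem_degFil (w : SU X) : ∃ d : ℕ, w ∈ degFil X d := by
  induction w using SU_induction with
  | h1 => exact ⟨0, one_mem_degFil⟩
  | hmul s w hw =>
    obtain ⟨d, hd⟩ := hw
    refine ⟨s.degree + d, ?_⟩
    push_cast
    exact mul_mem_degFil (ι_mem_degFil s) hd
  | hadd v w hv hw =>
    obtain ⟨d, hd⟩ := hv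
    obtain ⟨e, he⟩ := hw
    exact ⟨max d e, add_mem (degFil_mono (by push_cast; exact le_max_left _ _) hd)
      (degFil_mono (by push_cast; exact le_max_right _ _) he)⟩
  | hsmul c w hw =>
    obtain ⟨d, hd⟩ := hw
    exact ⟨d, Submodule.smul_mem _ _ hd⟩

theorem derivation_mem_degFil {D : Derivation ℂ (SU X) (SU X)} {e : ℤ}
    (h : ∀ s : X →₀ ℕ, D (SymmetricAlgebra.ι ℂ (U X) (MvPolynomial.monomial s 1)) ∈
      degFil X (s.degree - e)) {d : ℤ} {w : SU X} (hw : w ∈ degFil X d) :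
    D w ∈ degFil X (d - e) := by
  have hprod : ∀ m : Multiset (X →₀ ℕ),
      D (m.map fun s => SymmetricAlgebra.ι ℂ (U X) (MvPolynomial.monomial s 1)).prod ∈
        degFil X ((m.map Finsupp.degree).sum - e) := by
    intro m
    induction m using Multiset.induction_on with
    | empty => simp
    | cons s m ih =>
      have hm : (m.map fun s => SymmetricAlgebra.ι ℂ (U X) (MvPolynomial.monomial s 1)).prod ∈
          degFil X (m.map Finsupp.degree).sum := Submodule.subset_span ⟨m, le_rfl, rfl⟩
      simp only [Multiset.map_cons, Multiset.prod_cons, Derivation.leibniz, smul_eq_mul,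
        Multiset.sum_cons, Nat.cast_add]
      refine add_mem (degFil_mono (le_of_eq ?_) (mul_mem_degFil (ι_mem_degFil s) ih))
        (degFil_mono (le_of_eq ?_) (mul_mem_degFil hm (h s))) <;> ring
  rw [degFil] at hw
  induction hw using Submodule.span_induction with
  | mem w hw =>
    obtain ⟨m, hm, rfl⟩ := hw
    exact degFil_mono (by omega) (hprod m)
  | zero => simp
  | add v w _ _ hv hw =>
    rw [map_add]
    exact add_mem hv hw
  | smul c w _ hw =>
    rw [Derivation.map_smul]
    exact Submodule.smul_mem _ _ hw

theorem list_prod_mem_degFil (l : List ℕ) (f : ℕ → Module.End ℂ (SU X)) (e : ℕ → ℤ)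
    (h : ∀ i d w, w ∈ degFil X d → f i w ∈ degFil X (d - e i)) {d : ℤ} {w : SU X}
    (hw : w ∈ degFil X d) : (l.map f).prod w ∈ degFil X (d - (l.map e).sum) := by
  induction l with
  | nil => simpa using hw
  | cons i l ih =>
    simp only [List.map_cons, List.prod_cons, List.sum_cons, Module.End.mul_apply]
    exact degFil_mono (by omega) (h i _ _ ih)

section DecEq

variable [DecidableEq X]

theorem degree_res (B : Finset X) (s : X →₀ ℕ) : (res B s).degree = ∑ x ∈ B, s x := by
  rw [Finsupp.degree_apply]
  refine (Finset.sum_subset (support_res_subset B s) fun x _ hx => ?_).trans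
    (Finset.sum_congr rfl fun x hx => by simp [hx])
  exact Finsupp.notMem_support_iff.mp hx

theorem piece_mem_degFil (B : Finset X) (s : X →₀ ℕ) :
    piece B s ∈ degFil X ((∑ x ∈ B, s x : ℕ) : ℤ) := by
  rw [piece]
  split_ifs
  · rw [dpow, map_smul, ← degree_res]
    exact Submodule.smul_mem _ _ (ι_mem_degFil _)
  · exact zero_mem _

end DecEq

section Order

variable [LinearOrder X] (ρ : Form X)

/-- A removal takes one symbol at each of the `n + 1` points of `P`, and the fibers share out the
remaining exponents. -/
theorem A_mem_degFil (n : ℕ) {d : ℤ} {w : SU X} (hw : w ∈ degFil X d) :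
    A ρ n w ∈ degFil X (d - (n + 1)) := by
  refine derivation_mem_degFil (fun s => ?_) hw
  rw [monomial_eq_piece, Derivation.map_smul, A_piece]
  refine Submodule.smul_mem _ _ (sum_mem fun P hP => ?_)
  obtain ⟨hPB, hPc⟩ := Finset.mem_powersetCard.mp hP
  split_ifs with hPs
  swap
  · exact zero_mem _
  refine Submodule.smul_mem _ _ (sum_mem fun g hg => ?_)
  refine degFil_mono (le_of_eq ?_) (prod_mem_degFil P _ _ fun x _ => piece_mem_degFil _ _)
  rw [← Nat.cast_sum]
  have h1 : ∑ x ∈ P, ∑ z ∈ fib s.support g x, (s - ind P) z = ∑ z ∈ s.support, (s - ind P) z :=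
    Finset.sum_fiberwise_of_maps_to (mem_retr.mp hg).2.1 _
  have h2 : ∑ z ∈ s.support, (s - ind P) z + (n + 1) = s.degree := by
    rw [← hPc, ← degree_ind, ← degree_res, ← map_add, res_eq_self, tsub_add_cancel_of_le hPs]
    intro x hx
    simp only [Finsupp.mem_support_iff, Finsupp.tsub_apply] at hx ⊢
    omega
  rw [h1]
  omega

theorem A_eq_zero {n d : ℕ} (h : d ≤ n) {w : SU X} (hw : w ∈ degFil X d) : A ρ n w = 0 :=
  eq_zero_of_mem_degFil (by omega) (A_mem_degFil ρ n hw)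

theorem sumA_eq_sum {d N : ℕ} (h : d ≤ N) {w : SU X} (hw : w ∈ degFil X d) :
    sumA ρ w = ∑ n ∈ Finset.range N, A ρ n w := by
  refine finsum_eq_sum_of_support_subset _ fun n hn => ?_
  rw [Finset.mem_coe, Finset.mem_range]
  by_contra hnN
  exact hn (A_eq_zero ρ (by omega) hw)

theorem finite_A (w : SU X) : {n : ℕ | A ρ n w ≠ 0}.Finite := by
  obtain ⟨d, hd⟩ := exists_mem_degFil w
  refine (Set.finite_Iio d).subset fun n hn => ?_
  rw [Set.mem_Iio]
  by_contra h
  exact hn (A_eq_zero ρ (by omega) hd)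

/-- The sum of the derivations `A_n`. -/
def sumADer : Derivation ℂ (SU X) (SU X) where
  toFun := sumA ρ
  map_add' v w := by
    simp only [sumA, map_add]
    exact finsum_add_distrib (finite_A ρ v) (finite_A ρ w)
  map_smul' c w := by
    simp only [sumA, Derivation.map_smul, RingHom.id_apply]
    exact (smul_finsum' c (finite_A ρ w)).symm
  map_one_eq_zero' := by simp [sumA]
  leibniz' v w := by
    obtain ⟨d, hd⟩ := exists_mem_degFil v
    obtain ⟨e, he⟩ := exists_mem_degFil w
    have hde := mul_mem_degFil hd he
    change sumA ρ (v * w) = v • sumA ρ w + w • sumA ρ v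
    rw [sumA_eq_sum ρ (by omega : d ≤ d + e) hd, sumA_eq_sum ρ (by omega : e ≤ d + e) he,
      sumA_eq_sum ρ le_rfl (by exact_mod_cast hde), Finset.smul_sum, Finset.smul_sum,
      ← Finset.sum_add_distrib]
    exact Finset.sum_congr rfl fun n _ => Derivation.leibniz _ _ _

theorem sumADer_apply (w : SU X) : sumADer ρ w = sumA ρ w := rfl

theorem sumA_mem_degFil {d : ℤ} {w : SU X} (hw : w ∈ degFil X d) :
    sumA ρ w ∈ degFil X (d - 1) := by
  obtain ⟨e, he⟩ := exists_mem_degFil w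
  rw [sumA_eq_sum ρ le_rfl he]
  exact sum_mem fun n _ => degFil_mono (by omega) (A_mem_degFil ρ n hw)

theorem iterate_sumA_mem_degFil (k : ℕ) {d : ℤ} {w : SU X} (hw : w ∈ degFil X d) :
    (sumA ρ)^[k] w ∈ degFil X (d - k) := by
  induction k with
  | zero => simpa using hw
  | succ k ih =>
    rw [Function.iterate_succ_apply']
    exact degFil_mono (by push_cast; omega) (sumA_mem_degFil ρ ih)

theorem iterate_sumA_eq_zero {k d : ℕ} (h : d < k) {w : SU X} (hw : w ∈ degFil X d) :
    (sumA ρ)^[k] w = 0 :=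
  eq_zero_of_mem_degFil (by omega) (iterate_sumA_mem_degFil ρ k hw)

theorem finite_iterate_sumA (w : SU X) : {k : ℕ | (sumA ρ)^[k] w ≠ 0}.Finite := by
  obtain ⟨d, hd⟩ := exists_mem_degFil w
  refine (Set.finite_Iic d).subset fun k hk => ?_
  rw [Set.mem_Iic]
  by_contra h
  exact hk (iterate_sumA_eq_zero ρ (by omega) hd)

/-! ### Divided powers of the derivations and the exponential -/

/-- The product `A_0^{α_0}/α_0! ⋯ A_{N-1}^{α_{N-1}}/α_{N-1}!`. -/
def divPow (N : ℕ) (α : ℕ → ℕ) : Module.End ℂ (SU X) :=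
  ((List.range N).map fun i =>
    (((α i).factorial : ℂ))⁻¹ • ((A ρ i : Module.End ℂ (SU X)) ^ α i)).prod

theorem list_sum_range {M : Type*} [AddCommMonoid M] (N : ℕ) (f : ℕ → M) :
    ((List.range N).map f).sum = ∑ i ∈ Finset.range N, f i := rfl

theorem divPow_mem_degFil (N : ℕ) (α : ℕ → ℕ) {d : ℤ} {w : SU X} (hw : w ∈ degFil X d) :
    divPow ρ N α w ∈ degFil X (d - ∑ i ∈ Finset.range N, (α i : ℤ) * (i + 1)) := by
  have h1 : ∀ (i k : ℕ) (d : ℤ) (w : SU X), w ∈ degFil X d →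
      ((A ρ i : Module.End ℂ (SU X)) ^ k) w ∈ degFil X (d - k * (i + 1)) := by
    intro i k d w hw
    induction k with
    | zero => simpa using hw
    | succ k ih =>
      rw [pow_succ', Module.End.mul_apply]
      refine degFil_mono (le_of_eq ?_) (A_mem_degFil ρ i ih)
      push_cast
      ring
  rw [← list_sum_range]
  exact list_prod_mem_degFil _ _ _ (fun i d w hw => Submodule.smul_mem _ _ (h1 i (α i) d w hw)) hw

theorem divPow_eq_of_le {M N : ℕ} (h : M ≤ N) {α : ℕ → ℕ} (hα : ∀ i, M ≤ i → α i = 0) :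
    divPow ρ N α = divPow ρ M α := by
  induction N, h using Nat.le_induction with
  | base => rfl
  | succ N hN ih =>
    rw [← ih, divPow, List.range_succ, List.map_append, List.prod_append, divPow]
    simp [hα N hN]

/-- The constraint $\sum_i i\alpha_i=n$ forces $\alpha_i=0$ for $i>n$. All the $L_n^k$ with $n<N$
can therefore be written with the same derivations $A_0,\dots,A_{N-1}$. -/
theorem L_eq_sum {N n : ℕ} (h : n + 1 ≤ N) (k : ℕ) :
    L ρ n k = ∑ α ∈ (Finset.piAntidiag (Finset.range N) k).filter
      (fun α => ∑ i ∈ Finset.range N, i * α i = n), divPow ρ N α := by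
  have hzero : ∀ α : ℕ → ℕ, (∀ i, α i ≠ 0 → i ∈ Finset.range N) →
      ∑ i ∈ Finset.range N, i * α i = n → ∀ i, n + 1 ≤ i → α i = 0 := by
    intro α h1 h2 i hi
    by_contra h0
    have h3 := Finset.single_le_sum (f := fun i => i * α i) (fun _ _ => Nat.zero_le _) (h1 i h0)
    have h4 : i ≤ i * α i := Nat.le_mul_of_pos_right _ (Nat.pos_of_ne_zero h0)
    simp only [h2] at h3
    omega
  have hsum : ∀ (α : ℕ → ℕ) (f : ℕ → ℕ → ℕ), (∀ i, f i 0 = 0) → (∀ i, n + 1 ≤ i → α i = 0) →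
      ∑ i ∈ Finset.range N, f i (α i) = ∑ i ∈ Finset.range (n + 1), f i (α i) := by
    intro α f hf hα
    symm
    refine Finset.sum_subset (Finset.range_subset_range.mpr h) fun i _ hi => ?_
    rw [hα i (by simpa using hi), hf]
  have hset : (Finset.piAntidiag (Finset.range (n + 1)) k).filter
      (fun α => ∑ i ∈ Finset.range (n + 1), i * α i = n) =
      (Finset.piAntidiag (Finset.range N) k).filter
        (fun α => ∑ i ∈ Finset.range N, i * α i = n) := by
    ext α
    simp only [Finset.mem_filter, Finset.mem_piAntidiag]
    constructor
    · rintro ⟨⟨h1, h2⟩, h3⟩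
      have hα : ∀ i, n + 1 ≤ i → α i = 0 := fun i hi => by
        by_contra h0
        have := Finset.mem_range.mp (h2 i h0)
        omega
      exact ⟨⟨(hsum α (fun _ a => a) (fun _ => rfl) hα).trans h1,
        fun i hi => Finset.range_subset_range.mpr h (h2 i hi)⟩,
        (hsum α (fun i a => i * a) (fun _ => mul_zero _) hα).trans h3⟩
    · rintro ⟨⟨h1, h2⟩, h3⟩
      have hα := hzero α h2 h3
      refine ⟨⟨(hsum α (fun _ a => a) (fun _ => rfl) hα).symm.trans h1, fun i hi => ?_⟩,
        (hsum α (fun i a => i * a) (fun _ => mul_zero _) hα).symm.trans h3⟩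
      rw [Finset.mem_range]
      by_contra hin
      exact hi (hα i (by omega))
  rw [L, hset]
  refine Finset.sum_congr rfl fun α hα => ?_
  simp only [Finset.mem_filter, Finset.mem_piAntidiag] at hα
  exact (divPow_eq_of_le ρ h (hzero α hα.1.2 hα.2)).symm

/-- The loss of degree is $\sum_i\alpha_i(i+1)=n+k$. -/
theorem L_mem_degFil (n k : ℕ) {d : ℤ} {w : SU X} (hw : w ∈ degFil X d) :
    L ρ n k w ∈ degFil X (d - (n + k)) := by
  rw [L_eq_sum ρ le_rfl, LinearMap.sum_apply]
  refine sum_mem fun α hα => ?_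
  simp only [Finset.mem_filter, Finset.mem_piAntidiag] at hα
  refine degFil_mono (le_of_eq ?_) (divPow_mem_degFil ρ (n + 1) α hw)
  have h1 : ∑ i ∈ Finset.range (n + 1), (i : ℤ) * α i = n := by exact_mod_cast hα.2
  have h2 : ∑ i ∈ Finset.range (n + 1), (α i : ℤ) = k := by exact_mod_cast hα.1.1
  have h3 : ∑ i ∈ Finset.range (n + 1), (α i : ℤ) * (i + 1) =
      ∑ i ∈ Finset.range (n + 1), (i : ℤ) * α i + ∑ i ∈ Finset.range (n + 1), (α i : ℤ) := by
    rw [← Finset.sum_add_distrib]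
    exact Finset.sum_congr rfl fun i _ => by ring
  rw [h3, h1, h2]

theorem L_eq_zero {n k d : ℕ} (h : d < n + k) {w : SU X} (hw : w ∈ degFil X d) :
    L ρ n k w = 0 :=
  eq_zero_of_mem_degFil (by omega) (L_mem_degFil ρ n k hw)

theorem support_L_subset {d : ℕ} {w : SU X} (hw : w ∈ degFil X d) :
    {p : ℕ × ℕ | L ρ p.1 p.2 w ≠ 0} ⊆
      (Finset.range (d + 1) ×ˢ Finset.range (d + 1) : Finset (ℕ × ℕ)) := by
  rintro ⟨n, k⟩ hp
  simp only [Finset.coe_product, Finset.coe_range, Set.mem_prod, Set.mem_Iio]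
  by_contra h
  exact hp (L_eq_zero ρ (by omega) hw)

theorem finite_L (w : SU X) : {p : ℕ × ℕ | L ρ p.1 p.2 w ≠ 0}.Finite := by
  obtain ⟨d, hd⟩ := exists_mem_degFil w
  exact (Finset.finite_toSet _).subset (support_L_subset ρ hd)

theorem list_prod_smul (l : List ℕ) (c : ℕ → ℂ) (f : ℕ → Module.End ℂ (SU X)) :
    (l.map fun i => c i • f i).prod = (l.map c).prod • (l.map f).prod := by
  induction l with
  | nil => simp
  | cons i l ih => simp [ih, smul_smul, mul_comm]

/-- The multinomial theorem for commuting operators; commutation is also what makes the order of the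
factors in $L_n^k$ irrelevant. -/
theorem pow_sum_A (N k : ℕ) :
    ((k.factorial : ℂ))⁻¹ • (∑ i ∈ Finset.range N, (A ρ i : Module.End ℂ (SU X))) ^ k =
      ∑ α ∈ Finset.piAntidiag (Finset.range N) k, divPow ρ N α := by
  have hc : ∀ i j, Commute (A ρ i : Module.End ℂ (SU X)) (A ρ j) := fun i j =>
    LinearMap.ext fun w => A_comm ρ i j w
  rw [Finset.sum_pow_eq_sum_piAntidiag_of_commute _ _ (fun i _ j _ _ => hc i j), Finset.smul_sum]
  refine Finset.sum_congr rfl fun α hα => ?_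
  have h1 := (Finset.mem_piAntidiag.mp hα).1
  have h2 := Nat.multinomial_spec (Finset.range N) α
  have h3 : (Finset.range N).noncommProd (fun i => (A ρ i : Module.End ℂ (SU X)) ^ α i)
      (fun i _ j _ _ => (hc i j).pow_pow _ _) =
      ((List.range N).map fun i => (A ρ i : Module.End ℂ (SU X)) ^ α i).prod :=
    Multiset.noncommProd_coe _ _
  have h4 : ((List.range N).map fun i => (((α i).factorial : ℂ))⁻¹).prod =
      ∏ i ∈ Finset.range N, (((α i).factorial : ℂ))⁻¹ := rfl
  rw [h3, divPow, list_prod_smul, h4, ← nsmul_eq_mul, ← Nat.cast_smul_eq_nsmul ℂ, smul_smul]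
  congr 1
  have h5 : (∏ i ∈ Finset.range N, ((α i).factorial : ℂ)) ≠ 0 :=
    Finset.prod_ne_zero_iff.mpr fun i _ => Nat.cast_ne_zero.mpr (Nat.factorial_ne_zero _)
  have h6 : (k.factorial : ℂ) ≠ 0 := Nat.cast_ne_zero.mpr (Nat.factorial_ne_zero _)
  rw [h1] at h2
  rw [Finset.prod_inv_distrib, ← h2]
  rw [← h2] at h6
  push_cast at h6 ⊢
  have h7 := right_ne_zero_of_mul h6
  field_simp

theorem iterate_sumA_eq_pow {d N : ℕ} (h : d ≤ N) (k : ℕ) {w : SU X} (hw : w ∈ degFil X d) :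
    (sumA ρ)^[k] w = ((∑ i ∈ Finset.range N, (A ρ i : Module.End ℂ (SU X))) ^ k) w := by
  induction k with
  | zero => simp
  | succ k ih =>
    have hk := degFil_mono (by omega : (d : ℤ) - k ≤ d) (iterate_sumA_mem_degFil ρ k hw)
    rw [Function.iterate_succ_apply', sumA_eq_sum ρ h hk, ih, pow_succ', Module.End.mul_apply,
      LinearMap.sum_apply]
    rfl

theorem locExp_eq_sum {F : SU X → SU X} {w : SU X} {N : ℕ} (h : ∀ k, N ≤ k → F^[k] w = 0) :
    locExp F w = ∑ k ∈ Finset.range N, ((k.factorial : ℂ))⁻¹ • F^[k] w := by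
  refine finsum_eq_sum_of_support_subset _ fun k hk => ?_
  rw [Finset.mem_coe, Finset.mem_range]
  by_contra hkN
  exact hk (by simp [h k (by omega)])

theorem Ltot_eq_locExp (w : SU X) : Ltot ρ w = locExp (sumA ρ) w := by
  obtain ⟨d, hd⟩ := exists_mem_degFil w
  rw [locExp_eq_sum (N := d + 1) fun k hk => iterate_sumA_eq_zero ρ (by omega) hd, Ltot,
    finsum_eq_sum_of_support_subset (s := Finset.range (d + 1) ×ˢ Finset.range (d + 1)) _
      (support_L_subset ρ hd), Finset.sum_product_right]
  refine Finset.sum_congr rfl fun k _ => ?_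
  rw [iterate_sumA_eq_pow ρ (Nat.le_succ d) k hd, ← LinearMap.smul_apply, pow_sum_A,
    LinearMap.sum_apply, ← Finset.sum_filter_add_sum_filter_not _
      (fun α : ℕ → ℕ => ∑ i ∈ Finset.range (d + 1), i * α i ∈ Finset.range (d + 1))]
  symm
  -- The sequences with $\sum_i i\alpha_i>d$ lower the degree by more than `d` and annihilate `w`;
  -- the others are grouped by the value `n` of this sum.
  rw [Finset.sum_eq_zero (s := Finset.filter (fun α : ℕ → ℕ => ¬ _) _), add_zero]
  · rw [← Finset.sum_fiberwise_of_maps_to (t := Finset.range (d + 1))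
      (g := fun α : ℕ → ℕ => ∑ i ∈ Finset.range (d + 1), i * α i)
      fun α hα => (Finset.mem_filter.mp hα).2]
    refine Finset.sum_congr rfl fun n hn => ?_
    rw [L_eq_sum ρ (Nat.succ_le_of_lt (Finset.mem_range.mp hn)), LinearMap.sum_apply,
      Finset.filter_filter]
    refine Finset.sum_congr (Finset.filter_congr fun α _ => ?_) fun _ _ => rfl
    exact ⟨fun h => h.2, fun h => ⟨h ▸ hn, h⟩⟩
  · intro α hα
    simp only [Finset.mem_filter, Finset.mem_range, not_lt] at hα
    refine eq_zero_of_mem_degFil ?_ (divPow_mem_degFil ρ (d + 1) α hd)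
    have h1 : ∑ i ∈ Finset.range (d + 1), i * α i ≤ ∑ i ∈ Finset.range (d + 1), α i * (i + 1) :=
      Finset.sum_le_sum fun i _ => by nlinarith
    have h2 : ((∑ i ∈ Finset.range (d + 1), α i * (i + 1) : ℕ) : ℤ) =
        ∑ i ∈ Finset.range (d + 1), (α i : ℤ) * (i + 1) := by push_cast; rfl
    omega

end Order

section DecEq

variable [DecidableEq X]

/-! ### The values of the forms as sums over multisets of factors -/

theorem wt_apply (k : Fac X) (x : X) : wt k x = ∑ a ∈ k.support, k a * a x := by
  simp [wt, Finsupp.weight_apply, Finsupp.sum, Finsupp.finsetSum_apply]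

theorem terms_zero : terms (0 : X →₀ ℕ) = {0} := by
  ext k
  rw [mem_terms, Finset.mem_singleton]
  constructor
  · rintro ⟨h0, hk⟩
    ext a
    by_contra ha
    have h1 := le_wt' (k := k) (a := a) ha
    rw [hk, nonpos_iff_eq_zero] at h1
    exact ha (h1 ▸ h0)
  · rintro rfl
    simp

/-- The exponent `s x` counts the occurrences of `x` in the factors. Marking a factor with the
number of its occurrences of `x` and removing it gives the recursion of `cumulant_recursion`. -/
theorem sum_terms_recursion (R : (X →₀ ℕ) → ℂ) (s : X →₀ ℕ) (x : X) :
    s x * ∑ k ∈ terms s, coef R k = ∑ p ∈ Finset.HasAntidiagonal.antidiagonal s,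
      (∑ k ∈ terms p.1, coef R k) * (p.2 x * R p.2) := by
  have h1 : ∀ k ∈ terms s, (s x : ℂ) * coef R k =
      ∑ a ∈ k.support, a x * (R a * coef R (k - Finsupp.single a 1)) := by
    intro k hk
    rw [← (mem_terms.mp hk).2, wt_apply, Nat.cast_sum, Finset.sum_mul]
    refine Finset.sum_congr rfl fun a ha => ?_
    rw [← coef_mul_apply R k (Finsupp.mem_support_iff.mp ha)]
    push_cast
    ring
  -- The decomposition with `p.2 = 0` has weight zero; it must be dropped because terms have no
  -- trivial factor.
  rw [← Finset.sum_filter_of_ne (s := Finset.HasAntidiagonal.antidiagonal s)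
    (p := fun p => p.2 ≠ 0) (fun p _ h h0 => h (by simp [h0])), Finset.mul_sum,
    Finset.sum_congr rfl h1]
  simp_rw [Finset.sum_mul]
  rw [Finset.sum_sigma', Finset.sum_sigma']
  refine Finset.sum_bij' (fun q _ => ⟨(s - q.2, q.2), q.1 - Finsupp.single q.2 1⟩)
    (fun q _ => ⟨q.2 + Finsupp.single q.1.2 1, q.1.2⟩) ?_ ?_ ?_ ?_ ?_
  · rintro ⟨k, a⟩ hq
    simp only [Finset.mem_sigma, Finset.mem_filter, Finset.HasAntidiagonal.mem_antidiagonal,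
      Finsupp.mem_support_iff] at hq ⊢
    obtain ⟨hk, ha⟩ := hq
    obtain ⟨h0, hw⟩ := mem_terms.mp hk
    have has : a ≤ s := hw ▸ le_wt' ha
    refine ⟨⟨tsub_add_cancel_of_le has, ?_⟩, mem_terms.mpr ⟨?_, ?_⟩⟩
    · rintro rfl
      exact ha h0
    · rw [Finsupp.tsub_apply, h0, zero_tsub]
    · refine add_right_cancel (b := a) ?_
      rw [tsub_add_cancel_of_le has, ← hw]
      have h2 := map_add wt (k - Finsupp.single a 1) (Finsupp.single a 1)
      rw [tsub_add_cancel_of_le (single_le_of_ne_zero ha), wt_single, one_smul] at h2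
      exact h2.symm
  · rintro ⟨p, k⟩ hq
    simp only [Finset.mem_sigma, Finset.mem_filter, Finset.HasAntidiagonal.mem_antidiagonal,
      Finsupp.mem_support_iff] at hq ⊢
    obtain ⟨⟨hp, hp0⟩, hk⟩ := hq
    obtain ⟨h0, hw⟩ := mem_terms.mp hk
    refine ⟨mem_terms.mpr ⟨?_, ?_⟩, by simp⟩
    · rw [Finsupp.add_apply, h0, Finsupp.single_eq_of_ne hp0.symm, add_zero]
    · rw [map_add, hw, wt_single, one_smul, hp]
  · rintro ⟨k, a⟩ hq
    simp only [Finset.mem_sigma, Finsupp.mem_support_iff] at hq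
    simp only
    rw [tsub_add_cancel_of_le (single_le_of_ne_zero hq.2)]
  · rintro ⟨⟨b, a⟩, k⟩ hq
    simp only [Finset.mem_sigma, Finset.mem_filter,
      Finset.HasAntidiagonal.mem_antidiagonal] at hq
    simp only
    rw [add_tsub_cancel_right, ← hq.1.1, add_tsub_cancel_right]
  · rintro ⟨k, a⟩ _
    simp only
    ring

/-- The cumulant of a divided power. -/
def cum (ρ : Form X) (a : X →₀ ℕ) : ℂ := cumulant ρ (dpow a)

/-- Both sides obey the same recursion. A summand with `p.2 x ≠ 0` has `p.1` of smaller degree, so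
induction applies. -/
theorem form_dpow (ρ : Form X) (hρ : ρ 1 = 1) (s : X →₀ ℕ) :
    ρ (dpow s) = ∑ k ∈ terms s, coef (cum ρ) k := by
  induction hd : s.degree using Nat.strong_induction_on generalizing s with
  | _ d ih =>
    by_cases hs : s = 0
    · subst hs
      rw [dpow_zero, hρ, terms_zero, Finset.sum_singleton, coef_zero]
    obtain ⟨x, hx⟩ := Finsupp.support_nonempty_iff.mpr hs
    have hx : (s x : ℂ) ≠ 0 := Nat.cast_ne_zero.mpr (Finsupp.mem_support_iff.mp hx)
    refine mul_left_cancel₀ hx ?_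
    rw [cumulant_recursion ρ hρ, sum_terms_recursion]
    refine Finset.sum_congr rfl fun p hp => ?_
    by_cases hpx : p.2 x = 0
    · simp [hpx]
    rw [← ih p.1.degree _ p.1 rfl]
    · rfl
    · rw [← hd, ← Finset.HasAntidiagonal.mem_antidiagonal.mp hp, map_add]
      have := Finsupp.le_degree x p.2
      omega

open scoped Classical in
-- A term splits uniquely into the class of `x`, with point set `B \ I`, and an arbitrary term on
-- the remaining points `I`, since no factor meets both.
theorem sum_terms_split (R : (X →₀ ℕ) → ℂ) (s : X →₀ ℕ) {B : Finset X} {x : X} (hx : x ∈ B) :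
    ∑ k ∈ terms (res B s), coef R k = ∑ I ∈ B.powerset,
      (∑ k ∈ terms (res I s), coef R k) * (if x ∈ B \ I then
        ∑ k ∈ (terms (res (B \ I) s)).filter (ConnOn (B \ I)), coef R k else 0) := by
  have h1 : ∀ I ∈ B.powerset, (∑ k ∈ terms (res I s), coef R k) * (if x ∈ B \ I then
        ∑ k ∈ (terms (res (B \ I) s)).filter (ConnOn (B \ I)), coef R k else 0) =
      if x ∈ B \ I then ∑ q ∈ terms (res I s) ×ˢ (terms (res (B \ I) s)).filter (ConnOn (B \ I)),
        coef R q.1 * coef R q.2 else 0 := by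
    intro I _
    split_ifs
    · rw [Finset.sum_mul_sum, Finset.sum_product]
    · rw [mul_zero]
  rw [Finset.sum_congr rfl h1, ← Finset.sum_filter, Finset.sum_sigma']
  -- the factors of the two parts are distinct
  have hdis : ∀ I ⊆ B, ∀ k₁ ∈ terms (res I s), ∀ k₂ ∈ terms (res (B \ I) s), ∀ a,
      (k₁ a ≠ 0 → a.support ⊆ I ∧ k₂ a = 0) ∧ (k₂ a ≠ 0 → a.support ⊆ B \ I ∧ k₁ a = 0 ∧
        ¬ a.support ⊆ I) := by
    intro I hI k₁ hk₁ k₂ hk₂ a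
    have e1 : k₁ a ≠ 0 → a.support ⊆ I := fun h z hz =>
      support_subset_of_mem_terms hk₁ h (Finsupp.mem_support_iff.mp hz)
    have e2 : k₂ a ≠ 0 → a.support ⊆ B \ I := fun h z hz =>
      support_subset_of_mem_terms hk₂ h (Finsupp.mem_support_iff.mp hz)
    have e3 : k₂ a ≠ 0 → ¬ a.support ⊆ I := fun h h' => by
      obtain ⟨z, hz⟩ := exists_ne_zero_of_mem_terms hk₂ h
      have hz := Finsupp.mem_support_iff.mpr hz
      exact (Finset.mem_sdiff.mp (e2 h hz)).2 (h' hz)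
    exact ⟨fun h => ⟨e1 h, by_contra fun h' => e3 h' (e1 h)⟩,
      fun h => ⟨e2 h, by_contra fun h' => e3 h (e1 h'), e3 h⟩⟩
  refine Finset.sum_bij'
    (fun k _ => ⟨B.filter fun z => ¬ Conn k x z,
      (k.filter fun a => a.support ⊆ B.filter fun z => ¬ Conn k x z,
        k.filter fun a => ¬ a.support ⊆ B.filter fun z => ¬ Conn k x z)⟩)
    (fun q _ => q.2.1 + q.2.2) ?_ ?_ ?_ ?_ ?_
  · intro k hk
    simp only [Finset.mem_sigma, Finset.mem_filter, Finset.mem_powerset, Finset.mem_product]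
    set I := B.filter fun z => ¬ Conn k x z with hI
    have hJ : ∀ z, z ∈ B \ I ↔ z ∈ B ∧ Conn k x z := fun z => by
      rw [hI, Finset.mem_sdiff, Finset.mem_filter]
      tauto
    have hsplit : k.filter (fun a => a.support ⊆ I) + k.filter (fun a => ¬ a.support ⊆ I) = k :=
      Finsupp.filter_add_filter_not k _
    have hf1 : ∀ a, k.filter (fun a => a.support ⊆ I) a ≠ 0 → k a ≠ 0 ∧ a.support ⊆ I := by
      intro a ha
      rw [Finsupp.filter_apply] at ha
      split_ifs at ha with h
      · exact ⟨ha, h⟩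
      · exact absurd rfl ha
    have hf2 : ∀ a, k.filter (fun a => ¬ a.support ⊆ I) a ≠ 0 → k a ≠ 0 ∧ a.support ⊆ B \ I := by
      intro a ha
      rw [Finsupp.filter_apply] at ha
      split_ifs at ha with h
      · exact absurd rfl ha
      · refine ⟨ha, fun z hz => ?_⟩
        have hz' := Finsupp.mem_support_iff.mp hz
        refine (hJ z).mpr ⟨support_subset_of_mem_terms hk ha hz', by_contra fun hxz => h ?_⟩
        intro y hy
        have hy' := Finsupp.mem_support_iff.mp hy
        refine Finset.mem_filter.mpr ⟨support_subset_of_mem_terms hk ha hy', fun hxy => hxz ?_⟩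
        exact hxy.trans (Conn.of_mem ha hy' hz')
    have hwt : ∀ (k' : Fac X) (S : Finset X), (∀ a, k' a ≠ 0 → a.support ⊆ S) →
        ∀ z, z ∉ S → wt k' z = 0 := by
      intro k' S h z hz
      rw [wt_apply]
      refine Finset.sum_eq_zero fun a ha => ?_
      have := fun h' => hz (h a (Finsupp.mem_support_iff.mp ha) h')
      rw [Finsupp.notMem_support_iff.mp this, mul_zero]
    have hw : ∀ z, wt (k.filter fun a => a.support ⊆ I) z +
        wt (k.filter fun a => ¬ a.support ⊆ I) z = if z ∈ B then s z else 0 := by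
      intro z
      rw [← Finsupp.add_apply, ← map_add, hsplit, (mem_terms.mp hk).2, res_apply]
    have hIB : I ⊆ B := Finset.filter_subset _ _
    refine ⟨⟨hIB, (hJ x).mpr ⟨hx, Conn.refl k x⟩⟩, mem_terms.mpr ⟨?_, ?_⟩,
      mem_terms.mpr ⟨?_, ?_⟩, ⟨x, (hJ x).mpr ⟨hx, Conn.refl k x⟩⟩, ?_⟩
    · rw [Finsupp.filter_apply, (mem_terms.mp hk).1, ite_self]
    · ext z
      rw [res_apply]
      split_ifs with hz
      · have := hw z
        rw [hwt _ _ (fun a ha => (hf2 a ha).2) z (fun h => (Finset.mem_sdiff.mp h).2 hz),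
          if_pos (hIB hz)] at this
        exact this
      · exact hwt _ _ (fun a ha => (hf1 a ha).2) z hz
    · rw [Finsupp.filter_apply, (mem_terms.mp hk).1, ite_self]
    · ext z
      rw [res_apply]
      split_ifs with hz
      · have := hw z
        obtain ⟨hzB, hzI⟩ := Finset.mem_sdiff.mp hz
        rw [hwt _ _ (fun a ha => (hf1 a ha).2) z hzI, zero_add, if_pos hzB] at this
        exact this
      · exact hwt _ _ (fun a ha => (hf2 a ha).2) z hz
    · have hxz : ∀ z ∈ B \ I, Conn (k.filter fun a => ¬ a.support ⊆ I) x z := by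
        intro z hz T hT hxT
        refine (((hJ z).mp hz).2 (T ∩ {y | Conn k x y}) ?_ ⟨hxT, Conn.refl k x⟩).1
        rintro a ha u v hu hv ⟨huT, huC⟩
        have haI : ¬ a.support ⊆ I := fun h =>
          (Finset.mem_filter.mp (h (Finsupp.mem_support_iff.mpr hu))).2 huC
        refine ⟨hT a ?_ u v hu hv huT, huC.trans (Conn.of_mem ha hu hv)⟩
        rwa [Finsupp.filter_apply, if_pos haI]
      exact fun y hy z hz => (hxz y hy).symm.trans (hxz z hz)
  · rintro ⟨I, k₁, k₂⟩ hq
    simp only [Finset.mem_sigma, Finset.mem_filter, Finset.mem_powerset,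
      Finset.mem_product] at hq ⊢
    obtain ⟨⟨hI, hxI⟩, hk₁, hk₂, hc⟩ := hq
    rw [mem_terms] at hk₁ hk₂ ⊢
    refine ⟨by rw [Finsupp.add_apply, hk₁.1, hk₂.1], ?_⟩
    rw [map_add, hk₁.2, hk₂.2]
    ext z
    by_cases hz : z ∈ I
    · simp [hz, hI hz]
    · simp [hz]
  · intro k hk
    exact Finsupp.filter_add_filter_not k _
  · rintro ⟨I, k₁, k₂⟩ hq
    simp only [Finset.mem_sigma, Finset.mem_filter, Finset.mem_powerset,
      Finset.mem_product] at hq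
    obtain ⟨⟨hI, hxI⟩, hk₁, hk₂, hc⟩ := hq
    have hd := hdis I hI k₁ hk₁ k₂ hk₂
    have hII : (B.filter fun z => ¬ Conn (k₁ + k₂) x z) = I := by
      ext z
      rw [Finset.mem_filter]
      constructor
      · rintro ⟨hz, hxz⟩
        by_contra hzI
        refine hxz ((hc.2 x hxI z (Finset.mem_sdiff.mpr ⟨hz, hzI⟩)).mono fun a ha => ?_)
        rw [Finsupp.add_apply]
        omega
      · refine fun hz => ⟨hI hz, fun h => ?_⟩
        refine (Finset.mem_sdiff.mp hxI).2 (h.symm I ?_ hz)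
        intro a ha u v hu hv huI
        by_cases h1 : k₁ a = 0
        · have h2 : k₂ a ≠ 0 := by
            rw [Finsupp.add_apply, h1, zero_add] at ha
            exact ha
          exact absurd huI (Finset.mem_sdiff.mp
            (((hd a).2 h2).1 (Finsupp.mem_support_iff.mpr hu))).2
        · exact ((hd a).1 h1).1 (Finsupp.mem_support_iff.mpr hv)
    simp only [hII]
    congr 1
    refine Prod.ext ?_ ?_
    · ext a
      simp only [Finsupp.filter_apply, Finsupp.add_apply]
      have := hd a
      by_cases h1 : k₁ a = 0 <;> by_cases h2 : k₂ a = 0 <;> simp_all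
    · ext a
      simp only [Finsupp.filter_apply, Finsupp.add_apply]
      have := hd a
      by_cases h1 : k₁ a = 0 <;> by_cases h2 : k₂ a = 0 <;> simp_all
  · intro k hk
    simp only
    rw [← coef_add_of_disjoint, Finsupp.filter_add_filter_not]
    rw [Finset.disjoint_left]
    intro a ha ha'
    rw [Finsupp.support_filter, Finset.mem_filter] at ha ha'
    exact ha'.2 ha.2

open scoped Classical in
-- The recursions of `connected_recursion` and `sum_terms_split` have the same shape. By induction
-- on `B` they agree in every summand except `I = ∅`, which carries the unknown value on all of `B`
-- with coefficient one.
theorem connected_dpow_res (ρ : Form X) (hρ : ρ 1 = 1) (s : X →₀ ℕ) {B : Finset X}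
    (hB : B ⊆ s.support) (hne : B.Nonempty) :
    connected ρ (dpow (res B s)) =
      ∑ k ∈ (terms (res B s)).filter (ConnOn B), coef (cum ρ) k := by
  induction B using Finset.strongInduction with
  | H B ih =>
    obtain ⟨x, hx⟩ := hne
    have h1 : ρ (dpow (res B s)) = ∑ I ∈ B.powerset, ρ (dpow (res I s)) *
        (if x ∈ B \ I then connected ρ (dpow (res (B \ I) s)) else 0) := by
      rw [dpow, map_smul, connected_recursion ρ hρ s hB hx, Finset.smul_sum]
      refine Finset.sum_congr rfl fun I hI => ?_
      have h2 : ffact (res B s) = ffact (res I s) * ffact (res (B \ I) s) := by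
        rw [ffact_res, ffact_res, ffact_res, mul_comm,
          Finset.prod_sdiff (Finset.mem_powerset.mp hI)]
      rw [dpow, map_smul, dpow, map_smul, h2, mul_inv]
      simp only [smul_eq_mul]
      split_ifs <;> ring
    rw [form_dpow ρ hρ, sum_terms_split (cum ρ) s hx] at h1
    simp_rw [form_dpow ρ hρ] at h1
    rw [← Finset.add_sum_erase _ _ (Finset.empty_mem_powerset B),
      ← Finset.add_sum_erase _ _ (Finset.empty_mem_powerset B)] at h1
    have h3 : ∀ I ∈ B.powerset.erase ∅,
        (∑ k ∈ terms (res I s), coef (cum ρ) k) * (if x ∈ B \ I then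
          ∑ k ∈ (terms (res (B \ I) s)).filter (ConnOn (B \ I)), coef (cum ρ) k else 0) =
        (∑ k ∈ terms (res I s), coef (cum ρ) k) *
          (if x ∈ B \ I then connected ρ (dpow (res (B \ I) s)) else 0) := by
      intro I hI
      obtain ⟨hI0, hIB⟩ := Finset.mem_erase.mp hI
      have hIB := Finset.mem_powerset.mp hIB
      split_ifs with hxI
      · rw [ih (B \ I) (Finset.sdiff_ssubset hIB (Finset.nonempty_iff_ne_empty.mpr hI0))
          (Finset.sdiff_subset.trans hB) ⟨x, hxI⟩]
      · rfl
    rw [Finset.sum_congr rfl h3, add_left_inj] at h1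
    have h4 : res (∅ : Finset X) s = 0 := by ext; simp
    rw [h4, terms_zero, Finset.sum_singleton, coef_zero, one_mul, one_mul, Finset.sdiff_empty,
      if_pos hx, if_pos hx] at h1
    exact h1.symm

theorem eval_one_cpoly (R : (X →₀ ℕ) → ℂ) (B : Finset X) (s : X →₀ ℕ) :
    (cpoly R B s).eval 1 =
      ∑ k ∈ open scoped Classical in (terms (res B s)).filter (ConnOn B), coef R k := by
  simp [cpoly, Polynomial.eval_finsetSum, Polynomial.eval_monomial]

theorem connected_dpow (ρ : Form X) (hρ : ρ 1 = 1) {s : X →₀ ℕ} (hs : s ≠ 0) :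
    connected ρ (dpow s) = (cpoly (cum ρ) s.support s).eval 1 := by
  have := connected_dpow_res ρ hρ s (Finset.Subset.refl _) (Finsupp.support_nonempty_iff.mpr hs)
  rw [eval_one_cpoly, ← this, res_eq_self (Finset.Subset.refl _)]

end DecEq

/-! ### Ordered families of factors -/

/-- The multiset of the factors of a family. -/
def msum {l : ℕ} (e : Fin l → X →₀ ℕ) : Fac X := ∑ i, Finsupp.single (e i) 1

theorem msum_cons {l : ℕ} (a : X →₀ ℕ) (e : Fin l → X →₀ ℕ) :
    msum (Fin.cons a e : Fin (l + 1) → X →₀ ℕ) = msum e + Finsupp.single a 1 := by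
  rw [msum, Fin.sum_univ_succ, add_comm]
  simp [msum]

theorem wt_msum {l : ℕ} (e : Fin l → X →₀ ℕ) : wt (msum e) = ∑ i, e i := by
  simp [msum, wt_single]

/-- Removing the index `i` removes a single copy of the factor, so equal factors at other indices
remain. -/
theorem msum_sub_apply_ne_zero_iff {l : ℕ} (e : Fin l → X →₀ ℕ) (i : Fin l) (a : X →₀ ℕ) :
    (msum e - Finsupp.single (e i) 1 : Fac X) a ≠ 0 ↔ ∃ m ∈ ({i}ᶜ : Set (Fin l)), e m = a := by
  classical
  rw [msum, ← Finset.add_sum_erase _ _ (Finset.mem_univ i), add_tsub_cancel_left,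
    Finsupp.finsetSum_apply, Ne, Finset.sum_eq_zero_iff]
  push Not
  simp [Finsupp.single_apply]

theorem msum_apply_ne_zero_iff {l : ℕ} (e : Fin l → X →₀ ℕ) (a : X →₀ ℕ) :
    msum e a ≠ 0 ↔ ∃ m ∈ (Set.univ : Set (Fin l)), e m = a := by
  classical
  rw [msum, Finsupp.finsetSum_apply, Ne, Finset.sum_eq_zero_iff]
  push Not
  simp [Finsupp.single_apply]

theorem conn_iff_reflTransGen {l : ℕ} {e : Fin l → X →₀ ℕ} {J : Set (Fin l)} {k : Fac X}
    (h : ∀ a, k a ≠ 0 ↔ ∃ m ∈ J, e m = a) (x y : X) :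
    Conn k x y ↔ Relation.ReflTransGen (Linked e J) x y := by
  constructor
  · intro hc
    refine hc {z | Relation.ReflTransGen (Linked e J) x z} ?_ Relation.ReflTransGen.refl
    intro a ha u v hu hv hxu
    obtain ⟨m, hm, rfl⟩ := (h a).mp ha
    exact hxu.tail ⟨m, hm, hu, hv⟩
  · intro hr
    induction hr with
    | refl => exact Conn.refl k x
    | tail _ hl ih =>
      obtain ⟨m, hm, hu, hv⟩ := hl
      exact ih.trans (Conn.of_mem ((h (e m)).mpr ⟨m, hm, rfl⟩) hu hv)

/-- If distinct points are joined, the first link of a chain is a factor containing `x`, and it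
belongs to both components. For equal points the chain may be trivial and involve no factor. -/
theorem disjoint_component_iff {l : ℕ} {e : Fin l → X →₀ ℕ} {J : Set (Fin l)} {k : Fac X}
    (h : ∀ a, k a ≠ 0 ↔ ∃ m ∈ J, e m = a) {x y : X} (hxy : x ≠ y) :
    Disjoint (component e J x) (component e J y) ↔ ¬ Conn k x y := by
  constructor
  · intro hd hc
    have hr := (conn_iff_reflTransGen h x y).mp hc
    rcases Relation.ReflTransGen.cases_head hr with h' | ⟨z, ⟨m, hm, hx, hz⟩, -⟩
    · exact hxy h'
    · have hdm := @Set.disjoint_left _ _ _ |>.mp hd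
      exact @hdm m ⟨hm, x, Relation.ReflTransGen.refl, hx⟩
        ⟨hm, x, (conn_iff_reflTransGen h y x).mp hc.symm, hx⟩
  · intro hc
    rw [Set.disjoint_left]
    rintro m ⟨hm, u, hu, hmu⟩ ⟨-, v, hv, hmv⟩
    refine hc (((conn_iff_reflTransGen h x u).mpr hu).trans ?_)
    exact (Conn.of_mem ((h (e m)).mpr ⟨m, hm, rfl⟩) hmu hmv).trans
      ((conn_iff_reflTransGen h y v).mpr hv).symm

theorem isConnectedTerm_iff {l : ℕ} (s : X →₀ ℕ) (e : Fin l → X →₀ ℕ) :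
    IsConnectedTerm s e ↔ ConnOn s.support (msum e) := by
  refine and_congr_right fun _ => forall₄_congr fun x _ y _ => ?_
  exact (conn_iff_reflTransGen (msum_apply_ne_zero_iff e) x y).symm

theorem red_eq_zero_iff (k : Fac X) :
    red k = 0 ↔ ∀ a, k a ≠ 0 → ¬ Bridge a (k - Finsupp.single a 1) := by
  classical
  rw [red, Finsupp.sum, Finset.sum_eq_zero_iff]
  refine forall_congr' fun a => ?_
  rw [Finsupp.mem_support_iff]
  refine forall_congr' fun ha => ?_
  split_ifs with h <;> simp [h, ha]

theorem isReducibleTerm_iff {l : ℕ} (e : Fin l → X →₀ ℕ) :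
    IsReducibleTerm e ↔ red (msum e) ≠ 0 := by
  rw [Ne, red_eq_zero_iff]
  push Not
  constructor
  · rintro ⟨i, h1, h2⟩
    refine ⟨e i, (msum_apply_ne_zero_iff e _).mpr ⟨i, trivial, rfl⟩, h1, fun x y hx hy hxy => ?_⟩
    exact (disjoint_component_iff (msum_sub_apply_ne_zero_iff e i) hxy).mp (h2 x y hx hy hxy)
  · rintro ⟨a, ha, h1, h2⟩
    obtain ⟨i, -, rfl⟩ := (msum_apply_ne_zero_iff e a).mp ha
    refine ⟨i, h1, fun x y hx hy hxy => ?_⟩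
    exact (disjoint_component_iff (msum_sub_apply_ne_zero_iff e i) hxy).mpr (h2 x y hx hy hxy)

theorem is1PITerm_iff {l : ℕ} (s : X →₀ ℕ) (e : Fin l → X →₀ ℕ) :
    Is1PITerm s e ↔ ConnOn s.support (msum e) ∧ red (msum e) = 0 := by
  rw [Is1PITerm, isConnectedTerm_iff, isReducibleTerm_iff, not_not]

section DecEq

variable [DecidableEq X]

/-- The total multiplicity `l + 1` is the number of ways to mark a factor. This matches splitting
off the first member of an ordered family. -/
theorem sum_finsuppAntidiag_succ (R : (X →₀ ℕ) → ℂ) (S : Finset (X →₀ ℕ)) (l : ℕ)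
    (G : Fac X → ℂ) :
    ((l : ℂ) + 1) * ∑ k ∈ S.finsuppAntidiag (l + 1), coef R k * G k =
      ∑ a ∈ S, R a * ∑ k ∈ S.finsuppAntidiag l, coef R k * G (k + Finsupp.single a 1) := by
  have h1 : ∀ k ∈ S.finsuppAntidiag (l + 1), ((l : ℂ) + 1) * (coef R k * G k) =
      ∑ a ∈ k.support, R a * (coef R (k - Finsupp.single a 1) * G k) := by
    intro k hk
    obtain ⟨hk, hkS⟩ := Finset.mem_finsuppAntidiag.mp hk
    have h2 : ((l : ℂ) + 1) = ∑ a ∈ k.support, (k a : ℂ) := by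
      rw [Finset.sum_subset hkS fun a _ ha => by simp [Finsupp.notMem_support_iff.mp ha]]
      exact_mod_cast hk.symm
    rw [h2, Finset.sum_mul]
    refine Finset.sum_congr rfl fun a ha => ?_
    rw [← mul_assoc, ← mul_assoc, ← coef_mul_apply R k (Finsupp.mem_support_iff.mp ha)]
    ring
  rw [Finset.mul_sum, Finset.sum_congr rfl h1]
  simp_rw [Finset.mul_sum]
  rw [Finset.sum_sigma', Finset.sum_sigma']
  have hsum : ∀ (k : Fac X), ∀ a ∈ S, S.sum (k + Finsupp.single a 1 : Fac X) = S.sum k + 1 := by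
    intro k a ha
    rw [Finsupp.coe_add]
    simp only [Pi.add_apply]
    rw [Finset.sum_add_distrib]
    simp [Finsupp.single_apply, ha]
  refine Finset.sum_bij' (fun q _ => ⟨q.2, q.1 - Finsupp.single q.2 1⟩)
    (fun q _ => ⟨q.2 + Finsupp.single q.1 1, q.1⟩) ?_ ?_ ?_ ?_ ?_
  · rintro ⟨k, a⟩ hq
    simp only [Finset.mem_sigma, Finset.mem_finsuppAntidiag, Finsupp.mem_support_iff] at hq ⊢
    obtain ⟨⟨hk, hkS⟩, ha⟩ := hq
    have haS := hkS (Finsupp.mem_support_iff.mpr ha)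
    have hka := tsub_add_cancel_of_le (single_le_of_ne_zero ha)
    refine ⟨haS, ?_, fun b hb => hkS ?_⟩
    · have := hsum (k - Finsupp.single a 1) a haS
      rw [hka, hk] at this
      omega
    · rw [Finsupp.mem_support_iff, Finsupp.tsub_apply] at hb
      rw [Finsupp.mem_support_iff]
      omega
  · rintro ⟨a, k⟩ hq
    simp only [Finset.mem_sigma, Finset.mem_finsuppAntidiag, Finsupp.mem_support_iff] at hq ⊢
    obtain ⟨ha, hk, hkS⟩ := hq
    refine ⟨⟨by rw [hsum k a ha, hk], fun b hb => ?_⟩, by simp⟩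
    by_cases hba : b = a
    · exact hba ▸ ha
    · refine hkS ?_
      rw [Finsupp.mem_support_iff] at hb ⊢
      rwa [Finsupp.add_apply, Finsupp.single_eq_of_ne hba, add_zero] at hb
  · rintro ⟨k, a⟩ hq
    simp only [Finset.mem_sigma, Finsupp.mem_support_iff] at hq
    simp only
    rw [tsub_add_cancel_of_le (single_le_of_ne_zero hq.2)]
  · rintro ⟨a, k⟩ _
    simp only
    rw [add_tsub_cancel_right]
  · rintro ⟨k, a⟩ hq
    simp only [Finset.mem_sigma, Finsupp.mem_support_iff] at hq
    simp only
    rw [tsub_add_cancel_of_le (single_le_of_ne_zero hq.2)]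

/-- The sum over the ordered families of `l` factors is `l!` times the sum over the multisets. -/
theorem sum_piFinset_eq (R : (X →₀ ℕ) → ℂ) (S : Finset (X →₀ ℕ)) (l : ℕ) (G : Fac X → ℂ) :
    ∑ e ∈ Fintype.piFinset (fun _ : Fin l => S), (∏ i, R (e i)) * G (msum e) =
      l.factorial * ∑ k ∈ S.finsuppAntidiag l, coef R k * G k := by
  induction l generalizing G with
  | zero => simp [msum]
  | succ l ih =>
    rw [Nat.factorial_succ, Nat.cast_mul, mul_comm ((l + 1 : ℕ) : ℂ), mul_assoc, Nat.cast_add,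
      Nat.cast_one, sum_finsuppAntidiag_succ, Finset.mul_sum]
    have h1 : ∀ a ∈ S, (l.factorial : ℂ) * (R a * ∑ k ∈ S.finsuppAntidiag l,
        coef R k * G (k + Finsupp.single a 1)) =
        ∑ e ∈ Fintype.piFinset (fun _ : Fin l => S),
          R a * ((∏ i, R (e i)) * G (msum e + Finsupp.single a 1)) := by
      intro a _
      rw [← Finset.mul_sum, ih fun k => G (k + Finsupp.single a 1)]
      ring
    rw [Finset.sum_congr rfl h1, ← Finset.sum_product']
    refine Finset.sum_nbij' (fun e => (e 0, Fin.tail e)) (fun q => Fin.cons q.1 q.2) ?_ ?_ ?_ ?_ ?_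
    · intro e he
      simp only [Fintype.mem_piFinset, Finset.mem_product] at he ⊢
      exact ⟨he 0, fun i => he i.succ⟩
    · rintro ⟨a, e⟩ hq
      simp only [Fintype.mem_piFinset, Finset.mem_product] at hq ⊢
      exact fun i => Fin.cases hq.1 hq.2 i
    · intro e _
      exact Fin.cons_self_tail e
    · rintro ⟨a, e⟩ _
      simp
    · intro e _
      have h2 : msum e = msum (Fin.tail e) + Finsupp.single (e 0) 1 := by
        rw [← msum_cons, Fin.cons_self_tail]
      rw [Fin.prod_univ_succ, h2, mul_assoc]
      rfl

theorem cumulant_monomial (ρ : Form X) (a : X →₀ ℕ) :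
    cumulant ρ (MvPolynomial.monomial a 1) = ffact a * cum ρ a := by
  rw [monomial_eq_smul_dpow, map_smul, smul_eq_mul, cum]

theorem cum_zero (ρ : Form X) : cum ρ 0 = 0 := by
  rw [cum, cumulant_dpow]
  simp

/-- The multinomial coefficients are exactly the change from monomials to divided powers. -/
theorem multinomial_mul_prod (ρ : Form X) {l : ℕ} {s : X →₀ ℕ} {e : Fin l → X →₀ ℕ}
    (he : ∑ i, e i = s) :
    ((∏ x ∈ s.support, Nat.multinomial Finset.univ (fun i => e i x) : ℕ) : ℂ) *
        ∏ i, cumulant ρ (MvPolynomial.monomial (e i) 1) = ffact s * ∏ i, cum ρ (e i) := by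
  have h1 : ∀ i, ffact (e i) = ∏ x ∈ s.support, ((e i x).factorial : ℂ) := fun i => by
    refine ffact_eq_prod fun x hx => ?_
    rw [Finsupp.mem_support_iff] at hx ⊢
    rw [← he, Finsupp.finsetSum_apply]
    have := Finset.single_le_sum (f := fun i => e i x) (fun _ _ => Nat.zero_le _)
      (Finset.mem_univ i)
    exact fun h => hx (Nat.le_zero.mp (h ▸ this))
  have h2 : ffact s = (∏ i, ffact (e i)) *
      ((∏ x ∈ s.support, Nat.multinomial Finset.univ (fun i => e i x) : ℕ) : ℂ) := by
    simp_rw [h1]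
    rw [Finset.prod_comm, Nat.cast_prod, ← Finset.prod_mul_distrib, ffact]
    refine Finset.prod_congr rfl fun x _ => ?_
    have := Nat.multinomial_spec Finset.univ (fun i => e i x)
    rw [← Finsupp.finsetSum_apply, he] at this
    exact_mod_cast this.symm
  simp_rw [cumulant_monomial]
  rw [Finset.prod_mul_distrib, h2]
  ring

open scoped Classical in
-- Being 1PI depends only on the multiset of factors, so the prefactor `1 / l!` cancels against the
-- `l!` of `sum_piFinset_eq`.
theorem onePI_dpow (ρ : Form X) (s : X →₀ ℕ) :
    onePI ρ (dpow s) = ∑ k ∈ (terms s).filter (fun k => ConnOn s.support k ∧ red k = 0),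
      coef (cum ρ) k := by
  set S : Finset (X →₀ ℕ) := (Finset.Iic s).erase 0 with hS
  let G : Fac X → ℂ := fun k => if wt k = s ∧ ConnOn s.support k ∧ red k = 0 then 1 else 0
  have hl : ∀ l : ℕ, (ffact s)⁻¹ * (((l.factorial : ℂ))⁻¹ *
      ∑ e ∈ (Finset.piAntidiag (Finset.univ : Finset (Fin l)) s).filter (fun e => Is1PITerm s e),
        ((∏ x ∈ s.support, Nat.multinomial Finset.univ (fun i => e i x) : ℕ) : ℂ) *
          ∏ i, cumulant ρ (MvPolynomial.monomial (e i) 1)) =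
      ∑ k ∈ S.finsuppAntidiag l, coef (cum ρ) k * G k := by
    intro l
    have h0 : (l.factorial : ℂ) ≠ 0 := Nat.cast_ne_zero.mpr (Nat.factorial_ne_zero _)
    have h1 : ∑ e ∈ (Finset.piAntidiag (Finset.univ : Finset (Fin l)) s).filter
          (fun e => Is1PITerm s e),
        ((∏ x ∈ s.support, Nat.multinomial Finset.univ (fun i => e i x) : ℕ) : ℂ) *
          ∏ i, cumulant ρ (MvPolynomial.monomial (e i) 1) =
        ffact s * ∑ e ∈ Fintype.piFinset (fun _ : Fin l => S),
          (∏ i, cum ρ (e i)) * G (msum e) := by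
      rw [Finset.mul_sum]
      have h2 : ∀ e ∈ (Finset.piAntidiag (Finset.univ : Finset (Fin l)) s).filter
          (fun e => Is1PITerm s e),
          ((∏ x ∈ s.support, Nat.multinomial Finset.univ (fun i => e i x) : ℕ) : ℂ) *
            ∏ i, cumulant ρ (MvPolynomial.monomial (e i) 1) =
          ffact s * ((∏ i, cum ρ (e i)) * G (msum e)) := by
        intro e he
        rw [Finset.mem_filter, Finset.mem_piAntidiag, is1PITerm_iff] at he
        have hG : G (msum e) = 1 := if_pos ⟨by rw [wt_msum]; exact he.1.1, he.2⟩
        rw [multinomial_mul_prod ρ he.1.1, hG, mul_one]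
      rw [Finset.sum_congr rfl h2]
      refine Finset.sum_congr_of_eq_on_inter ?_ ?_ fun _ _ _ => rfl
      -- A family outside `S` contains the trivial monomial, whose cumulant is zero.
      · intro e he he'
        have : ∃ i, e i = 0 := by
          by_contra! hne
          refine he' (Fintype.mem_piFinset.mpr fun i => Finset.mem_erase.mpr ⟨hne i, ?_⟩)
          rw [Finset.mem_Iic, ← (Finset.mem_piAntidiag.mp (Finset.mem_filter.mp he).1).1]
          exact Finset.single_le_sum (fun _ _ => zero_le) (Finset.mem_univ i)
        obtain ⟨i, hi⟩ := this
        rw [Finset.prod_eq_zero (Finset.mem_univ i) (by rw [hi, cum_zero]), zero_mul, mul_zero]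
      · intro e _ he'
        have hG : G (msum e) = 0 := by
          refine if_neg fun h => he' ?_
          rw [Finset.mem_filter, Finset.mem_piAntidiag, is1PITerm_iff]
          rw [wt_msum] at h
          exact ⟨⟨h.1, fun i _ => Finset.mem_univ i⟩, h.2⟩
        rw [hG, mul_zero, mul_zero]
    rw [h1, sum_piFinset_eq, mul_left_comm, ← mul_assoc (ffact s)⁻¹,
      inv_mul_cancel₀ (ffact_ne_zero s), one_mul, ← mul_assoc, inv_mul_cancel₀ h0, one_mul]
  rw [dpow, map_smul, onePI, onMonomials_monomial, smul_eq_mul, Finset.mul_sum]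
  have hterm : ∀ k ∈ terms s, k.support ⊆ S := by
    intro k hk a ha
    rw [Finsupp.mem_support_iff] at ha
    rw [hS, Finset.mem_erase, Finset.mem_Iic, ← (mem_terms.mp hk).2]
    exact ⟨by rintro rfl; exact ha (mem_terms.mp hk).1, le_wt' ha⟩
  -- Nontrivial factors have degree at least one, so the range of `l` in `onePI` covers every term.
  have hdeg : ∀ k ∈ terms s, S.sum k ≤ s.degree := by
    intro k hk
    have h3 : s.degree = ∑ a ∈ S, k a * a.degree := by
      rw [← Finset.sum_subset (hterm k hk) (fun a _ ha => by
        rw [Finsupp.notMem_support_iff.mp ha, zero_mul])]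
      rw [← (mem_terms.mp hk).2, wt, Finsupp.weight_apply, Finsupp.sum, map_sum]
      simp
    rw [h3]
    refine Finset.sum_le_sum fun a ha => Nat.le_mul_of_pos_right _ (Nat.pos_of_ne_zero ?_)
    rw [Ne, Finsupp.degree_eq_zero_iff]
    exact (Finset.mem_erase.mp ha).1
  rw [← Finset.sum_fiberwise_of_maps_to (t := Finset.range (s.degree + 1))
    (g := fun k : Fac X => S.sum k) fun k hk => Finset.mem_range.mpr
      (Nat.lt_succ_of_le (hdeg k (Finset.mem_filter.mp hk).1))]
  refine Finset.sum_congr rfl fun l _ => ?_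
  refine (Eq.trans ?_ (hl l)).trans ?_
  · congr!
  · simp only [G, mul_ite, mul_one, mul_zero]
    rw [← Finset.sum_filter]
    refine Finset.sum_congr ?_ fun _ _ => rfl
    ext k
    simp only [Finset.mem_filter, Finset.mem_finsuppAntidiag, mem_terms]
    constructor
    · rintro ⟨⟨h1, h2⟩, h3, h4⟩
      refine ⟨⟨⟨?_, h3⟩, h4⟩, h1⟩
      by_contra h0
      exact (Finset.mem_erase.mp (h2 (Finsupp.mem_support_iff.mpr h0))).1 rfl
    · rintro ⟨⟨h1, h2⟩, h3⟩
      exact ⟨⟨h3, hterm k (mem_terms.mpr h1)⟩, h1.2, h2⟩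

theorem eval_zero_cpoly (R : (X →₀ ℕ) → ℂ) (B : Finset X) (s : X →₀ ℕ) :
    (cpoly R B s).eval 0 =
      ∑ k ∈ open scoped Classical in (terms (res B s)).filter (fun k => ConnOn B k ∧ red k = 0),
        coef R k := by
  classical
  rw [cpoly, Polynomial.eval_finsetSum, ← Finset.filter_filter]
  rw [Finset.sum_filter (fun k => red k = 0)]
  refine Finset.sum_congr (by congr!) fun k _ => ?_
  rw [Polynomial.eval_monomial]
  split_ifs with h <;> simp [h]

theorem onePI_dpow_eq_eval (ρ : Form X) (s : X →₀ ℕ) :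
    onePI ρ (dpow s) = (cpoly (cum ρ) s.support s).eval 0 := by
  rw [eval_zero_cpoly, res_eq_self (Finset.Subset.refl _), onePI_dpow]

end DecEq

/-! ### The interpolating character -/

section DecEq

variable [DecidableEq X]

/-- The form with polynomial values which interpolates between `ρ_I` and `ρ_c`, with value `1`
at the unit. -/
def polyForm (ρ : Form X) : U X →ₗ[ℂ] Polynomial ℂ :=
  onMonomials fun s => if s = 0 then 1 else ffact s • cpoly (cum ρ) s.support s

theorem polyForm_dpow (ρ : Form X) (s : X →₀ ℕ) :
    polyForm ρ (dpow s) = if s = 0 then 1 else cpoly (cum ρ) s.support s := by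
  rw [dpow, map_smul, polyForm, onMonomials_monomial]
  split_ifs with h
  · simp [h]
  · rw [smul_smul, inv_mul_cancel₀ (ffact_ne_zero s), one_smul]

/-- The interpolating character of `S(U)`. -/
def polyChar (ρ : Form X) : SU X →ₐ[ℂ] Polynomial ℂ := SymmetricAlgebra.lift (polyForm ρ)

theorem polyChar_ι (ρ : Form X) (u : U X) :
    polyChar ρ (SymmetricAlgebra.ι ℂ (U X) u) = polyForm ρ u :=
  SymmetricAlgebra.lift_ι_apply (polyForm ρ) u

theorem cpoly_congr (R : (X →₀ ℕ) → ℂ) {B : Finset X} {s t : X →₀ ℕ} (h : res B s = res B t) :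
    cpoly R B s = cpoly R B t := by
  rw [cpoly, cpoly, h]

/-- The convention in `piece` mirrors connectedness. A point that occurs in no factor is a class by
itself, so it must be all of `B`; the only term is then the empty one, of weight 1, the value at the
unit of `U`. -/
theorem polyChar_piece (ρ : Form X) {B : Finset X} (hB : B.Nonempty) (s : X →₀ ℕ) :
    polyChar ρ (piece B s) = cpoly (cum ρ) B s := by
  classical
  rw [piece]
  by_cases h1 : (res B s).support = B
  · have h0 : res B s ≠ 0 := by
      rw [← Finsupp.support_nonempty_iff, h1]
      exact hB
    rw [if_pos (Or.inl h1), polyChar_ι, polyForm_dpow, if_neg h0, h1]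
    exact cpoly_congr _ (res_res_of_subset (Finset.Subset.refl B) s)
  by_cases h2 : B.card = 1 ∧ res B s = 0
  · rw [if_pos (Or.inr h2), polyChar_ι, polyForm_dpow, if_pos h2.2, cpoly, h2.2, terms_zero]
    obtain ⟨x, rfl⟩ := Finset.card_eq_one.mp h2.1
    have hc : ConnOn {x} (0 : Fac X) := by
      refine ⟨⟨x, Finset.mem_singleton_self x⟩, fun y hy z hz => ?_⟩
      rw [Finset.mem_singleton.mp hy, Finset.mem_singleton.mp hz]
      exact Conn.refl _ _
    rw [Finset.filter_singleton, if_pos hc, Finset.sum_singleton]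
    simp [red]
  · rw [if_neg (by tauto), map_zero, cpoly, Finset.sum_eq_zero]
    intro k hk
    exfalso
    obtain ⟨hk, hc⟩ := Finset.mem_filter.mp hk
    obtain ⟨z, hz, hzs⟩ : ∃ z ∈ B, z ∉ (res B s).support := by
      by_contra! h
      exact h1 (Finset.Subset.antisymm (support_res_subset B s) h)
    rw [Finsupp.notMem_support_iff] at hzs
    have hB1 : B = {z} := by
      refine Finset.eq_singleton_iff_unique_mem.mpr ⟨hz, fun y hy => ?_⟩
      refine hc.2 z hz y hy {z} ?_ rfl
      rintro a ha u v hu - rfl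
      have := le_wt' ha u
      rw [(mem_terms.mp hk).2, hzs] at this
      exact absurd (Nat.le_zero.mp this) hu
    refine h2 ⟨by rw [hB1, Finset.card_singleton], ?_⟩
    ext y
    by_cases hy : y ∈ B
    · rw [hB1, Finset.mem_singleton] at hy
      rw [hy, hzs, Finsupp.zero_apply]
    · simp [hy]

theorem connected_one (ρ : Form X) : connected ρ 1 = 0 := by
  have : (1 : U X) = MvPolynomial.monomial 0 1 := rfl
  rw [this, connected, convLog, onMonomials_monomial]
  simp

theorem onePI_one (ρ : Form X) : onePI ρ 1 = 0 := by
  classical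
  rw [← dpow_zero, onePI_dpow]
  refine Finset.sum_eq_zero fun k hk => ?_
  obtain ⟨x, hx⟩ := (Finset.mem_filter.mp hk).2.1.1
  simp at hx

/-- The specialization of the interpolating character at a point. -/
theorem eval_polyChar (ρ : Form X) (z : ℂ) (f : Form X) (h0 : f 1 = 0)
    (hf : ∀ s : X →₀ ℕ, s ≠ 0 → f (dpow s) = (cpoly (cum ρ) s.support s).eval z) (w : SU X) :
    (polyChar ρ w).eval z = character f w := by
  have h : (Polynomial.aeval (R := ℂ) z).comp (polyChar ρ) = character f := by
    apply SymmetricAlgebra.algHom_ext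
    refine linearMap_ext_monomial fun s => ?_
    rw [monomial_eq_smul_dpow, map_smul, map_smul]
    congr 1
    change Polynomial.aeval z (polyChar ρ (SymmetricAlgebra.ι ℂ (U X) (dpow s))) =
      SymmetricAlgebra.lift (f + counit X) (SymmetricAlgebra.ι ℂ (U X) (dpow s))
    rw [polyChar_ι, SymmetricAlgebra.lift_ι_apply, polyForm_dpow, LinearMap.add_apply]
    have hc : counit X (dpow s) = if s = 0 then 1 else 0 := by
      rw [dpow, map_smul, counit_monomial]
      split_ifs with hs <;> simp [hs]
    rw [hc]
    split_ifs with hs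
    · rw [hs, dpow_zero, h0, map_one, zero_add]
    · rw [hf s hs, add_zero, Polynomial.coe_aeval_eq_eval]
  rw [← h, AlgHom.comp_apply, Polynomial.coe_aeval_eq_eval]

theorem eval_one_comp_polyChar (ρ : Form X) (hρ : ρ 1 = 1) (w : SU X) :
    (polyChar ρ w).eval 1 = character (connected ρ) w :=
  eval_polyChar ρ 1 _ (connected_one ρ) (fun _ hs => connected_dpow ρ hρ hs) w

theorem eval_zero_comp_polyChar (ρ : Form X) (w : SU X) :
    (polyChar ρ w).eval 0 = character (onePI ρ) w :=
  eval_polyChar ρ 0 _ (onePI_one ρ) (fun s _ => onePI_dpow_eq_eval ρ s) w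

end DecEq

/-! ### The differential equation and Taylor's formula -/

section Order

variable [LinearOrder X] (ρ : Form X)

theorem cum_ind (P : Finset X) : cum ρ (ind P) = prop ρ P := by
  rw [cum, prop, dpow, ffact_ind, inv_one, one_smul]

/-- `derivative_cpoly` and `A_piece` are the same sum over `P`, the second grouped by `P.card = n +
1`. -/
theorem derivative_polyChar_piece {B : Finset X} (hB : B.Nonempty) (s : X →₀ ℕ) :
    Polynomial.derivative (polyChar ρ (piece B s)) = polyChar ρ (sumA ρ (piece B s)) := by
  classical
  have hN : piece B s ∈ degFil X (max (∑ x ∈ B, s x) B.card : ℕ) :=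
    degFil_mono (by exact_mod_cast le_max_left _ _) (piece_mem_degFil B s)
  -- The bound must exceed the degree, for the sum of the `A_n` to be complete, and reach the number
  -- of points, for every subset `P` to be counted.
  set N := max (∑ x ∈ B, s x) B.card
  have hg : ∀ P ⊆ B, ∀ g ∈ retr B P, ∏ x ∈ P, polyChar ρ (piece (fib B g x) (s - ind P)) =
      ∏ x ∈ P, cpoly (cum ρ) (fib B g x) (s - ind P) := fun P hP g hg =>
    Finset.prod_congr rfl fun x hx =>
      polyChar_piece ρ ⟨x, mem_fib.mpr ⟨hP hx, (mem_retr.mp hg).2.2 x hx⟩⟩ _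
  rw [polyChar_piece ρ hB, derivative_cpoly, sumA_eq_sum ρ le_rfl hN, map_sum,
    Finset.sum_filter]
  have h1 : ∀ n, polyChar ρ (A ρ n (piece B s)) = ∑ P ∈ B.powerset.filter (·.card = n + 1),
      if P.Nonempty ∧ ind P ≤ s then Polynomial.C (cum ρ (ind P)) *
        ∑ g ∈ retr B P, ∏ x ∈ P, cpoly (cum ρ) (fib B g x) (s - ind P) else 0 := by
    intro n
    rw [A_piece, ← Finset.powersetCard_eq_filter, map_sum]
    refine Finset.sum_congr rfl fun P hP => ?_
    obtain ⟨hPB, hPc⟩ := Finset.mem_powersetCard.mp hP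
    have hP : P.Nonempty := Finset.card_pos.mp (by omega)
    rw [apply_ite (polyChar ρ), map_zero]
    simp only [hP, true_and]
    congr 1
    rw [map_smul, map_sum, Polynomial.smul_eq_C_mul, cum_ind]
    congr 1
    exact Finset.sum_congr rfl fun g hgg => by rw [map_prod, hg P hPB g hgg]
  simp_rw [h1]
  rw [← Finset.sum_filter_of_ne (s := B.powerset) (p := fun P => P.Nonempty)
    fun P _ h => by_contra fun h' => h (if_neg fun h'' => h' h''.1)]
  rw [← Finset.sum_fiberwise_of_maps_to (t := Finset.range N) (g := fun P => P.card - 1)]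
  · refine Finset.sum_congr rfl fun n _ => Finset.sum_congr ?_ fun _ _ => rfl
    ext P
    simp only [Finset.mem_filter, ← Finset.card_pos]
    constructor
    · rintro ⟨⟨h2, h3⟩, h4⟩
      exact ⟨h2, by omega⟩
    · rintro ⟨h2, h3⟩
      exact ⟨⟨h2, by omega⟩, by omega⟩
  · intro P hP
    obtain ⟨h2, h3⟩ := Finset.mem_filter.mp hP
    have h4 := Finset.card_le_card (Finset.mem_powerset.mp h2)
    have h5 := Finset.card_pos.mpr h3
    have h6 : B.card ≤ N := le_max_right _ _
    rw [Finset.mem_range]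
    omega

/-- Both sides obey the Leibniz rule along `polyChar`, so monomials suffice. -/
theorem derivative_polyChar (w : SU X) :
    Polynomial.derivative (polyChar ρ w) = polyChar ρ (sumA ρ w) := by
  rw [← sumADer_apply]
  induction w using SU_induction with
  | h1 => simp
  | hmul s w hw =>
    rw [Derivation.leibniz, map_mul, Polynomial.derivative_mul, hw, map_add, smul_eq_mul,
      smul_eq_mul, map_mul, map_mul, add_comm, mul_comm (polyChar ρ w)]
    congr 2
    -- The unit of `U` is apart, as its set of points is empty: its image is the constant 1, and the
    -- derivations kill it for reasons of degree.
    by_cases hs : s = 0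
    · subst hs
      have h1 : sumADer ρ (SymmetricAlgebra.ι ℂ (U X) (MvPolynomial.monomial 0 1)) = 0 := by
        refine eq_zero_of_mem_degFil (d := (0 : ℤ) - 1) (by omega) (sumA_mem_degFil ρ ?_)
        simpa using ι_mem_degFil (X := X) 0
      rw [h1, map_zero, polyChar_ι, polyForm, onMonomials_monomial, if_pos rfl,
        Polynomial.derivative_one]
    · rw [monomial_eq_piece, Derivation.map_smul, map_smul, map_smul, map_smul,
        derivative_polyChar_piece ρ (Finsupp.support_nonempty_iff.mpr hs), sumADer_apply]
  | hadd v w hv hw => simp only [map_add, hv, hw]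
  | hsmul c w hw => simp only [map_smul, Derivation.map_smul, hw]

theorem iterate_derivative_polyChar (k : ℕ) (w : SU X) :
    Polynomial.derivative^[k] (polyChar ρ w) = polyChar ρ ((sumA ρ)^[k] w) := by
  induction k with
  | zero => rfl
  | succ k ih => rw [Function.iterate_succ_apply', ih, derivative_polyChar,
      Function.iterate_succ_apply']

theorem eval_add_eq_sum (p : Polynomial ℂ) (a b : ℂ) {N : ℕ}
    (hN : ∀ k, N ≤ k → Polynomial.derivative^[k] p = 0) :
    p.eval (a + b) = ∑ k ∈ Finset.range N,
      ((k.factorial : ℂ))⁻¹ * ((Polynomial.derivative^[k] p).eval a * b ^ k) := by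
  have h1 : ∀ k, (Polynomial.taylor a p).coeff k =
      ((k.factorial : ℂ))⁻¹ * (Polynomial.derivative^[k] p).eval a := by
    intro k
    have h0 : (k.factorial : ℂ) ≠ 0 := Nat.cast_ne_zero.mpr (Nat.factorial_ne_zero _)
    rw [Polynomial.taylor_coeff, ← Polynomial.factorial_smul_hasseDeriv, eq_inv_mul_iff_mul_eq₀ h0]
    simp
  have h2 : (Polynomial.taylor a p).natDegree < max N ((Polynomial.taylor a p).natDegree + 1) :=
    lt_of_lt_of_le (Nat.lt_succ_self _) (le_max_right _ _)
  rw [add_comm, ← Polynomial.taylor_eval, Polynomial.eval_eq_sum_range' h2]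
  symm
  refine (Finset.sum_subset (Finset.range_subset_range.mpr (le_max_left _ _)) fun k _ hk => ?_).trans
    (Finset.sum_congr rfl fun k _ => ?_)
  · rw [hN k (by simpa using hk)]
    simp
  · rw [h1, mul_assoc]

theorem iterate_neg_sumA (k : ℕ) (w : SU X) :
    (fun v => -sumA ρ v)^[k] w = (-1 : ℂ) ^ k • (sumA ρ)^[k] w := by
  induction k with
  | zero => simp
  | succ k ih =>
    rw [Function.iterate_succ_apply', ih, Function.iterate_succ_apply', ← sumADer_apply,
      Derivation.map_smul, sumADer_apply, pow_succ, mul_neg_one, neg_smul]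

/-- Taylor's formula for `polyChar ρ w` at 0 with increment 1: the derivatives at 0 are the values
of `ρ_I` at the iterates of the sum of the `A_n`. -/
theorem connected_eq_onePI_comp_locExp (hρ : ρ 1 = 1) (w : SU X) :
    character (connected ρ) w = character (onePI ρ) (locExp (sumA ρ) w) := by
  obtain ⟨d, hd⟩ := exists_mem_degFil w
  have hz : ∀ k, d + 1 ≤ k → (sumA ρ)^[k] w = 0 := fun k hk => iterate_sumA_eq_zero ρ hk hd
  rw [locExp_eq_sum hz, ← eval_one_comp_polyChar ρ hρ, ← zero_add (1 : ℂ),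
    eval_add_eq_sum _ _ _ (N := d + 1) fun k hk => by
      rw [iterate_derivative_polyChar, hz k hk, map_zero], map_sum]
  refine Finset.sum_congr rfl fun k _ => ?_
  rw [iterate_derivative_polyChar, eval_zero_comp_polyChar, map_smul, one_pow, mul_one, smul_eq_mul]

/-- Taylor's formula at 1 with increment -1; no inversion of the exponential is needed. -/
theorem onePI_eq_connected_comp_locExp (hρ : ρ 1 = 1) (w : SU X) :
    character (onePI ρ) w = character (connected ρ) (locExp (fun v => -sumA ρ v) w) := by
  obtain ⟨d, hd⟩ := exists_mem_degFil w
  have hz : ∀ k, d + 1 ≤ k → (sumA ρ)^[k] w = 0 := fun k hk => iterate_sumA_eq_zero ρ hk hd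
  rw [locExp_eq_sum (N := d + 1) fun k hk => by rw [iterate_neg_sumA, hz k hk, smul_zero],
    ← eval_zero_comp_polyChar ρ, ← add_neg_cancel (1 : ℂ),
    eval_add_eq_sum _ _ _ (N := d + 1) fun k hk => by
      rw [iterate_derivative_polyChar, hz k hk, map_zero], map_sum]
  refine Finset.sum_congr rfl fun k _ => ?_
  rw [iterate_derivative_polyChar, eval_one_comp_polyChar ρ hρ, iterate_neg_sumA, map_smul,
    map_smul, smul_eq_mul, smul_eq_mul, mul_comm ((-1) ^ k)]

end Order

end ConnForm

end

/-! ### The theorem -/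

theorem theorem8p1 {X : Type*} [LinearOrder X] (ρ : ConnForm.Form X) (hρ : ρ 1 = 1) :
    (∀ (m n : ℕ) (w : ConnForm.SU X),
      ConnForm.A ρ m (ConnForm.A ρ n w) = ConnForm.A ρ n (ConnForm.A ρ m w)) ∧
    (∀ w : ConnForm.SU X,
      {n : ℕ | ConnForm.A ρ n w ≠ 0}.Finite ∧
      {k : ℕ | (ConnForm.sumA ρ)^[k] w ≠ 0}.Finite ∧
      {p : ℕ × ℕ | ConnForm.L ρ p.1 p.2 w ≠ 0}.Finite) ∧
    (ConnForm.connected ρ 1 = 0 ∧ ConnForm.onePI ρ 1 = 0) ∧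
    (∀ w : ConnForm.SU X,
      ConnForm.character (ConnForm.connected ρ) w =
        ConnForm.character (ConnForm.onePI ρ) (ConnForm.locExp (ConnForm.sumA ρ) w)) ∧
    (∀ w : ConnForm.SU X,
      ConnForm.character (ConnForm.connected ρ) w =
        ConnForm.character (ConnForm.onePI ρ) (ConnForm.Ltot ρ w)) ∧
    (∀ w : ConnForm.SU X,
      ConnForm.character (ConnForm.onePI ρ) w =
        ConnForm.character (ConnForm.connected ρ)
          (ConnForm.locExp (fun v => -ConnForm.sumA ρ v) w)) := by
  refine ⟨ConnForm.A_comm ρ, fun w => ⟨ConnForm.finite_A ρ w, ConnForm.finite_iterate_sumA ρ w,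
    ConnForm.finite_L ρ w⟩, ⟨ConnForm.connected_one ρ, ConnForm.onePI_one ρ⟩,
    ConnForm.connected_eq_onePI_comp_locExp ρ hρ, fun w => ?_,
    ConnForm.onePI_eq_connected_comp_locExp ρ hρ⟩
  rw [ConnForm.Ltot_eq_locExp]
  exact ConnForm.connected_eq_onePI_comp_locExp ρ hρ w
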